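/- **Bilinear estimates for free Klein–Gordon waves.** Let $n\ge 3$. *Conventions.* Dyadic numbers are $0$ and $2^k$, $k\in\mathbb N=\{0,1,2,\dots\}$; the dyadic number $0$ stands for the frequencies below $1$, and its size is counted as $1$: write $[N]=\max(1,N)$. Fix a cutoff $\chi\in C_0^\infty(-2,2)$, even, nonnegative, with $\chi=1$ on $[-1,1]$. For $N=2^k$ let $P_N$ and $P_{\le N}$ be the Fourier multipliers in $x\in\mathbb R^n$ with symbols $\chi(|\xi|/N)-\chi(2|\xi|/N)$ and $\chi(|\xi|/N)$, and let $P_0=P_{\le 0}$ have the symbol $\chi(2|\xi|)$. For $m>0$ put $\langle\xi\rangle_m=\sqrt{m^2+|\xi|^2}$, and let $e^{\pm it\langle D\rangle_m}$ be the Fourier multiplier with symbol $e^{\pm it\langle \xi\rangle_m}$. Fix $a\ge1$, the implicit constant in the localization: $|\xi|\sim N$ means $N/a\le|\xi|\le aN$ if $N=2^k$, and $|\xi|\le a$ if $N=0$. A function in $L^2(\mathbb R^n;\mathbb C)$ is localized at frequency $N$ if its Fourier transform vanishes a.e. off $\{|\xi|\sim N\}$. For $\kappa>0$, $M\sim_\kappa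 N$ means $[M]\le\kappa[N]$ and $[N]\le\kappa[M]$. For dyadic $O,M,N$ put $H=\max([O],[M],[N])$ and $L=\min([O],[M],[N])$. All products below are of complex-valued functions, and $L^2=L^2(\mathbb R\times\mathbb R^n)$ when no domain is written. *Claim.* There is $\kappa_0=\kappa_0(n,a)$ such that for all $\kappa\ge\kappa_0$, all cutoffs $\chi$ as above and all masses $m_1,m_2>0$ there is a constant $C=C(n,a,\kappa,\chi,m_1,m_2)$ for which (1) and (2) hold for all signs $\pm_1,\pm_2$, independently chosen. 1. For all dyadic $O,M,N$ and all $\phi_M,\psi_N\in L^2(\mathbb R^n)$ localized at frequencies $M,N$ respectively, put $u_M=e^{\pm_1it\langle D\rangle_{m_1}}\phi_M$ and $v_N=e^{\pm_2it\langle D\rangle_{m_2}}\psi_N$. Then, for both $P=P_O$ and $P=P_{\le O}$, $P(u_Mv_N)\in L^2$ and $$\|P(u_Mv_N)\|_{L^2}\le C\begin{cases}H^{\frac12}L^{\frac{n-2}2}\|\phi_M\|_{L^2(\mathbb R^n)}\|\psi_N\|_{L^2(\mathbb R^n)}&\text{if }M\sim_\kappa N,\\ L^{\frac{n-1}2}\|\phi_M\|_{L^2(\mathbb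 R^n)}\|\psi_N\|_{L^2(\mathbb R^n)}&\text{otherwise.}\end{cases}$$ 2. For all dyadic $O,M,N>1$, all $\epsilon_1,\epsilon_2>0$ and all $u,v\in L^2$ whose space-time Fourier transforms are supported in $K^{m_1,\pm_1}_{M,\epsilon_1}$ and $K^{m_2,\pm_2}_{N,\epsilon_2}$ respectively, where $$K^{m,\pm}_{M,\epsilon}=\{(\tau,\xi)\in\mathbb R\times\mathbb R^n:\ |\xi|\sim M,\ |\tau\mp\langle\xi\rangle_m|\le\epsilon\},$$ one has $P_{\le O}(uv)\in L^2$ and $$\|P_{\le O}(uv)\|_{L^2}\le C\begin{cases}(\epsilon_1\epsilon_2)^{\frac12}H^{\frac12}L^{\frac{n-2}2}\|u\|_{L^2}\|v\|_{L^2}&\text{if }M\sim_\kappa N,\\ (\epsilon_1\epsilon_2)^{\frac12}L^{\frac{n-1}2}\|u\|_{L^2}\|v\|_{L^2}&\text{if not }M\sim_\kappa N\text{ and }M,N\ge\kappa.\end{cases}$$ -/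

import Mathlib

open MeasureTheory FourierTransform
open scoped ENNReal ContDiff

namespace KG

noncomputable section

/-- Space `ℝⁿ` with the Euclidean norm. -/
abbrev Space (n : ℕ) : Type := EuclideanSpace ℝ (Fin n)

/-- Space-time `ℝ × ℝⁿ`, as a Euclidean space; its volume is Lebesgue measure. For `p : SpaceTime n`,
`p.fst` is the time (or `τ`) variable and `p.snd` is the space (or `ξ`) variable. -/
abbrev SpaceTime (n : ℕ) : Type := WithLp 2 (ℝ × Space n)

/-- `L²(ℝⁿ; ℂ)`. -/
abbrev L2x (n : ℕ) : Type := Lp ℂ 2 (volume : Measure (Space n))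

/-- `L²(ℝ × ℝⁿ; ℂ)`. -/
abbrev L2tx (n : ℕ) : Type := Lp ℂ 2 (volume : Measure (SpaceTime n))

/-- The mass-`m` bracket `⟨ξ⟩_m = √(m² + |ξ|²)`. -/
def bracket {n : ℕ} (m : ℝ) (ξ : Space n) : ℝ := Real.sqrt (m ^ 2 + ‖ξ‖ ^ 2)

/-! Mathlib's Fourier transform is `𝓕 f ξ = ∫ exp (-2πi ⟨x, ξ⟩) f x dx`, so the angular frequency
(the dual variable for `D = -i∇`) which belongs to the point `ξ` is `2π ξ`. All symbols and all
frequency supports below are in terms of the angular frequency. -/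

/-- The symbol of `exp (± i t ⟨D⟩_m)`, as a function of Mathlib's frequency variable. -/
def waveSymbol {n : ℕ} (m : ℝ) (s : ℤˣ) (t : ℝ) (ξ : Space n) : ℂ :=
  Complex.exp ((((s : ℤ) : ℝ) * t * bracket m ((2 * Real.pi) • ξ) : ℝ) * Complex.I)

theorem memLp_waveSymbol_mul {n : ℕ} (m : ℝ) (s : ℤˣ) (t : ℝ) (f : L2x n) :
    MemLp (fun ξ => waveSymbol m s t ξ * f ξ) 2 (volume : Measure (Space n)) := by
  have hc : Continuous (waveSymbol (n := n) m s t) := by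
    unfold waveSymbol bracket
    fun_prop
  refine MemLp.of_le (Lp.memLp f) (hc.aestronglyMeasurable.mul (Lp.aestronglyMeasurable f)) ?_
  refine Filter.Eventually.of_forall fun ξ => ?_
  rw [norm_mul]
  unfold waveSymbol
  rw [Complex.norm_exp_ofReal_mul_I, one_mul]

/-- The free Klein–Gordon wave `exp (± i t ⟨D⟩_m) φ` at time `t`. -/
def freeWave {n : ℕ} (m : ℝ) (s : ℤˣ) (φ : L2x n) (t : ℝ) : L2x n :=
  𝓕⁻ ((memLp_waveSymbol_mul m s t (𝓕 φ)).toLp _)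

/-- The pointwise product of two free waves as a function on space-time. -/
def freeProduct {n : ℕ} (m₁ m₂ : ℝ) (s₁ s₂ : ℤˣ) (φ ψ : L2x n) (p : SpaceTime n) : ℂ :=
  freeWave m₁ s₁ φ p.fst p.snd * freeWave m₂ s₂ ψ p.fst p.snd

/-- The cutoffs `χ ∈ C₀^∞(-2, 2)`, even, nonnegative, equal to `1` on `[-1, 1]`, from which the
Littlewood–Paley decomposition is built. -/
structure IsCutoff (χ : ℝ → ℝ) : Prop where
  smooth : ContDiff ℝ ∞ χ
  support : tsupport χ ⊆ Set.Ioo (-2) 2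
  even : ∀ r, χ (-r) = χ r
  nonneg : ∀ r, 0 ≤ χ r
  eq_one : ∀ r, |r| ≤ 1 → χ r = 1

/-- Dyadic numbers: `0` (which stands for the frequencies below `1`) and `2 ^ k` with `k : ℕ`. -/
def IsDyadic (N : ℝ) : Prop := N = 0 ∨ ∃ k : ℕ, N = 2 ^ k

/-- The size of the frequencies that a dyadic number stands for: `N` itself for `N = 2 ^ k`, and
`1` for `N = 0`. -/
def size (N : ℝ) : ℝ := max 1 N

/-- The radial profile of the symbol of the Littlewood–Paley projection `P_N`. -/
def annulusProfile (χ : ℝ → ℝ) (N : ℝ) (r : ℝ) : ℝ :=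
  if N = 0 then χ (2 * r) else χ (r / N) - χ (2 * (r / N))

/-- The radial profile of the symbol of `P_{≤ N}`. -/
def lowProfile (χ : ℝ → ℝ) (N : ℝ) (r : ℝ) : ℝ :=
  if N = 0 then χ (2 * r) else χ (r / N)

/-- `P_{≤ 2^k}` is the sum of the `P_N` over the dyadic `N ≤ 2^k`. -/
theorem lowProfile_eq_sum (χ : ℝ → ℝ) (k : ℕ) (r : ℝ) :
    lowProfile χ (2 ^ k) r =
      annulusProfile χ 0 r + ∑ j ∈ Finset.range (k + 1), annulusProfile χ (2 ^ j) r := by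
  induction k with
  | zero => simp [lowProfile, annulusProfile]
  | succ k ih =>
    rw [Finset.sum_range_succ, ← add_assoc, ← ih]
    have h : 2 * (r / 2 ^ (k + 1)) = r / 2 ^ k := by
      rw [pow_succ]; field_simp
    simp [lowProfile, annulusProfile, h]

/-- The profiles of all `P_N` sum to `1`; that is, `ψ_0 = 1 - ∑_{N ≥ 1} ψ_N`. -/
theorem hasSum_annulusProfile {χ : ℝ → ℝ} (hχ : IsCutoff χ) (r : ℝ) :
    HasSum (fun j : ℕ => annulusProfile χ (2 ^ j) r) (1 - annulusProfile χ 0 r) := by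
  obtain ⟨K, hK⟩ := pow_unbounded_of_one_lt |r| (one_lt_two : (1 : ℝ) < 2)
  have hone : ∀ j, K ≤ j → χ (r / 2 ^ j) = 1 := by
    intro j hj
    apply hχ.eq_one
    rw [abs_div, abs_of_pos (by positivity : (0 : ℝ) < 2 ^ j), div_le_one (by positivity)]
    exact hK.le.trans (pow_le_pow_right₀ one_le_two hj)
  have hzero : ∀ j ∉ Finset.range (K + 1), annulusProfile χ (2 ^ j) r = 0 := by
    intro j hj
    obtain ⟨i, rfl⟩ : ∃ i, j = i + 1 := ⟨j - 1, by simp at hj; omega⟩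
    have hi : K ≤ i := by simp at hj; omega
    have h : 2 * (r / 2 ^ (i + 1)) = r / 2 ^ i := by
      rw [pow_succ]; field_simp
    simp [annulusProfile, h, hone i hi, hone (i + 1) (by omega)]
  have h : HasSum (fun j : ℕ => annulusProfile χ (2 ^ j) r) _ :=
    hasSum_sum_of_ne_finset_zero (s := Finset.range (K + 1)) hzero
  have e := lowProfile_eq_sum χ K r
  have e1 : lowProfile χ (2 ^ K) r = 1 := by simp [lowProfile, hone K le_rfl]
  have : ∑ j ∈ Finset.range (K + 1), annulusProfile χ (2 ^ j) r = 1 - annulusProfile χ 0 r := by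
    linarith
  rwa [this] at h

/-- The Fourier multiplier in the space variables with radial symbol `σ (|D|)`, applied to a
function `f` on space-time one time at a time: the inverse Fourier transform of
`σ (|ξ|) * (𝓕_x f)(t, ξ)`. It is used for time slices `f (t, ·)` in `L¹` and for compactly supported
`σ`, where both Fourier integrals converge absolutely. -/
def spatialMultiplier {n : ℕ} (σ : ℝ → ℝ) (f : SpaceTime n → ℂ) (p : SpaceTime n) : ℂ :=
  𝓕⁻ (fun ξ : Space n =>
    (σ ‖(2 * Real.pi) • ξ‖ : ℂ) * 𝓕 (fun x : Space n => f (WithLp.toLp 2 (p.fst, x))) ξ) p.snd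

/-- The Littlewood–Paley projection `P_N`. -/
def proj {n : ℕ} (χ : ℝ → ℝ) (N : ℝ) (f : SpaceTime n → ℂ) : SpaceTime n → ℂ :=
  spatialMultiplier (annulusProfile χ N) f

/-- The projection `P_{≤ N}`. -/
def projLow {n : ℕ} (χ : ℝ → ℝ) (N : ℝ) (f : SpaceTime n → ℂ) : SpaceTime n → ℂ :=
  spatialMultiplier (lowProfile χ N) f

/-- The set of `ξ` with `|ξ| ∼ N`, with implicit constant `a` (`|ξ| ≲ 1` if `N = 0`). -/
def freqRegion (n : ℕ) (a N : ℝ) : Set (Space n) :=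
  {ξ | N / a ≤ ‖ξ‖ ∧ ‖ξ‖ ≤ a * size N}

/-- `φ` is localized at frequency `N`: `φ̂` vanishes (almost everywhere) off `|ξ| ∼ N`. -/
def LocalizedAt {n : ℕ} (a N : ℝ) (φ : L2x n) : Prop :=
  ∀ᵐ ξ : Space n, (2 * Real.pi) • ξ ∉ freqRegion n a N → (𝓕 φ : L2x n) ξ = 0

/-- The thickened characteristic surface `K_{N,ε}^{m,±}`: `|ξ| ∼ N`, `|τ ∓ ⟨ξ⟩_m| ≤ ε`. -/
def thickSurface (n : ℕ) (a N ε m : ℝ) (s : ℤˣ) : Set (SpaceTime n) :=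
  {ζ | ζ.snd ∈ freqRegion n a N ∧ |ζ.fst - ((s : ℤ) : ℝ) * bracket m ζ.snd| ≤ ε}

/-- The space-time Fourier transform of `u` is supported in `A`. -/
def FourierSupportedIn {n : ℕ} (A : Set (SpaceTime n)) (u : L2tx n) : Prop :=
  ∀ᵐ ζ : SpaceTime n, (2 * Real.pi) • ζ ∉ A → (𝓕 u : L2tx n) ζ = 0

/-- `M ∼ N` with implicit constant `κ`. -/
def Comparable (κ M N : ℝ) : Prop := size M ≤ κ * size N ∧ size N ≤ κ * size M

/-- `F ∈ L²(ℝ × ℝⁿ)` and `‖F‖_{L²} ≤ B`. -/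
def L2Bound {n : ℕ} (F : SpaceTime n → ℂ) (B : ℝ) : Prop :=
  MemLp F 2 volume ∧ eLpNorm F 2 volume ≤ ENNReal.ofReal B

/-- The largest of three frequency sizes. -/
def high (O M N : ℝ) : ℝ := max (size O) (max (size M) (size N))

/-- The smallest of three frequency sizes. -/
def low (O M N : ℝ) : ℝ := min (size O) (min (size M) (size N))

end

end KG

/-! A localized free wave is an absolutely convergent superposition of plane waves (`fourierExt`),
and the product of two of them is again one, over the product of the parameter spaces and with the
frequencies added. By duality such a superposition $W$ with amplitude $D$ obeys $\|W\|_2^2\le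
K\|D\|_2^2$ as soon as the push-forward of the parameter measure under the frequency map has density
at most $K$ (`lintegral_fourierExt_sq_le`). What remains is a measure estimate for the pairs of
frequencies with a given sum.

Because $|uv|=|\bar uv|$, conjugation puts both waves on the upper sheet, whatever the signs. For a
fixed output frequency $\xi$ the temporal frequency is then, up to a factor $2\pi$, the convex
function $f(\eta)=\langle2\pi\eta\rangle_{m_1}+\langle2\pi(\xi\mp\eta)\rangle_{m_2}$, and the set
$\{s<f\le t\}$ inside a cube of size $R$ must have volume $O([M]\min(R,[M])^{n-2}(t-s))$. No lower
bound for the gradient is needed. The first bracket is strongly convex across directions, so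
$\{f\le\min f+\tau\}$ lies in a sheared box of width about $\sqrt{[M]\tau}$ in two directions, and
its volume is linear in $\tau$ (`volume_bracket_shell_le`; the two directions need $n\ge3$).
Dilation about the minimum point carries this linear growth over to the shells
(`measure_convex_shell_le`). The second bracket matters only through its convexity.

The projection confines the output to $|\xi|\lesssim[O]$. Hence a piece of one factor in a cube of
side $[O]$ meets only $3^n$ pieces of the other, and Cauchy–Schwarz over the cubes sums the pieces
(`eLpNorm_bilinear_le`). The resulting factor is $([M]\min([O],[M])^{n-2})^{1/2}$ and, by symmetry,
also the one with $N$ for $M$. Comparing with $H$ and $L$ gives the claim (`L2Bound_of_cases`). When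
$M$ and $N$ are not comparable and $[O]$ is below both, the projected product vanishes, since
$\kappa\ge4a^2$ keeps the output frequency away from the support of the symbol.

For thickened surfaces the density is the volume of the intersection of one surface with a
translated reflection of the other: its fibres in $\tau$ have length at most
$2\min(\epsilon_1,\epsilon_2)$ and lie over a shell of thickness $2(\epsilon_1+\epsilon_2)$, so a
factor $O(\epsilon_1\epsilon_2)$ appears (`volume_thick_inter_le`). -/

namespace KG

/-! ### The integral and the L² Fourier transform on L¹ ∩ L² -/

section Plancherel

variable {V : Type*} [NormedAddCommGroup V] [InnerProductSpace ℝ V] [FiniteDimensional ℝ V]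
  [MeasurableSpace V] [BorelSpace V]

theorem continuous_fourier_of_integrable {f : V → ℂ} (hf : Integrable f) : Continuous (𝓕 f) :=
  VectorFourier.fourierIntegral_continuous Real.continuous_fourierChar
    (by exact continuous_inner) hf

theorem continuous_fourierInv_of_integrable {f : V → ℂ} (hf : Integrable f) :
    Continuous (𝓕⁻ f) :=
  VectorFourier.fourierIntegral_continuous Real.continuous_fourierChar
    (by exact (continuous_inner (𝕜 := ℝ) (E := V)).neg) hf

theorem integral_fourier_mul_of_integrable {f g : V → ℂ} (hf : Integrable f) (hg : Integrable g) :
    ∫ x, 𝓕 f x * g x = ∫ x, f x * 𝓕 g x := by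
  have := VectorFourier.integral_fourierIntegral_smul_eq_flip (L := innerₗ V)
    (μ := volume) (ν := volume) (f := f) (g := g)
    Real.continuous_fourierChar continuous_inner hf hg
  rw [flip_innerₗ] at this
  exact this

theorem integral_fourierInv_mul_of_integrable {f g : V → ℂ} (hf : Integrable f)
    (hg : Integrable g) : ∫ x, 𝓕⁻ f x * g x = ∫ x, f x * 𝓕⁻ g x := by
  have := VectorFourier.integral_fourierIntegral_smul_eq_flip (L := -innerₗ V)
    (μ := volume) (ν := volume) (f := f) (g := g)
    Real.continuous_fourierChar (by exact (continuous_inner (𝕜 := ℝ) (E := V)).neg) hf hg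
  have h : (-innerₗ V).flip = -innerₗ V := by
    ext x y
    simp [real_inner_comm]
  rw [h] at this
  exact this

/-- Both transforms can be moved onto a smooth compactly supported test function: the L² one through
its tempered distribution, the integral one by Fubini. Equal pairings force equality almost
everywhere. -/
theorem coeFn_fourier_toLp {f : V → ℂ} (h1 : Integrable f) (h2 : MemLp f 2) :
    ((𝓕 (h2.toLp f) : Lp ℂ 2 (volume : Measure V)) : V → ℂ) =ᵐ[volume] 𝓕 f := by
  refine ae_eq_of_integral_contDiff_smul_eq
    ((Lp.memLp _).locallyIntegrable (by norm_num))
    (continuous_fourier_of_integrable h1).locallyIntegrable fun g hg hgc => ?_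
  let G : SchwartzMap V ℂ := HasCompactSupport.toSchwartzMap (f := fun x => (g x : ℂ))
    (hgc.comp_left (g := fun r : ℝ => (r : ℂ)) (by simp)) (Complex.ofRealCLM.contDiff.comp hg)
  have hG : ∀ x, (g x : ℂ) = G x := fun x => rfl
  have e := congrArg (fun T => T G) (Lp.fourier_toTemperedDistribution_eq (h2.toLp f))
  simp only [TemperedDistribution.fourier_apply, Lp.toTemperedDistribution_apply,
    smul_eq_mul] at e
  simp only [Complex.real_smul, hG]
  rw [← e]
  have e2 : ∫ x, (𝓕 G) x * (h2.toLp f) x = ∫ x, (𝓕 (G : V → ℂ)) x * f x := by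
    refine integral_congr_ae ?_
    filter_upwards [h2.coeFn_toLp] with x hx
    rw [hx]; rfl
  rw [e2, integral_fourier_mul_of_integrable G.integrable h1]

theorem coeFn_fourierInv_toLp {f : V → ℂ} (h1 : Integrable f) (h2 : MemLp f 2) :
    ((𝓕⁻ (h2.toLp f) : Lp ℂ 2 (volume : Measure V)) : V → ℂ) =ᵐ[volume] 𝓕⁻ f := by
  refine ae_eq_of_integral_contDiff_smul_eq
    ((Lp.memLp _).locallyIntegrable (by norm_num))
    (continuous_fourierInv_of_integrable h1).locallyIntegrable fun g hg hgc => ?_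
  let G : SchwartzMap V ℂ := HasCompactSupport.toSchwartzMap (f := fun x => (g x : ℂ))
    (hgc.comp_left (g := fun r : ℝ => (r : ℂ)) (by simp)) (Complex.ofRealCLM.contDiff.comp hg)
  have hG : ∀ x, (g x : ℂ) = G x := fun x => rfl
  have e := congrArg (fun T => T G) (Lp.fourierInv_toTemperedDistribution_eq (h2.toLp f))
  simp only [TemperedDistribution.fourierInv_apply, Lp.toTemperedDistribution_apply,
    smul_eq_mul] at e
  simp only [Complex.real_smul, hG]
  rw [← e]
  have e2 : ∫ x, (𝓕⁻ G) x * (h2.toLp f) x = ∫ x, (𝓕⁻ (G : V → ℂ)) x * f x := by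
    refine integral_congr_ae ?_
    filter_upwards [h2.coeFn_toLp] with x hx
    rw [hx, SchwartzMap.fourierInv_coe]
  rw [e2, integral_fourierInv_mul_of_integrable G.integrable h1]

theorem eLpNorm_fourier {f : V → ℂ} (h1 : Integrable f) (h2 : MemLp f 2) :
    eLpNorm (𝓕 f) 2 volume = eLpNorm f 2 volume := by
  rw [← eLpNorm_congr_ae (coeFn_fourier_toLp h1 h2), ← eLpNorm_congr_ae h2.coeFn_toLp,
    ← Lp.enorm_def, ← Lp.enorm_def, ← ofReal_norm, ← ofReal_norm,
    Lp.norm_fourier_eq]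

theorem norm_fourierInv_Lp (f : Lp ℂ 2 (volume : Measure V)) : ‖𝓕⁻ f‖ = ‖f‖ := by
  rw [← Lp.norm_fourier_eq (𝓕⁻ f), fourier_fourierInv_eq]

theorem eLpNorm_fourierInv {f : V → ℂ} (h1 : Integrable f) (h2 : MemLp f 2) :
    eLpNorm (𝓕⁻ f) 2 volume = eLpNorm f 2 volume := by
  rw [← eLpNorm_congr_ae (coeFn_fourierInv_toLp h1 h2), ← eLpNorm_congr_ae h2.coeFn_toLp,
    ← Lp.enorm_def, ← Lp.enorm_def, ← ofReal_norm, ← ofReal_norm,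
    norm_fourierInv_Lp]

theorem lintegral_enorm_sq {α : Type*} {E : Type*} [NormedAddCommGroup E] [MeasurableSpace α]
    (μ : Measure α) (f : α → E) :
    ∫⁻ x, ‖f x‖ₑ ^ 2 ∂μ = eLpNorm f 2 μ ^ 2 := by
  have := eLpNorm_nnreal_pow_eq_lintegral (f := f) (μ := μ) (p := 2) (by norm_num)
  simpa using this.symm

end Plancherel

/-! ### Superpositions of plane waves: duality and Fourier multipliers -/

section Extension

variable {V : Type*} [NormedAddCommGroup V] [InnerProductSpace ℝ V] [FiniteDimensional ℝ V]
  [MeasurableSpace V] [BorelSpace V] {Z : Type*} [MeasurableSpace Z]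

/-- The superposition `z ↦ ∫ exp (2πi ⟨r w, z⟩) D w dμ` of plane waves with frequencies `r w`. -/
noncomputable def fourierExt (μ : Measure Z) (r : Z → V) (D : Z → ℂ) (z : V) : ℂ :=
  ∫ w, Real.fourierChar (inner ℝ (r w) z) • D w ∂μ

theorem integrable_fourierExt {μ : Measure Z} {r : Z → V} {D : Z → ℂ} (hr : Measurable r)
    (hD : Integrable D μ) (z : V) :
    Integrable (fun w => Real.fourierChar (inner ℝ (r w) z) • D w) μ := by
  refine hD.mono ((Real.continuous_fourierChar.comp_aestronglyMeasurable
    (hr.inner_const (c := z)).aestronglyMeasurable).smul hD.1) ?_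
  exact Filter.Eventually.of_forall fun w => by rw [Circle.norm_smul]

theorem continuous_fourierExt {μ : Measure Z} {r : Z → V} {D : Z → ℂ} (hr : Measurable r)
    (hD : Integrable D μ) : Continuous (fourierExt μ r D) := by
  refine continuous_of_dominated (bound := fun w => ‖D w‖)
    (fun z => (integrable_fourierExt hr hD z).1)
    (fun z => Filter.Eventually.of_forall fun w => by rw [Circle.norm_smul]) hD.norm ?_
  refine Filter.Eventually.of_forall fun w => ?_
  exact (Real.continuous_fourierChar.comp (by fun_prop)).smul continuous_const

set_option linter.unusedSectionVars false in
theorem conj_fourierExt (μ : Measure Z) (r : Z → V) (D : Z → ℂ) (z : V) :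
    (starRingEnd ℂ) (fourierExt μ r D z) =
      fourierExt μ (fun w => -r w) (fun w => (starRingEnd ℂ) (D w)) z := by
  unfold fourierExt
  rw [← integral_conj]
  congr 1 with w
  rw [inner_neg_left, AddChar.map_neg_eq_inv, Circle.smul_def, Circle.smul_def, smul_eq_mul,
    smul_eq_mul, map_mul, Circle.coe_inv_eq_conj]

set_option linter.unusedSectionVars false in
theorem fourierExt_mul {Y : Type*} [MeasurableSpace Y] (μ : Measure Z) (ν : Measure Y)
    [SFinite μ] [SFinite ν] (p : Z → V) (q : Y → V) (A : Z → ℂ) (B : Y → ℂ) (z : V) :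
    fourierExt μ p A z * fourierExt ν q B z =
      fourierExt (μ.prod ν) (fun w => p w.1 + q w.2) (fun w => A w.1 * B w.2) z := by
  unfold fourierExt
  rw [← integral_prod_mul]
  congr 1 with w
  rw [inner_add_left, AddChar.map_add_eq_mul]
  simp only [Circle.smul_def, smul_eq_mul, Circle.coe_mul]
  ring

/-- Fubini: the adjoint of the superposition operator is the inverse transform restricted to the
frequencies `r w`. -/
theorem integral_fourierExt_mul {μ : Measure Z} [SFinite μ] {r : Z → V} {D : Z → ℂ}
    (hr : Measurable r) (hD : Integrable D μ) {g : V → ℂ} (hg : Integrable g) :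
    ∫ z, fourierExt μ r D z * g z = ∫ w, D w * 𝓕⁻ g (r w) ∂μ := by
  have hi : Integrable (fun x : V × Z =>
      Real.fourierChar (inner ℝ (r x.2) x.1) • (g x.1 * D x.2)) (volume.prod μ) := by
    have h0 := hg.mul_prod hD
    refine h0.mono ?_ (Filter.Eventually.of_forall fun w => by rw [Circle.norm_smul])
    exact (Real.continuous_fourierChar.comp_aestronglyMeasurable
      ((hr.comp measurable_snd).inner measurable_fst).aestronglyMeasurable).smul h0.1
  calc ∫ z, fourierExt μ r D z * g z
      = ∫ z, ∫ w, Real.fourierChar (inner ℝ (r w) z) • (g z * D w) ∂μ := by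
        congr 1 with z
        rw [fourierExt, ← integral_mul_const]
        congr 1 with w
        simp only [Circle.smul_def, smul_eq_mul]; ring
    _ = ∫ w, (∫ z, Real.fourierChar (inner ℝ (r w) z) • (g z * D w)) ∂μ :=
        integral_integral_swap hi
    _ = ∫ w, D w * 𝓕⁻ g (r w) ∂μ := by
        congr 1 with w
        rw [Real.fourierInv_eq, ← integral_const_mul]
        congr 1 with z
        rw [real_inner_comm]
        simp only [Circle.smul_def, smul_eq_mul]; ring

/-- Cauchy–Schwarz for lower Lebesgue integrals, in squared form. -/
theorem lintegral_mul_sq_le {α : Type*} [MeasurableSpace α] {μ : Measure α} {f g : α → ℝ≥0∞}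
    (hf : AEMeasurable f μ) (hg : AEMeasurable g μ) :
    (∫⁻ x, f x * g x ∂μ) ^ 2 ≤ (∫⁻ x, f x ^ 2 ∂μ) * ∫⁻ x, g x ^ 2 ∂μ := by
  have h := ENNReal.lintegral_mul_le_Lp_mul_Lq μ Real.HolderConjugate.two_two hf hg
  simp only [Pi.mul_apply, ENNReal.rpow_two] at h
  calc _ ≤ _ := pow_le_pow_left' h 2
    _ = _ := by
      rw [mul_pow, ← ENNReal.rpow_two, ← ENNReal.rpow_two, ← ENNReal.rpow_mul,
        ← ENNReal.rpow_mul]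
      norm_num

/-- A superposition of plane waves whose frequencies have bounded density is in `L²`. -/
theorem lintegral_fourierExt_sq_le {μ : Measure Z} [SFinite μ] {r : Z → V} {D : Z → ℂ}
    (hr : Measurable r) (hD : Integrable D μ) {S : Set Z} (hS : MeasurableSet S)
    (hDS : ∀ w ∉ S, D w = 0) {K : ℝ≥0∞} (hK : (μ.restrict S).map r ≤ K • volume) :
    ∫⁻ z, ‖fourierExt μ r D z‖ₑ ^ 2 ≤ K * ∫⁻ w, ‖D w‖ₑ ^ 2 ∂μ := by
  set W := fourierExt μ r D with hW
  have hWc : Continuous W := continuous_fourierExt hr hD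
  have key : ∀ k : ℕ, ∫⁻ z in Metric.closedBall (0 : V) k, ‖W z‖ₑ ^ 2 ≤
      K * ∫⁻ w, ‖D w‖ₑ ^ 2 ∂μ := by
    intro k
    set Bk := Metric.closedBall (0 : V) (k : ℝ) with hBk
    have hBm : MeasurableSet Bk := measurableSet_closedBall
    -- The dual function is `W` itself, cut off to a ball so that `I` is finite; this is what allows
    -- `I` to be cancelled from `I ^ 2 ≤ K * ‖D‖² * I`.
    set g : V → ℂ := Bk.indicator fun z => (starRingEnd ℂ) (W z) with hg
    have hgc : Continuous fun z => (starRingEnd ℂ) (W z) := Complex.continuous_conj.comp hWc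
    have hBc : IsCompact Bk := isCompact_closedBall _ _
    have hgi : Integrable g := (hgc.continuousOn.integrableOn_compact hBc).integrable_indicator hBm
    set I := ∫⁻ z in Bk, ‖W z‖ₑ ^ 2 with hI
    have hIg : ∫⁻ z, ‖g z‖ₑ ^ 2 = I := by
      rw [hI, ← lintegral_indicator hBm]
      congr 1 with z
      by_cases hz : z ∈ Bk <;> simp [hg, hz]
    have hg2 : MemLp g 2 := by
      rw [memLp_two_iff_integrable_sq_norm hgi.1]
      have h1 : (fun z => ‖g z‖ ^ 2) = Bk.indicator fun z => ‖W z‖ ^ 2 := by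
        ext z
        by_cases hz : z ∈ Bk <;> simp [hg, hz]
      rw [h1]
      exact ((by fun_prop : Continuous fun z => ‖W z‖ ^ 2).continuousOn.integrableOn_compact
        hBc).integrable_indicator hBm
    have hIfin : I ≠ ⊤ := by
      rw [← hIg, lintegral_enorm_sq]
      exact ENNReal.pow_ne_top hg2.2.ne
    have hIW : I = ‖∫ z, W z * g z‖ₑ := by
      have h1 : ∀ z, W z * g z = ((Bk.indicator (fun z => ‖W z‖ ^ 2) z : ℝ) : ℂ) := by
        intro z
        by_cases hz : z ∈ Bk
        · simp [hg, hz, Complex.mul_conj']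
        · simp [hg, hz]
      have h2 : 0 ≤ ∫ z in Bk, ‖W z‖ ^ 2 := by positivity
      simp_rw [h1]
      rw [integral_complex_ofReal, integral_indicator hBm, ← ofReal_norm, Complex.norm_real,
        Real.norm_of_nonneg h2, ofReal_integral_eq_lintegral_ofReal
          ((by fun_prop : Continuous fun z => ‖W z‖ ^ 2).continuousOn.integrableOn_compact hBc)
          (Filter.Eventually.of_forall fun z => by positivity)]
      refine lintegral_congr fun z => ?_
      rw [ENNReal.ofReal_pow (norm_nonneg _), ofReal_norm]
    have hFg : Continuous (𝓕⁻ g) := continuous_fourierInv_of_integrable hgi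
    have hI1 : I ≤ ∫⁻ w in S, ‖D w‖ₑ * ‖𝓕⁻ g (r w)‖ₑ ∂μ := by
      rw [hIW, integral_fourierExt_mul hr hD hgi]
      refine (enorm_integral_le_lintegral_enorm _).trans_eq ?_
      rw [← lintegral_indicator hS]
      refine lintegral_congr fun w => ?_
      by_cases hw : w ∈ S
      · simp [hw]
      · simp [hw, hDS w hw]
    have hI2 : ∫⁻ w in S, ‖𝓕⁻ g (r w)‖ₑ ^ 2 ∂μ ≤ K * I := by
      calc ∫⁻ w in S, ‖𝓕⁻ g (r w)‖ₑ ^ 2 ∂μ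
          = ∫⁻ ζ, ‖𝓕⁻ g ζ‖ₑ ^ 2 ∂((μ.restrict S).map r) := by
            rw [lintegral_map (by fun_prop) hr]
        _ ≤ ∫⁻ ζ, ‖𝓕⁻ g ζ‖ₑ ^ 2 ∂(K • volume) := lintegral_mono' hK le_rfl
        _ = K * I := by
            rw [lintegral_smul_measure, lintegral_enorm_sq, eLpNorm_fourierInv hgi hg2,
              ← lintegral_enorm_sq, hIg, smul_eq_mul]
    have hI3 : I ^ 2 ≤ (∫⁻ w, ‖D w‖ₑ ^ 2 ∂μ) * (K * I) := by
      calc I ^ 2 ≤ _ := pow_le_pow_left' hI1 2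
        _ ≤ _ := lintegral_mul_sq_le hD.1.enorm.restrict
            (by exact (hFg.measurable.comp hr).enorm.aemeasurable)
        _ ≤ _ := mul_le_mul' (lintegral_mono' Measure.restrict_le_self le_rfl) hI2
    by_cases h0 : I = 0
    · rw [h0]; exact zero_le
    · rw [sq, ← mul_assoc] at hI3
      have := (ENNReal.mul_le_mul_iff_left h0 hIfin).1 hI3
      rwa [mul_comm] at this
  have hmono : Monotone fun k : ℕ => Metric.closedBall (0 : V) (k : ℝ) := fun i j hij =>
    Metric.closedBall_subset_closedBall (by exact_mod_cast hij)
  have hU : ⋃ k : ℕ, Metric.closedBall (0 : V) (k : ℝ) = Set.univ := Metric.iUnion_closedBall_nat 0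
  rw [← setLIntegral_univ, ← hU, setLIntegral_iUnion_of_directed _ hmono.directed_le]
  exact iSup_le key

/-- A Fourier multiplier acts on a superposition of plane waves by multiplying the amplitudes. -/
theorem fourierInv_mul_fourier_fourierExt {μ : Measure Z} [SFinite μ] {r : Z → V} {D : Z → ℂ}
    (hr : Measurable r) (hD : Integrable D μ) (h : SchwartzMap V ℂ) {w : V → ℂ}
    (hw : w =ᵐ[volume] fourierExt μ r D) (hwi : Integrable w) (x : V) :
    𝓕⁻ (fun ξ => h ξ * 𝓕 w ξ) x = fourierExt μ r (fun y => h (r y) * D y) x := by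
  -- The evaluation point is absorbed into the test function. The transform moves from `w` to `g`,
  -- then through the superposition, where Fourier inversion gives `g` back at the frequencies `r
  -- y`.
  let g : V → ℂ := fun ξ => Real.fourierChar (inner ℝ ξ x) • h ξ
  have hgi : Integrable g :=
    integrable_fourierExt (μ := volume) (r := fun ξ : V => ξ) measurable_id h.integrable x
  have hgc : Continuous g :=
    (Real.continuous_fourierChar.comp (by fun_prop)).smul h.continuous
  have hFg : 𝓕 g = fun y => 𝓕 (h : V → ℂ) (y - x) := by
    ext y
    rw [Real.fourier_eq, Real.fourier_eq]
    congr 1 with v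
    simp only [g]
    rw [smul_smul, ← AddChar.map_add_eq_mul, inner_sub_right]
    congr 2; ring
  have hFgi : Integrable (𝓕 g) := by
    rw [hFg]
    have : Integrable (𝓕 (h : V → ℂ)) := by
      rw [← SchwartzMap.fourier_coe]; exact (𝓕 h).integrable
    exact this.comp_sub_right x
  calc 𝓕⁻ (fun ξ => h ξ * 𝓕 w ξ) x = ∫ ξ, 𝓕 w ξ * g ξ := by
        rw [Real.fourierInv_eq]
        congr 1 with ξ
        simp only [g, Circle.smul_def, smul_eq_mul]; ring
    _ = ∫ y, w y * 𝓕 g y := integral_fourier_mul_of_integrable hwi hgi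
    _ = ∫ y, fourierExt μ r D y * 𝓕 g y := by
        refine integral_congr_ae ?_
        filter_upwards [hw] with y hy
        rw [hy]
    _ = ∫ y, D y * 𝓕⁻ (𝓕 g) (r y) ∂μ := integral_fourierExt_mul hr hD hFgi
    _ = fourierExt μ r (fun y => h (r y) * D y) x := by
        rw [fourierExt]
        congr 1 with y
        rw [hgc.fourierInv_fourier_eq hgi hFgi]
        simp only [g, Circle.smul_def, smul_eq_mul]; ring

theorem lintegral_fourierInv_mul_fourier_le {w : V → ℂ} (hwi : Integrable w) (hw2 : MemLp w 2)
    (h : SchwartzMap V ℂ) {S : ℝ} (hS : ∀ ξ, ‖h ξ‖ ≤ S) :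
    ∫⁻ x, ‖𝓕⁻ (fun ξ => h ξ * 𝓕 w ξ) x‖ₑ ^ 2 ≤ ENNReal.ofReal S ^ 2 * ∫⁻ x, ‖w x‖ₑ ^ 2 := by
  have hFc := continuous_fourier_of_integrable hwi
  have hF2 : MemLp (𝓕 w) 2 :=
    ⟨hFc.aestronglyMeasurable, by rw [eLpNorm_fourier hwi hw2]; exact hw2.2⟩
  have hle : ∀ ξ, ‖h ξ * 𝓕 w ξ‖ ≤ S * ‖𝓕 w ξ‖ := fun ξ => by
    rw [norm_mul]; exact mul_le_mul_of_nonneg_right (hS ξ) (norm_nonneg _)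
  have hm2 : MemLp (fun ξ => h ξ * 𝓕 w ξ) 2 :=
    hF2.of_le_mul (h.continuous.mul hFc).aestronglyMeasurable (Filter.Eventually.of_forall hle)
  have hm1 : Integrable (fun ξ => h ξ * 𝓕 w ξ) :=
    h.integrable.mul_bdd (c := ∫ y, ‖w y‖) hFc.aestronglyMeasurable
      (Filter.Eventually.of_forall fun ξ =>
        VectorFourier.norm_fourierIntegral_le_integral_norm _ _ _ _ _)
  rw [lintegral_enorm_sq, lintegral_enorm_sq, ← mul_pow, eLpNorm_fourierInv hm1 hm2,
    ← eLpNorm_fourier hwi hw2]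
  exact pow_le_pow_left' (eLpNorm_le_mul_eLpNorm_of_ae_le_mul (Filter.Eventually.of_forall hle) 2) 2

end Extension

/-! ### Strict convexity of the norm and shells of convex functions -/

section Geometry

/-- The norm in an inner product space is strictly convex across directions. -/
theorem norm_add_norm_sub_norm_add_ge {E : Type*} [NormedAddCommGroup E] [InnerProductSpace ℝ E]
    {X Y : E} {L : ℝ} (hX0 : 0 < ‖X‖) (hY0 : 0 < ‖Y‖) (hX : ‖X‖ ≤ L) (hY : ‖Y‖ ≤ L) :
    (‖X‖ ^ 2 * ‖Y‖ ^ 2 - inner ℝ X Y ^ 2) / (4 * L ^ 3) ≤ ‖X‖ + ‖Y‖ - ‖X + Y‖ := by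
  have hL : 0 < L := hX0.trans_le hX
  have h1 := norm_add_sq_real X Y
  have h2 := norm_add_le X Y
  have h3 := abs_real_inner_le_norm X Y
  rw [abs_le] at h3
  set p := ‖X‖
  set q := ‖Y‖
  set s := ‖X + Y‖ with hs
  have hs0 : 0 ≤ s := norm_nonneg _
  set I := inner ℝ X Y
  rw [div_le_iff₀ (by positivity)]
  -- The defect and the Gram determinant share the factor `p * q - I`; their cofactors `p + q + s`
  -- and `p * q + I` are at most `4 * L` and `2 * L ^ 2`.
  have e1 : (p + q - s) * (p + q + s) = 2 * (p * q - I) := by linear_combination -h1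
  have hpq : 0 < p * q := by positivity
  have e2 : p ^ 2 * q ^ 2 - I ^ 2 = (p * q - I) * (p * q + I) := by ring
  have b1 : p * q + I ≤ 2 * L ^ 2 := by
    have : p * q ≤ L * L := mul_le_mul hX hY hY0.le hL.le
    nlinarith
  have b2 : p + q + s ≤ 4 * L := by linarith
  have hd : 0 ≤ p + q - s := by linarith
  calc p ^ 2 * q ^ 2 - I ^ 2 = (p * q - I) * (p * q + I) := e2
    _ ≤ (p * q - I) * (2 * L ^ 2) := mul_le_mul_of_nonneg_left b1 (by linarith)
    _ = (p + q - s) * (p + q + s) * L ^ 2 := by rw [e1]; ring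
    _ ≤ (p + q - s) * (4 * L) * L ^ 2 :=
        mul_le_mul_of_nonneg_right (mul_le_mul_of_nonneg_left b2 hd) (by positivity)
    _ = _ := by ring

/-- A single `2 × 2` minor is controlled by the Gram determinant. -/
theorem minor_sq_le_gram {E : Type*} [NormedAddCommGroup E] [InnerProductSpace ℝ E]
    {u v : E} (hu : ‖u‖ = 1) (hv : ‖v‖ = 1) (huv : inner ℝ u v = 0) (X Y : E) :
    (inner ℝ X u * inner ℝ Y v - inner ℝ X v * inner ℝ Y u) ^ 2 ≤
      ‖X‖ ^ 2 * ‖Y‖ ^ 2 - inner ℝ X Y ^ 2 := by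
  rcases eq_or_ne Y 0 with rfl | hY
  · simp
  have hY0 : 0 < ‖Y‖ ^ 2 := by positivity
  have hvu : inner ℝ v u = 0 := by rw [real_inner_comm]; exact huv
  have huu : inner ℝ u u = (1 : ℝ) := by rw [real_inner_self_eq_norm_sq, hu]; norm_num
  have hvv : inner ℝ v v = (1 : ℝ) := by rw [real_inner_self_eq_norm_sq, hv]; norm_num
  have hXX : inner ℝ X X = ‖X‖ ^ 2 := real_inner_self_eq_norm_sq X
  have hYY : inner ℝ Y Y = ‖Y‖ ^ 2 := real_inner_self_eq_norm_sq Y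
  set P := inner ℝ Y u with hP
  set Q := inner ℝ Y v with hQ
  have hP' : inner ℝ u Y = P := real_inner_comm _ _
  have hQ' : inner ℝ v Y = Q := real_inner_comm _ _
  have bessel : P ^ 2 + Q ^ 2 ≤ ‖Y‖ ^ 2 := by
    have h0 : 0 ≤ inner ℝ (Y - P • u - Q • v) (Y - P • u - Q • v) := real_inner_self_nonneg
    simp only [inner_sub_left, inner_sub_right, real_inner_smul_left, real_inner_smul_right,
      huu, hvv, huv, hvu, hP', hQ', ← hP, ← hQ, hYY] at h0
    nlinarith
  -- `Q • u - P • v` is orthogonal to `Y`, so pairing it with `X` sees only the part of `X`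
  -- orthogonal to `Y`, whose squared length is the Gram determinant over `‖Y‖ ^ 2`. Cauchy–Schwarz
  -- and Bessel finish.
  have hZ : ‖Q • u - P • v‖ ^ 2 = P ^ 2 + Q ^ 2 := by
    rw [← real_inner_self_eq_norm_sq]
    simp only [inner_sub_left, inner_sub_right, real_inner_smul_left, real_inner_smul_right,
      huu, hvv, huv, hvu]
    ring
  set G := ‖X‖ ^ 2 * ‖Y‖ ^ 2 - inner ℝ X Y ^ 2 with hG
  have hX' : ‖‖Y‖ ^ 2 • X - inner ℝ X Y • Y‖ ^ 2 = ‖Y‖ ^ 2 * G := by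
    rw [← real_inner_self_eq_norm_sq]
    simp only [inner_sub_left, inner_sub_right, real_inner_smul_left, real_inner_smul_right,
      hXX, hYY, real_inner_comm X Y, hG]
    ring
  have hin : inner ℝ (‖Y‖ ^ 2 • X - inner ℝ X Y • Y) (Q • u - P • v) =
      ‖Y‖ ^ 2 * (inner ℝ X u * Q - inner ℝ X v * P) := by
    simp only [inner_sub_left, inner_sub_right, real_inner_smul_left, real_inner_smul_right,
      ← hP, ← hQ]
    ring
  have cs := real_inner_mul_inner_self_le (‖Y‖ ^ 2 • X - inner ℝ X Y • Y) (Q • u - P • v)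
  rw [hin, real_inner_self_eq_norm_sq, real_inner_self_eq_norm_sq, hX', hZ] at cs
  have hG0 : 0 ≤ G := by
    have : 0 ≤ ‖Y‖ ^ 2 * G := by rw [← hX']; positivity
    exact nonneg_of_mul_nonneg_right this hY0
  have c2 : (‖Y‖ ^ 2) ^ 2 * (inner ℝ X u * Q - inner ℝ X v * P) ^ 2 ≤ (‖Y‖ ^ 2) ^ 2 * G := by
    calc _ = _ := by ring
      _ ≤ _ := cs
      _ ≤ ‖Y‖ ^ 2 * G * ‖Y‖ ^ 2 := mul_le_mul_of_nonneg_left bessel (by positivity)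
      _ = _ := by ring
  exact le_of_mul_le_mul_left c2 (by positivity)

/-- Lebesgue outer measure is the largest outer measure bounded by length on covering intervals, so
a bound on intervals passes to every measurable set. Dividing by `c` is what needs `c` nonzero and
finite. -/
theorem measure_le_smul_volume_of_Ioc {μ : Measure ℝ} {c : ℝ≥0∞} (hc0 : c ≠ 0) (hc : c ≠ ⊤)
    (h : ∀ a b, a < b → μ (Set.Ioc a b) ≤ c * ENNReal.ofReal (b - a)) : μ ≤ c • volume := by
  have h1 : (c⁻¹ • μ).toOuterMeasure ≤ StieltjesFunction.id.outer := by
    rw [StieltjesFunction.outer, OuterMeasure.le_ofFunction]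
    intro s
    rw [StieltjesFunction.length_eq]
    refine le_iInf fun a => le_iInf fun b => le_iInf fun hs' => ?_
    -- The interval has to cover `s` only off a least element of the line, and ℝ has none.
    have hs : s ⊆ Set.Ioc a b := fun x hx => hs' ⟨hx, notMem_botSet_of_lt (sub_one_lt x)⟩
    rcases lt_or_ge a b with hab | hab
    · calc (c⁻¹ • μ).toOuterMeasure s ≤ (c⁻¹ • μ) (Set.Ioc a b) := measure_mono hs
        _ = c⁻¹ * μ (Set.Ioc a b) := by simp
        _ ≤ c⁻¹ * (c * ENNReal.ofReal (b - a)) := by gcongr; exact h a b hab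
        _ = _ := by
          rw [← mul_assoc, ENNReal.inv_mul_cancel hc0 hc, one_mul]; rfl
    · rw [Set.Ioc_eq_empty (not_lt.2 hab), Set.subset_empty_iff] at hs
      simp [hs]
  rw [Measure.le_iff]
  intro s hs
  have h2 : c⁻¹ * μ s ≤ volume s := by
    have := h1 s
    rw [Real.volume_eq_stieltjes_id, StieltjesFunction.measure_def]
    simpa using! this
  calc μ s = c * (c⁻¹ * μ s) := by rw [← mul_assoc, ENNReal.mul_inv_cancel hc0 hc, one_mul]
    _ ≤ c * volume s := by gcongr
    _ = _ := by simp

theorem one_add_pow_le (n : ℕ) {t : ℝ} (h0 : 0 ≤ t) (h1 : t ≤ 1) :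
    (1 + t) ^ n ≤ 1 + 2 ^ n * t := by
  -- `2 ^ n - 1` is the slope of the chord over [0, 1]; this sharper constant is the one that
  -- survives the induction.
  suffices h : (1 + t) ^ n ≤ 1 + (2 ^ n - 1) * t by nlinarith
  induction n with
  | zero => simp
  | succ n ih =>
    have h2 : (1 : ℝ) ≤ 2 ^ n := one_le_pow₀ (by norm_num)
    rw [pow_succ, pow_succ]
    nlinarith [mul_le_mul_of_nonneg_right ih (by linarith : 0 ≤ 1 + t),
      mul_nonneg (mul_nonneg (by linarith : (0:ℝ) ≤ 2 ^ n - 1) h0) (by linarith : 0 ≤ 1 - t)]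

open Module in
/-- If the sublevel sets of a convex function have at most linearly growing measure, then so do
the differences of its sublevel sets. -/
theorem measure_convex_shell_le {E : Type*} [NormedAddCommGroup E] [NormedSpace ℝ E]
    [FiniteDimensional ℝ E] [MeasurableSpace E] [BorelSpace E] (μ : Measure E)
    [μ.IsAddHaarMeasure] {K : Set E} (hK : IsCompact K) {f : E → ℝ}
    (hf : Continuous f) (hfc : ConvexOn ℝ K f) {x₀ : E} (hx₀ : x₀ ∈ K)
    {B : ℝ} (hB0 : 0 ≤ B)
    (hB : ∀ τ, 0 < τ → μ {x ∈ K | f x ≤ f x₀ + τ} ≤ ENNReal.ofReal (B * τ))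
    {s t : ℝ} (hst : s < t) :
    μ {x ∈ K | f x ∈ Set.Ioc s t} ≤ ENNReal.ofReal (2 ^ (finrank ℝ E + 1) * B * (t - s)) := by
  set d := finrank ℝ E
  have hd1 : (1 : ℝ) ≤ 2 ^ d := one_le_pow₀ (by norm_num)
  have hε : 0 < t - s := sub_pos.2 hst
  -- A shell that starts within its own thickness above `f x₀` already lies in the sublevel set at
  -- height `2 * (t - s)`. Otherwise the starting height `τ` is at least the thickness `ε`.
  rcases lt_or_ge (s - f x₀) (t - s) with h | h
  · calc μ {x ∈ K | f x ∈ Set.Ioc s t} ≤ μ {x ∈ K | f x ≤ f x₀ + 2 * (t - s)} := by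
          refine measure_mono fun x hx => ⟨hx.1, ?_⟩
          have := hx.2.2
          linarith
      _ ≤ _ := hB _ (by linarith)
      _ ≤ _ := by
          refine ENNReal.ofReal_le_ofReal ?_
          rw [pow_succ]
          nlinarith [mul_nonneg hB0 hε.le]
  set τ := s - f x₀ with hτ
  set ε := t - s with hεd
  have hτ0 : 0 < τ := hε.trans_le h
  set S₁ := {x ∈ K | f x ≤ f x₀ + τ}
  set S₂ := {x ∈ K | f x ≤ f x₀ + (τ + ε)}
  have hS₁ : MeasurableSet S₁ :=
    (hK.isClosed.inter (isClosed_le hf continuous_const)).measurableSet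
  have hsub : {x ∈ K | f x ∈ Set.Ioc s t} ⊆ S₂ \ S₁ := by
    intro x hx
    have h1 := hx.2.1
    have h2 := hx.2.2
    refine ⟨⟨hx.1, by rw [hτ, hεd]; linarith⟩, fun h' => ?_⟩
    have := h'.2
    rw [hτ] at this
    linarith
  have h12 : S₁ ⊆ S₂ := fun x hx => ⟨hx.1, hx.2.trans (by linarith)⟩
  have hfin : μ S₁ ≠ ⊤ := ((measure_mono (fun x hx => hx.1)).trans_lt hK.measure_lt_top).ne
  set r := 1 + ε / τ with hr
  have hr0 : 0 < r := by positivity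
  -- Along a segment from `x₀`, convexity scales the excess over `f x₀` at most linearly, so
  -- contraction by `τ / (τ + ε)` takes `S₂` into `S₁`.
  have hdil : S₂ ⊆ AffineMap.homothety x₀ r '' S₁ := by
    intro x hx
    refine ⟨AffineMap.homothety x₀ r⁻¹ x, ?_, ?_⟩
    · have hr1 : r⁻¹ ≤ 1 := inv_le_one_of_one_le₀ (by rw [hr]; linarith [div_pos hε hτ0])
      have e : AffineMap.homothety x₀ r⁻¹ x = (1 - r⁻¹) • x₀ + r⁻¹ • x := by
        rw [AffineMap.homothety_apply, vsub_eq_sub, vadd_eq_add, smul_sub, sub_smul, one_smul]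
        abel
      have h0 : 0 ≤ 1 - r⁻¹ := by linarith
      have hri : 0 ≤ r⁻¹ := inv_nonneg.2 hr0.le
      rw [e]
      refine ⟨hfc.1 hx₀ hx.1 h0 hri (by ring), ?_⟩
      refine (hfc.2 hx₀ hx.1 h0 hri (by ring)).trans ?_
      simp only [smul_eq_mul]
      have h3 : r⁻¹ * (τ + ε) = τ := by
        have : τ + ε = r * τ := by rw [hr]; field_simp
        rw [this, ← mul_assoc, inv_mul_cancel₀ hr0.ne', one_mul]
      have h4 := mul_le_mul_of_nonneg_left hx.2 hri
      nlinarith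
    · rw [← AffineMap.comp_apply, ← AffineMap.homothety_mul, mul_inv_cancel₀ hr0.ne',
        AffineMap.homothety_one]
      rfl
  calc μ {x ∈ K | f x ∈ Set.Ioc s t} ≤ μ (S₂ \ S₁) := measure_mono hsub
    _ = μ S₂ - μ S₁ := measure_sdiff h12 hS₁.nullMeasurableSet hfin
    _ ≤ ENNReal.ofReal (r ^ d) * μ S₁ - μ S₁ := by
        gcongr
        refine (measure_mono hdil).trans_eq ?_
        rw [Measure.addHaar_image_homothety, abs_of_pos (by positivity)]
    -- The gain is `(1 + ε / τ) ^ d - 1 ≤ 2 ^ d * (ε / τ)`; against `μ S₁ ≤ B * τ` the height `τ`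
    -- then cancels.
    _ ≤ ENNReal.ofReal (2 ^ d * (ε / τ)) * μ S₁ := by
        rw [tsub_le_iff_right]
        calc ENNReal.ofReal (r ^ d) * μ S₁
            ≤ ENNReal.ofReal (1 + 2 ^ d * (ε / τ)) * μ S₁ := by
              gcongr
              exact one_add_pow_le d (by positivity) ((div_le_one hτ0).2 h)
          _ = _ := by
              rw [ENNReal.ofReal_add zero_le_one (by positivity), add_mul, ENNReal.ofReal_one,
                one_mul, add_comm]
    _ ≤ ENNReal.ofReal (2 ^ d * (ε / τ)) * ENNReal.ofReal (B * τ) := by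
        gcongr
        exact hB τ hτ0
    _ ≤ _ := by
        rw [← ENNReal.ofReal_mul (by positivity)]
        refine ENNReal.ofReal_le_ofReal ?_
        have : 2 ^ d * (ε / τ) * (B * τ) = 2 ^ d * B * ε := by field_simp
        rw [this, pow_succ]
        nlinarith [mul_nonneg (mul_nonneg (by positivity : (0:ℝ) ≤ 2 ^ d) hB0) hε.le]

end Geometry

/-! ### Shells of a mass bracket plus a convex function -/

section Shell

theorem prod_ite_pair {n : ℕ} {j k : Fin n} (hjk : j ≠ k) {M : Type*} [CommMonoid M] (A B : M) :
    ∏ l, (if l = j then A else if l = k then A else B) = A ^ 2 * B ^ (n - 2) := by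
  rw [← Finset.mul_prod_erase Finset.univ _ (Finset.mem_univ j),
    ← Finset.mul_prod_erase (Finset.univ.erase j) _
      (Finset.mem_erase.2 ⟨hjk.symm, Finset.mem_univ k⟩)]
  rw [if_pos rfl, if_neg hjk.symm, if_pos rfl, ← mul_assoc, ← sq]
  congr 1
  rw [Finset.prod_congr rfl (g := fun _ => B), Finset.prod_const, Finset.card_erase_of_mem,
    Finset.card_erase_of_mem (Finset.mem_univ j), Finset.card_univ, Fintype.card_fin]
  · congr 1
  · exact Finset.mem_erase.2 ⟨hjk.symm, Finset.mem_univ k⟩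
  · intro l hl
    simp only [Finset.mem_erase, Finset.mem_univ, and_true] at hl
    rw [if_neg hl.2, if_neg hl.1]

/-- Two transvections, which preserve volume, straighten the set into a box with two sides `2 * ρ`
and the others `2 * R`. -/
theorem volume_sheared_box_le {n : ℕ} {i j k : Fin n} (hij : i ≠ j) (hik : i ≠ k) (hjk : j ≠ k)
    (q q' α β : ℝ) (c : Fin n → ℝ) {ρ R : ℝ} (hρ : 0 ≤ ρ) (hR : 0 ≤ R) :
    volume {x : Space n | |x j - q * x i - α| ≤ ρ ∧ |x k - q' * x i - β| ≤ ρ ∧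
      ∀ l, |x l - c l| ≤ R} ≤ ENNReal.ofReal ((2 * ρ) ^ 2 * (2 * R) ^ (n - 2)) := by
  let t₁ : Matrix.TransvectionStruct (Fin n) ℝ := ⟨j, i, hij.symm, -q⟩
  let t₂ : Matrix.TransvectionStruct (Fin n) ℝ := ⟨k, i, hik.symm, -q'⟩
  have hΦ := ((Real.volume_preserving_transvectionStruct t₂).comp
    (Real.volume_preserving_transvectionStruct t₁)).comp (PiLp.volume_preserving_ofLp (Fin n))
  set Φ := (⇑(Matrix.toLin' t₂.toMatrix) ∘ ⇑(Matrix.toLin' t₁.toMatrix)) ∘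
    (WithLp.ofLp : Space n → Fin n → ℝ) with hΦd
  set box : Set (Fin n → ℝ) := Set.pi Set.univ fun l =>
    if l = j then Set.Icc (α - ρ) (α + ρ) else if l = k then Set.Icc (β - ρ) (β + ρ)
      else Set.Icc (c l - R) (c l + R) with hbox
  have hval : ∀ x : Space n, ∀ l, Φ x l =
      if l = j then x j - q * x i else if l = k then x k - q' * x i else x l := by
    intro x l
    have e1 : ∀ (t : Matrix.TransvectionStruct (Fin n) ℝ) (y : Fin n → ℝ) (l : Fin n),
        Matrix.toLin' t.toMatrix y l = y l + if l = t.i then t.c * y t.j else 0 := by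
      intro t y l
      simp [Matrix.TransvectionStruct.toMatrix, Matrix.transvection,
        Matrix.single_mulVec, Function.update_apply]
    simp only [hΦd, Function.comp_apply, e1, t₁, t₂]
    by_cases hlj : l = j
    · subst hlj
      simp [hjk]; ring
    · by_cases hlk : l = k
      · subst hlk
        simp [hlj, hij]; ring
      · simp [hlj, hlk]
  have hsub : {x : Space n | |x j - q * x i - α| ≤ ρ ∧ |x k - q' * x i - β| ≤ ρ ∧
      ∀ l, |x l - c l| ≤ R} ⊆ Φ ⁻¹' box := by
    rintro x ⟨h1, h2, h3⟩ l -
    rw [abs_le] at h1 h2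
    have h3 := abs_le.1 (h3 l)
    simp only [hval]
    split_ifs with hlj hlk
    · constructor <;> linarith
    · constructor <;> linarith
    · constructor <;> linarith
  have hbm : MeasurableSet box := by
    refine MeasurableSet.univ_pi fun l => ?_
    split_ifs <;> exact measurableSet_Icc
  refine (measure_mono hsub).trans ?_
  rw [hΦ.measure_preimage hbm.nullMeasurableSet, hbox, volume_pi_pi]
  have : ∀ l, volume (if l = j then Set.Icc (α - ρ) (α + ρ) else
      if l = k then Set.Icc (β - ρ) (β + ρ) else Set.Icc (c l - R) (c l + R)) =
      if l = j then ENNReal.ofReal (2 * ρ) else if l = k then ENNReal.ofReal (2 * ρ)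
        else ENNReal.ofReal (2 * R) := by
    intro l
    split_ifs <;> rw [Real.volume_Icc] <;> congr 1 <;> ring
  simp_rw [this]
  rw [prod_ite_pair hjk, ← ENNReal.ofReal_pow (by positivity), ← ENNReal.ofReal_pow (by positivity),
    ← ENNReal.ofReal_mul (by positivity)]

/-- With the mass as an extra coordinate, convexity properties of the bracket become those of a
Euclidean norm on an affine hyperplane. -/
theorem bracket_eq_norm {n : ℕ} (m : ℝ) (x : Space n) :
    bracket m x = ‖(WithLp.toLp 2 (m, x) : SpaceTime n)‖ := by
  rw [bracket, WithLp.prod_norm_eq_of_L2]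
  simp

theorem continuous_bracket {n : ℕ} (m : ℝ) : Continuous (bracket (n := n) m) := by
  unfold bracket
  fun_prop

theorem convexOn_bracket {n : ℕ} (m : ℝ) : ConvexOn ℝ Set.univ (bracket (n := n) m) := by
  refine ⟨convex_univ, fun x _ y _ s t hs ht hst => ?_⟩
  simp only [bracket_eq_norm]
  have e : (WithLp.toLp 2 (m, s • x + t • y) : SpaceTime n) =
      s • WithLp.toLp 2 (m, x) + t • WithLp.toLp 2 (m, y) := by
    refine WithLp.ofLp_injective 2 (Prod.ext ?_ ?_)
    · simp [← add_mul, hst]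
    · simp
  rw [e]
  refine (norm_add_le _ _).trans ?_
  rw [norm_smul, norm_smul, Real.norm_of_nonneg hs, Real.norm_of_nonneg ht]
  rfl

theorem bracket_pos {n : ℕ} {m : ℝ} (hm : 0 < m) (x : Space n) : 0 < bracket m x := by
  unfold bracket
  positivity

/-- Strong midpoint convexity of the mass bracket, transversally to the coordinate `i`. -/
theorem sq_shear_le_bracket {n : ℕ} {m : ℝ} (hm : 0 < m) {i j : Fin n} (hij : i ≠ j)
    {u₀ b : ℝ} (hu : u₀ ^ 2 + b ^ 2 = 1) {L : ℝ} {x y : Space n}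
    (hx : bracket m x ≤ L) (hy : bracket m y ≤ L) :
    ((m * u₀ + b * x i) * y j - x j * (m * u₀ + b * y i)) ^ 2 ≤
      4 * L ^ 3 * (bracket m x + bracket m y - 2 * bracket m ((1 / 2 : ℝ) • x + (1 / 2 : ℝ) • y)) := by
  have hL : 0 < L := (bracket_pos hm x).trans_le hx
  set X : SpaceTime n := WithLp.toLp 2 (m, x)
  set Y : SpaceTime n := WithLp.toLp 2 (m, y)
  have hX : bracket m x = ‖X‖ := bracket_eq_norm m x
  have hY : bracket m y = ‖Y‖ := bracket_eq_norm m y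
  have hXY : 2 * bracket m ((1 / 2 : ℝ) • x + (1 / 2 : ℝ) • y) = ‖X + Y‖ := by
    have : X + Y = (2 : ℝ) • WithLp.toLp 2 (m, (1 / 2 : ℝ) • x + (1 / 2 : ℝ) • y) := by
      rw [← WithLp.toLp_smul, ← WithLp.toLp_add]
      congr 1
      simp only [Prod.mk_add_mk, Prod.smul_mk, smul_add, smul_smul, smul_eq_mul]
      norm_num
      ring
    rw [this, norm_smul, ← bracket_eq_norm]
    norm_num
  -- `U` is the direction in which `(m, x)` will be bounded below: the mass axis for `(u₀, b) = (1,
  -- 0)`, the `i`-th axis for `(0, ±1)`. The minor is taken against the transversal axis `j`.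
  set U : SpaceTime n := WithLp.toLp 2 (u₀, EuclideanSpace.single i b)
  set W : SpaceTime n := WithLp.toLp 2 (0, EuclideanSpace.single j 1)
  have hU : ‖U‖ = 1 := by
    rw [WithLp.prod_norm_eq_of_L2]
    simp [U, hu]
  have hW : ‖W‖ = 1 := by
    rw [WithLp.prod_norm_eq_of_L2]
    simp [W]
  have hUW : inner ℝ U W = 0 := by
    simp [U, W, WithLp.prod_inner_apply, EuclideanSpace.inner_single_left, hij]
  have iU : ∀ z : Space n, inner ℝ (WithLp.toLp 2 (m, z) : SpaceTime n) U = m * u₀ + b * z i := by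
    intro z
    simp [U, WithLp.prod_inner_apply, EuclideanSpace.inner_single_right, mul_comm]
  have iW : ∀ z : Space n, inner ℝ (WithLp.toLp 2 (m, z) : SpaceTime n) W = z j := by
    intro z
    simp [W, WithLp.prod_inner_apply, EuclideanSpace.inner_single_right]
  have h1 := minor_sq_le_gram hU hW hUW X Y
  have h2 := norm_add_norm_sub_norm_add_ge (X := X) (Y := Y) (hX ▸ bracket_pos hm x)
    (hY ▸ bracket_pos hm y) (hX ▸ hx) (hY ▸ hy)
  rw [div_le_iff₀ (by positivity)] at h2
  rw [iU, iU, iW, iW] at h1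
  rw [hX, hY, hXY]
  linarith

/-- The main measure estimate: the shells of the sum of a mass bracket and a convex function. -/
theorem volume_bracket_shell_le {n : ℕ} (hn : 3 ≤ n) {m : ℝ} (hm : 0 < m) {K : Set (Space n)}
    (hK : IsCompact K) (hKc : Convex ℝ K) {h : Space n → ℝ} (hh : Continuous h)
    (hhc : ConvexOn ℝ Set.univ h) (i : Fin n) {u₀ b : ℝ} (hu : u₀ ^ 2 + b ^ 2 = 1) {L δ R : ℝ}
    (hδ : 0 < δ) (hR : 0 ≤ R) (hL : ∀ x ∈ K, bracket m x ≤ L)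
    (hw : ∀ x ∈ K, δ ≤ m * u₀ + b * x i) {c : Fin n → ℝ} (hc : ∀ x ∈ K, ∀ l, |x l - c l| ≤ R)
    {s t : ℝ} (hst : s < t) :
    volume {x ∈ K | bracket m x + h x ∈ Set.Ioc s t} ≤
      ENNReal.ofReal (2 ^ (n + 1) * (16 * (L ^ 3 / δ ^ 2) * (2 * R) ^ (n - 2)) * (t - s)) := by
  rcases K.eq_empty_or_nonempty with rfl | hne
  · simp
  set f : Space n → ℝ := fun x => bracket m x + h x with hf
  have hfc : Continuous f := (continuous_bracket m).add hh
  have hfconv : ConvexOn ℝ K f := ((convexOn_bracket m).add hhc).subset (Set.subset_univ _) hKc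
  obtain ⟨x₀, hx₀, hmin⟩ := hK.exists_isMinOn hne hfc.continuousOn
  have hL0 : 0 < L := (bracket_pos hm x₀).trans_le (hL x₀ hx₀)
  -- Two transversal coordinates, each giving a factor `√τ`, are what makes the sublevel volume
  -- linear in `τ`; this is where `3 ≤ n` is needed.
  obtain ⟨j, k, hij, hik, hjk⟩ : ∃ j k : Fin n, i ≠ j ∧ i ≠ k ∧ j ≠ k := by
    have h3 : 2 < (Finset.univ : Finset (Fin n)).card := by
      rw [Finset.card_univ, Fintype.card_fin]; omega
    obtain ⟨j, hj⟩ : ∃ j, j ≠ i := by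
      have : Nontrivial (Fin n) := Fin.nontrivial_iff_two_le.2 (by omega)
      exact exists_ne i
    obtain ⟨k, hk⟩ : ∃ k, k ∉ ({i, j} : Finset (Fin n)) := by
      by_contra! hcon
      have : (Finset.univ : Finset (Fin n)) ⊆ {i, j} := fun x _ => hcon x
      have := (Finset.card_le_card this).trans Finset.card_le_two
      omega
    simp only [Finset.mem_insert, Finset.mem_singleton, not_or] at hk
    exact ⟨j, k, hj.symm, Ne.symm hk.1, Ne.symm hk.2⟩
  set w₀ := m * u₀ + b * x₀ i with hw₀
  have hw₀δ : δ ≤ w₀ := hw x₀ hx₀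
  have hw₀p : 0 < w₀ := hδ.trans_le hw₀δ
  -- The midpoint of `x₀` and `x` cannot lie below the minimum, and `h` only adds to the midpoint
  -- defect of `f`; hence the defect of the bracket alone is at most `τ`.
  have growth : ∀ l, i ≠ l → ∀ x ∈ K, ∀ τ, 0 < τ → f x ≤ f x₀ + τ →
      |x l - b * x₀ l / w₀ * x i - (x₀ l - b * x₀ l / w₀ * x₀ i)| ≤
        Real.sqrt (4 * (L ^ 3 / δ ^ 2) * τ) := by
    intro l hil x hx τ hτ hfx
    have h1 := sq_shear_le_bracket hm hil hu (hL x₀ hx₀) (hL x hx)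
    have hmid : (1 / 2 : ℝ) • x₀ + (1 / 2 : ℝ) • x ∈ K :=
      hKc hx₀ hx (by norm_num) (by norm_num) (by norm_num)
    have h2 : f x₀ ≤ f ((1 / 2 : ℝ) • x₀ + (1 / 2 : ℝ) • x) := hmin hmid
    have h3 := hhc.2 (Set.mem_univ x₀) (Set.mem_univ x) (by norm_num : (0:ℝ) ≤ 1 / 2)
      (by norm_num : (0:ℝ) ≤ 1 / 2) (by norm_num)
    simp only [smul_eq_mul] at h3
    simp only [hf] at h2 hfx
    have h4 : bracket m x₀ + bracket m x - 2 * bracket m ((1 / 2 : ℝ) • x₀ + (1 / 2 : ℝ) • x)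
        ≤ τ := by linarith
    have h5 : (w₀ * x l - x₀ l * (m * u₀ + b * x i)) ^ 2 ≤ 4 * L ^ 3 * τ :=
      h1.trans (mul_le_mul_of_nonneg_left h4 (by positivity))
    refine Real.abs_le_sqrt ?_
    -- Divided by `w₀ ≥ δ`, the minor becomes the sheared coordinate, with slope `b * x₀ l / w₀`
    -- depending on `x₀` only.
    have e : (w₀ * x l - x₀ l * (m * u₀ + b * x i)) =
        w₀ * (x l - b * x₀ l / w₀ * x i - (x₀ l - b * x₀ l / w₀ * x₀ i)) := by
      field_simp
      rw [hw₀]; ring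
    rw [e, mul_pow] at h5
    set T := (x l - b * x₀ l / w₀ * x i - (x₀ l - b * x₀ l / w₀ * x₀ i)) ^ 2
    have hT : 0 ≤ T := sq_nonneg _
    have h6 : δ ^ 2 * T ≤ 4 * L ^ 3 * τ :=
      (mul_le_mul_of_nonneg_right (by gcongr) hT).trans h5
    rw [show 4 * (L ^ 3 / δ ^ 2) * τ = (4 * L ^ 3 * τ) / δ ^ 2 by ring,
      le_div_iff₀ (by positivity)]
    linarith
  have := measure_convex_shell_le (volume : Measure (Space n)) hK hfc hfconv hx₀
    (B := 16 * (L ^ 3 / δ ^ 2) * (2 * R) ^ (n - 2)) (by positivity) ?_ hst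
  · simpa using this
  intro τ hτ
  refine (measure_mono ?_).trans ((volume_sheared_box_le hij hik hjk (b * x₀ j / w₀)
    (b * x₀ k / w₀) (x₀ j - b * x₀ j / w₀ * x₀ i) (x₀ k - b * x₀ k / w₀ * x₀ i) c
    (Real.sqrt_nonneg (4 * (L ^ 3 / δ ^ 2) * τ)) hR).trans_eq ?_)
  · rintro x ⟨hx, hfx⟩
    exact ⟨growth j hij x hx τ hτ hfx, growth k hik x hx τ hτ hfx, hc x hx⟩
  · congr 1
    rw [mul_pow, Real.sq_sqrt (by positivity)]
    ring

end Shell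

/-! ### Shell estimates over frequency regions and cubes -/

section Pushforward

theorem one_le_size (N : ℝ) : 1 ≤ size N := le_max_left _ _

theorem IsDyadic.eq_zero_or_size {N : ℝ} (h : IsDyadic N) : N = 0 ∨ size N = N := by
  rcases h with h | ⟨k, rfl⟩
  · exact Or.inl h
  · exact Or.inr (max_eq_right (one_le_pow₀ (by norm_num)))

theorem isClosed_freqRegion (n : ℕ) (a N : ℝ) : IsClosed (freqRegion n a N) :=
  (isClosed_le continuous_const continuous_norm).inter
    (isClosed_le continuous_norm continuous_const)

theorem abs_coord_le_norm {n : ℕ} (x : Space n) (l : Fin n) : |x l| ≤ ‖x‖ := by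
  simpa using PiLp.norm_apply_le x l

theorem exists_coord_ge {n : ℕ} (hn : 0 < n) (x : Space n) : ∃ i, ‖x‖ / n ≤ |x i| := by
  by_contra! hcon
  have hn' : (0 : ℝ) < n := by exact_mod_cast hn
  have h1 : ‖x‖ ≤ ∑ i, |x i| := by
    have := norm_sum_le Finset.univ fun i => EuclideanSpace.single i (x i)
    simp only [PiLp.norm_single, Real.norm_eq_abs] at this
    refine le_trans (le_of_eq ?_) this
    congr 1
    ext j
    simp
  have h2 : ∑ i, |x i| < ∑ _i : Fin n, ‖x‖ / n := by
    have : Nonempty (Fin n) := ⟨⟨0, hn⟩⟩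
    exact Finset.sum_lt_sum_of_nonempty Finset.univ_nonempty fun i _ => hcon i
  rw [Finset.sum_const, Finset.card_univ, Fintype.card_fin, nsmul_eq_mul,
    mul_div_cancel₀ _ hn'.ne'] at h2
  linarith

/-- A constant that bounds the shells over every piece of the frequency region. -/
noncomputable def pieceConst (n : ℕ) (a m : ℝ) : ℝ :=
  2 ^ (n + 1) * (16 * ((m + a) ^ 3 / (min m (1 / (a * n))) ^ 2) * 2 ^ (n - 2))

theorem pieceConst_nonneg {n : ℕ} {a m : ℝ} (ha : 1 ≤ a) (hm : 0 < m) : 0 ≤ pieceConst n a m := by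
  unfold pieceConst
  have : 0 < m + a := by linarith
  positivity

theorem bracket_le {n : ℕ} {m : ℝ} (hm : 0 < m) (x : Space n) : bracket m x ≤ m + ‖x‖ := by
  rw [bracket, Real.sqrt_le_left (by positivity)]
  nlinarith [mul_nonneg hm.le (norm_nonneg x)]

/-- A frequency annulus is not convex; a ball, a cube and a half-space are, and so is their
intersection. There `L` and `δ` are both of order `size M`, so `L ^ 3 / δ ^ 2` yields a single power
of `size M`. -/
theorem volume_freq_piece_le {n : ℕ} (hn : 3 ≤ n) {a m : ℝ} (ha : 1 ≤ a) (hm : 0 < m)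
    {M : ℝ} (i : Fin n) {u₀ b : ℝ} (hu : u₀ ^ 2 + b ^ 2 = 1) {R : ℝ} (hR : 0 ≤ R)
    (c : Fin n → ℝ) {h : Space n → ℝ} (hh : Continuous h) (hhc : ConvexOn ℝ Set.univ h)
    {s t : ℝ} (hst : s < t) :
    volume {x | ‖x‖ ≤ a * size M ∧ (∀ l, |x l - c l| ≤ R) ∧
      min m (1 / (a * n)) * size M ≤ m * u₀ + b * x i ∧ bracket m x + h x ∈ Set.Ioc s t} ≤
      ENNReal.ofReal (pieceConst n a m * size M * R ^ (n - 2) * (t - s)) := by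
  set δ₀ := min m (1 / (a * n)) with hδ₀
  have hn' : (0 : ℝ) < n := by exact_mod_cast (by omega : 0 < n)
  have hδ₀p : 0 < δ₀ := lt_min hm (by positivity)
  have hM : 0 < size M := zero_lt_one.trans_le (one_le_size M)
  set K : Set (Space n) := {x | ‖x‖ ≤ a * size M} ∩ {x | ∀ l, |x l - c l| ≤ R} ∩
    {x | δ₀ * size M ≤ m * u₀ + b * x i} with hKd
  have hc1 : IsCompact {x : Space n | ‖x‖ ≤ a * size M} := by
    have : {x : Space n | ‖x‖ ≤ a * size M} = Metric.closedBall 0 (a * size M) := by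
      ext x; simp
    rw [this]; exact isCompact_closedBall _ _
  have hcl2 : IsClosed {x : Space n | ∀ l, |x l - c l| ≤ R} := by
    simp only [Set.ofPred_forall]
    exact isClosed_iInter fun l => isClosed_le (by fun_prop) continuous_const
  have hcl3 : IsClosed {x : Space n | δ₀ * size M ≤ m * u₀ + b * x i} :=
    isClosed_le continuous_const (by fun_prop)
  have hK : IsCompact K := (hc1.inter_right hcl2).inter_right hcl3
  have hKc : Convex ℝ K := by
    rintro x ⟨⟨hx1, hx2⟩, hx3⟩ y ⟨⟨hy1, hy2⟩, hy3⟩ p q hp hq hpq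
    simp only [Set.mem_ofPred_eq] at hx1 hx2 hx3 hy1 hy2 hy3
    refine ⟨⟨?_, ?_⟩, ?_⟩
    · refine (norm_add_le _ _).trans ?_
      rw [norm_smul, norm_smul, Real.norm_of_nonneg hp, Real.norm_of_nonneg hq]
      calc _ ≤ p * (a * size M) + q * (a * size M) := by gcongr
        _ = a * size M := by rw [← add_mul, hpq, one_mul]
    · intro l
      have e : (p • x + q • y) l - c l = p * (x l - c l) + q * (y l - c l) := by
        simp only [PiLp.add_apply, PiLp.smul_apply, smul_eq_mul]
        linear_combination (c l) * hpq
      rw [e]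
      refine (abs_add_le _ _).trans ?_
      rw [abs_mul, abs_mul, abs_of_nonneg hp, abs_of_nonneg hq]
      calc _ ≤ p * R + q * R := by gcongr; exacts [hx2 l, hy2 l]
        _ = R := by rw [← add_mul, hpq, one_mul]
    · simp only [Set.mem_ofPred_eq, PiLp.add_apply, PiLp.smul_apply, smul_eq_mul]
      calc δ₀ * size M = p * (δ₀ * size M) + q * (δ₀ * size M) := by rw [← add_mul, hpq, one_mul]
        _ ≤ p * (m * u₀ + b * x i) + q * (m * u₀ + b * y i) := by gcongr
        _ = _ := by linear_combination (m * u₀) * hpq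
  have hL : ∀ x ∈ K, bracket m x ≤ (m + a) * size M := by
    rintro x ⟨⟨hx1, -⟩, -⟩
    have := bracket_le hm x
    simp only [Set.mem_ofPred_eq] at hx1
    nlinarith [one_le_size M]
  have key := volume_bracket_shell_le hn hm hK hKc hh hhc i hu (L := (m + a) * size M)
    (δ := δ₀ * size M) (by positivity) hR hL (fun x hx => hx.2) (fun x hx => hx.1.2) hst
  refine le_trans (measure_mono ?_) (key.trans_eq ?_)
  · rintro x ⟨h1, h2, h3, h4⟩
    exact ⟨⟨⟨h1, h2⟩, h3⟩, h4⟩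
  · congr 1
    rw [pieceConst, ← hδ₀, mul_pow (2 : ℝ) R]
    field_simp

/-- Some coordinate of `x` has absolute value at least `‖x‖ / n`, so the `2 * n` convex pieces given
by a coordinate and its sign cover the annulus. -/
theorem volume_freq_shell_le {n : ℕ} (hn : 3 ≤ n) {a m : ℝ} (ha : 1 ≤ a) (hm : 0 < m)
    {M : ℝ} (hM : IsDyadic M) {R : ℝ} (hR : 0 ≤ R)
    (c : Fin n → ℝ) {h : Space n → ℝ} (hh : Continuous h) (hhc : ConvexOn ℝ Set.univ h)
    {s t : ℝ} (hst : s < t) :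
    volume {x | x ∈ freqRegion n a M ∧ (∀ l, |x l - c l| ≤ R) ∧
      bracket m x + h x ∈ Set.Ioc s t} ≤
      ENNReal.ofReal (2 * n * pieceConst n a m * size M * R ^ (n - 2) * (t - s)) := by
  have hn1 : (1 : ℝ) ≤ n := by exact_mod_cast (by omega : 1 ≤ n)
  have hP := pieceConst_nonneg (n := n) ha hm
  have hS := one_le_size M
  have hts : 0 < t - s := sub_pos.2 hst
  set Q := pieceConst n a m * size M * R ^ (n - 2) * (t - s) with hQ
  have hQ0 : 0 ≤ Q := by positivity
  have hQe : 2 * n * pieceConst n a m * size M * R ^ (n - 2) * (t - s) = 2 * n * Q := by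
    rw [hQ]; ring
  rw [hQe]
  -- For `M = 0` the frequencies may vanish, and the positive mass supplies the lower bound instead:
  -- the direction is the mass axis.
  rcases hM.eq_zero_or_size with h0 | hMs
  · refine le_trans (measure_mono ?_) ((volume_freq_piece_le hn ha hm (M := M)
      ⟨0, by omega⟩ (u₀ := 1) (b := 0) (by norm_num) hR c hh hhc hst).trans ?_)
    · rintro x ⟨h1, h2, h3⟩
      refine ⟨h1.2, h2, ?_, h3⟩
      have : size M = 1 := by rw [h0]; norm_num [size]
      rw [this]
      simp
    · refine ENNReal.ofReal_le_ofReal ?_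
      rw [← hQ]
      nlinarith
  · have hcover : {x | x ∈ freqRegion n a M ∧ (∀ l, |x l - c l| ≤ R) ∧
        bracket m x + h x ∈ Set.Ioc s t} ⊆ ⋃ e : Fin n × Bool,
        {x | ‖x‖ ≤ a * size M ∧ (∀ l, |x l - c l| ≤ R) ∧
          min m (1 / (a * n)) * size M ≤ m * 0 + (if e.2 then 1 else -1) * x e.1 ∧
          bracket m x + h x ∈ Set.Ioc s t} := by
      rintro x ⟨h1, h2, h3⟩
      obtain ⟨i, hi⟩ := exists_coord_ge (by omega : 0 < n) x
      have hlow : min m (1 / (a * n)) * size M ≤ |x i| := by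
        calc _ ≤ 1 / (a * n) * size M := by gcongr; exact min_le_right _ _
          _ = M / a / n := by rw [hMs]; field_simp
          _ ≤ ‖x‖ / n := by gcongr; exact h1.1
          _ ≤ _ := hi
      rw [Set.mem_iUnion]
      rcases abs_cases (x i) with ⟨e, -⟩ | ⟨e, -⟩
      · exact ⟨(i, true), h1.2, h2, by rw [e] at hlow; simpa only [mul_zero, zero_add, if_true, if_false, Bool.false_eq_true, one_mul, neg_one_mul] using hlow, h3⟩
      · exact ⟨(i, false), h1.2, h2, by rw [e] at hlow; simpa only [mul_zero, zero_add, if_true, if_false, Bool.false_eq_true, one_mul, neg_one_mul] using hlow, h3⟩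
    calc _ ≤ _ := measure_mono hcover
      _ ≤ ∑ e : Fin n × Bool, volume _ := measure_iUnion_fintype_le _ _
      _ ≤ ∑ _e : Fin n × Bool, ENNReal.ofReal Q := by
        refine Finset.sum_le_sum fun e _ => ?_
        refine volume_freq_piece_le hn ha hm e.1 ?_ hR c hh hhc hst
        split_ifs <;> norm_num
      _ = _ := by
        rw [Finset.sum_const, Finset.card_univ, Fintype.card_prod, Fintype.card_fin,
          Fintype.card_bool, nsmul_eq_mul, ← ENNReal.ofReal_natCast,
          ← ENNReal.ofReal_mul (by positivity)]
        congr 1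
        push_cast
        ring

/-- The frequencies of size `M` in a cube, in terms of Mathlib's frequency variable. -/
def freqCube (n : ℕ) (a M R : ℝ) (c : Fin n → ℝ) : Set (Space n) :=
  {η | (2 * Real.pi) • η ∈ freqRegion n a M ∧ ∀ l, |η l - c l| ≤ R}

theorem measurableSet_freqCube (n : ℕ) (a M R : ℝ) (c : Fin n → ℝ) :
    MeasurableSet (freqCube n a M R c) := by
  have h1 : IsClosed ((fun η : Space n => (2 * Real.pi) • η) ⁻¹' freqRegion n a M) :=
    (isClosed_freqRegion n a M).preimage (continuous_const_smul (2 * Real.pi))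
  have h2 : IsClosed {η : Space n | ∀ l, |η l - c l| ≤ R} := by
    simp only [Set.ofPred_forall]
    exact isClosed_iInter fun l => isClosed_le (by fun_prop) continuous_const
  exact (h1.inter h2).measurableSet

noncomputable def shellConst (n : ℕ) (a m : ℝ) : ℝ :=
  2 * n * pieceConst n a m * (2 * Real.pi * a) ^ (n - 2)

theorem shellConst_nonneg {n : ℕ} {a m : ℝ} (ha : 1 ≤ a) (hm : 0 < m) : 0 ≤ shellConst n a m := by
  have := pieceConst_nonneg (n := n) ha hm
  unfold shellConst
  positivity

theorem volume_freqCube_shell_le {n : ℕ} (hn : 3 ≤ n) {a m : ℝ} (ha : 1 ≤ a) (hm : 0 < m)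
    {M : ℝ} (hM : IsDyadic M) {R : ℝ} (hR : 0 ≤ R)
    (c : Fin n → ℝ) {h : Space n → ℝ} (hh : Continuous h) (hhc : ConvexOn ℝ Set.univ h)
    {s t : ℝ} (hst : s < t) :
    volume {η | η ∈ freqCube n a M R c ∧
      bracket m ((2 * Real.pi) • η) + h η ∈ Set.Ioc s t} ≤
      ENNReal.ofReal (shellConst n a m * size M * min R (size M) ^ (n - 2) * (t - s)) := by
  have hP := pieceConst_nonneg (n := n) ha hm
  have hS := one_le_size M
  have hts : 0 < t - s := sub_pos.2 hst
  have hpi : 1 ≤ 2 * Real.pi := by linarith [Real.pi_gt_three]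
  have hpi0 : 2 * Real.pi ≠ 0 := by positivity
  -- A cube larger than the frequency ball is replaced by one just containing the ball; this
  -- produces `min R (size M)`.
  obtain ⟨c', R', hR', hle, hcc⟩ : ∃ (c' : Fin n → ℝ) (R' : ℝ), 0 ≤ R' ∧
      R' ≤ (2 * Real.pi * a) * min R (size M) ∧
      ∀ η ∈ freqCube n a M R c, ∀ l, |((2 * Real.pi) • η) l - c' l| ≤ R' := by
    rcases le_total R (size M) with h1 | h1
    · refine ⟨fun l => 2 * Real.pi * c l, 2 * Real.pi * R, by positivity, ?_, ?_⟩
      · rw [min_eq_left h1]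
        nlinarith [mul_nonneg Real.pi_pos.le hR]
      · intro η hη l
        rw [PiLp.smul_apply, smul_eq_mul, ← mul_sub, abs_mul, abs_of_pos (by positivity)]
        exact mul_le_mul_of_nonneg_left (hη.2 l) (by positivity)
    · refine ⟨0, a * size M, by positivity, ?_, ?_⟩
      · rw [min_eq_right h1]
        nlinarith [mul_pos (by linarith : 0 < a) (by linarith : 0 < size M)]
      · intro η hη l
        rw [Pi.zero_apply, sub_zero]
        exact (abs_coord_le_norm _ l).trans hη.1.2
  set h' : Space n → ℝ := fun x => h ((2 * Real.pi)⁻¹ • x)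
  have hh' : Continuous h' := hh.comp (continuous_const_smul _)
  have hhc' : ConvexOn ℝ Set.univ h' :=
    hhc.comp_linearMap (LinearMap.lsmul ℝ (Space n) (2 * Real.pi)⁻¹)
  have key := volume_freq_shell_le hn ha hm hM hR' c' hh' hhc' hst
  set T := {x | x ∈ freqRegion n a M ∧ (∀ l, |x l - c' l| ≤ R') ∧
      bracket m x + h' x ∈ Set.Ioc s t}
  calc _ ≤ volume ((fun η : Space n => (2 * Real.pi) • η) ⁻¹' T) := by
        refine measure_mono fun η hη => ⟨hη.1.1, hcc η hη.1, ?_⟩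
        have : h' ((2 * Real.pi) • η) = h η := by simp only [h', inv_smul_smul₀ hpi0]
        simp only [this]
        exact hη.2
    _ ≤ volume T := by
        rw [Measure.addHaar_preimage_smul _ hpi0]
        refine mul_le_of_le_one_left zero_le ?_
        rw [ENNReal.ofReal_le_one, abs_inv, abs_of_pos (by positivity)]
        exact inv_le_one_of_one_le₀ (one_le_pow₀ hpi)
    _ ≤ _ := key
    _ ≤ _ := by
        refine ENNReal.ofReal_le_ofReal ?_
        have : R' ^ (n - 2) ≤ (2 * Real.pi * a) ^ (n - 2) * min R (size M) ^ (n - 2) := by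
          rw [← mul_pow]; exact pow_le_pow_left₀ hR' hle _
        calc _ ≤ 2 * n * pieceConst n a m * size M *
              ((2 * Real.pi * a) ^ (n - 2) * min R (size M) ^ (n - 2)) * (t - s) := by gcongr
          _ = _ := by rw [shellConst]; ring

/-- The added `1` makes the bound visibly positive, as `measure_le_smul_volume_of_Ioc` requires. -/
noncomputable def shellBound (n : ℕ) (a m M R : ℝ) : ℝ :=
  (shellConst n a m + 1) * size M * min R (size M) ^ (n - 2)

theorem shellBound_pos {n : ℕ} {a m M R : ℝ} (ha : 1 ≤ a) (hm : 0 < m) (hR : 0 < R) :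
    0 < shellBound n a m M R := by
  have hC := shellConst_nonneg (n := n) ha hm
  have hS := one_le_size M
  have hmin : 0 < min R (size M) := lt_min hR (by linarith)
  unfold shellBound
  positivity

theorem map_shell_le {n : ℕ} (hn : 3 ≤ n) {a m : ℝ} (ha : 1 ≤ a) (hm : 0 < m)
    {M : ℝ} (hM : IsDyadic M) {R : ℝ} (hR : 0 < R)
    (c : Fin n → ℝ) {h : Space n → ℝ} (hh : Continuous h) (hhc : ConvexOn ℝ Set.univ h) :
    (volume.restrict (freqCube n a M R c)).map
        (fun η => bracket m ((2 * Real.pi) • η) + h η) ≤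
      ENNReal.ofReal (shellBound n a m M R) • volume := by
  rw [shellBound]
  have hC := shellConst_nonneg (n := n) ha hm
  have hS := one_le_size M
  have hmin : 0 < min R (size M) := lt_min hR (by linarith)
  have hf : Continuous fun η : Space n => bracket m ((2 * Real.pi) • η) + h η :=
    ((continuous_bracket m).comp (continuous_const_smul _)).add hh
  refine measure_le_smul_volume_of_Ioc ?_ ENNReal.ofReal_ne_top fun s t hst => ?_
  · exact (ENNReal.ofReal_pos.2 (by positivity)).ne'
  · rw [Measure.map_apply hf.measurable measurableSet_Ioc,
      Measure.restrict_apply (hf.measurable measurableSet_Ioc), Set.inter_comm]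
    refine (volume_freqCube_shell_le hn ha hm hM hR.le c hh hhc hst).trans ?_
    have hts : 0 < t - s := sub_pos.2 hst
    rw [← ENNReal.ofReal_mul (by positivity)]
    refine ENNReal.ofReal_le_ofReal ?_
    gcongr
    linarith

end Pushforward

/-! ### Density of the sums of two frequencies -/

section Pairs

theorem units_cast_eq (s : ℤˣ) : ((s : ℤ) : ℝ) = 1 ∨ ((s : ℤ) : ℝ) = -1 := by
  rcases Int.units_eq_one_or s with rfl | rfl <;> simp

theorem units_cast_mul_self (s : ℤˣ) : ((s : ℤ) : ℝ) * ((s : ℤ) : ℝ) = 1 := by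
  rcases units_cast_eq s with h | h <;> rw [h] <;> norm_num

theorem bracket_units_smul {n : ℕ} (m : ℝ) (s : ℤˣ) (x : Space n) :
    bracket m (((s : ℤ) : ℝ) • x) = bracket m x := by
  rcases units_cast_eq s with h | h <;> rw [h] <;> simp [bracket]

/-- This is the change of variables that makes the output frequency the second coordinate while
keeping the first input. -/
theorem measurePreserving_shear {V : Type*} [NormedAddCommGroup V] [InnerProductSpace ℝ V]
    [FiniteDimensional ℝ V] [MeasurableSpace V] [BorelSpace V] (μ : Measure V) [SFinite μ]
    (s₁ s₂ : ℤˣ) :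
    MeasurePreserving (fun w : V × V => (w.1, ((s₁ : ℤ) : ℝ) • w.1 + ((s₂ : ℤ) : ℝ) • w.2))
      (μ.prod volume) (μ.prod volume) := by
  refine (MeasurePreserving.id μ).skew_product
    (g := fun x y => ((s₁ : ℤ) : ℝ) • x + ((s₂ : ℤ) : ℝ) • y) (by fun_prop)
    (Filter.Eventually.of_forall fun x => ?_)
  have h2 : MeasurePreserving (fun y : V => ((s₂ : ℤ) : ℝ) • y) volume volume := by
    rcases units_cast_eq s₂ with h | h <;> rw [h]
    · simp only [one_smul]
      exact MeasurePreserving.id (volume : Measure V)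
    · simpa using Measure.measurePreserving_neg (volume : Measure V)
  exact ((measurePreserving_add_left volume (((s₁ : ℤ) : ℝ) • x)).comp h2).map_eq

theorem volume_spaceTime_eq_lintegral {n : ℕ} {s : Set (SpaceTime n)} (hs : MeasurableSet s) :
    volume s = ∫⁻ ξ : Space n, volume {τ : ℝ | (WithLp.toLp 2 (τ, ξ) : SpaceTime n) ∈ s} := by
  have h := WithLp.volume_preserving_toLp ℝ (Space n)
  rw [← h.measure_preimage hs.nullMeasurableSet, Measure.volume_eq_prod,
    Measure.prod_apply_symm (h.measurable hs)]
  rfl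

/-- By Fubini, a density bound for the temporal frequency, uniform over the spatial output
frequency, is a density bound in space-time. -/
theorem map_fibered_le {n : ℕ} {μ : Measure (Space n)} [SFinite μ] {f : Space n → Space n → ℝ}
    (hf : Measurable (Function.uncurry f)) {K : ℝ≥0∞} (h : ∀ ξ, μ.map (f ξ) ≤ K • volume) :
    (μ.prod volume).map (fun w => (WithLp.toLp 2 (f w.2 w.1, w.2) : SpaceTime n)) ≤
      K • volume := by
  have hr : Measurable fun w : Space n × Space n =>
      (WithLp.toLp 2 (f w.2 w.1, w.2) : SpaceTime n) :=
    (WithLp.volume_preserving_toLp ℝ (Space n)).measurable.comp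
      ((hf.comp measurable_swap).prodMk measurable_snd)
  rw [Measure.le_iff]
  intro s hs
  rw [Measure.map_apply hr hs, Measure.prod_apply_symm (hr hs), Measure.smul_apply,
    volume_spaceTime_eq_lintegral hs, smul_eq_mul]
  refine (lintegral_mono (g := fun ξ : Space n =>
    K * volume {τ : ℝ | (WithLp.toLp 2 (τ, ξ) : SpaceTime n) ∈ s}) fun ξ => ?_).trans ?_
  · have hm : MeasurableSet {τ : ℝ | (WithLp.toLp 2 (τ, ξ) : SpaceTime n) ∈ s} :=
      ((WithLp.volume_preserving_toLp ℝ (Space n)).measurable.comp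
        (measurable_id.prodMk measurable_const)) hs
    have hfξ : Measurable (f ξ) := hf.comp (measurable_const.prodMk measurable_id)
    have := h ξ {τ : ℝ | (WithLp.toLp 2 (τ, ξ) : SpaceTime n) ∈ s}
    rw [Measure.map_apply hfξ hm] at this
    exact this
  · refine (lintegral_const_mul _ ?_).le
    have h' := WithLp.volume_preserving_toLp ℝ (Space n)
    exact measurable_measure_prodMk_right (h'.measurable hs)

theorem convexOn_bracket_sub {n : ℕ} (m c : ℝ) (ξ : Space n) (b : ℝ) :
    ConvexOn ℝ Set.univ fun η : Space n => bracket m (c • (ξ - b • η)) := by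
  have := ((convexOn_bracket (n := n) m).translate_right (c • ξ)).comp_linearMap
    (LinearMap.lsmul ℝ (Space n) (-(c * b)))
  refine (this.congr fun η _ => ?_)
  simp only [Function.comp_apply, LinearMap.lsmul_apply]
  congr 1
  module

theorem continuous_bracket_sub {n : ℕ} (m c : ℝ) (ξ : Space n) (b : ℝ) :
    Continuous fun η : Space n => bracket m (c • (ξ - b • η)) :=
  (continuous_bracket m).comp (by fun_prop)

/-- The space-time frequency of the plane wave with spatial frequency `η` in a free wave. -/
noncomputable def waveFreq {n : ℕ} (m : ℝ) (s : ℤˣ) (η : Space n) : SpaceTime n :=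
  WithLp.toLp 2 (((s : ℤ) : ℝ) * bracket m ((2 * Real.pi) • η) / (2 * Real.pi), η)

theorem measurable_waveFreq {n : ℕ} (m : ℝ) (s : ℤˣ) : Measurable (waveFreq (n := n) m s) := by
  have : Continuous fun η : Space n =>
      ((s : ℤ) : ℝ) * bracket m ((2 * Real.pi) • η) / (2 * Real.pi) :=
    (continuous_const.mul ((continuous_bracket m).comp (continuous_const_smul _))).div_const _
  exact (WithLp.volume_preserving_toLp ℝ (Space n)).measurable.comp
    (this.measurable.prodMk measurable_id)

/-- Multiplication by the signs turns both temporal frequencies into positive brackets, so over each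
output frequency the temporal one is a bracket plus a convex function. The factor `2 * π` comes from
measuring it in Mathlib's frequency variable. -/
theorem map_waveFreq_pair_le {n : ℕ} (hn : 3 ≤ n) {a m₁ : ℝ} (m₂ : ℝ) (ha : 1 ≤ a) (hm : 0 < m₁)
    {M : ℝ} (hM : IsDyadic M) {R : ℝ} (hR : 0 < R) (c : Fin n → ℝ) (s₁ s₂ : ℤˣ) :
    ((volume.restrict (freqCube n a M R c)).prod volume).map
      (fun w => ((s₁ : ℤ) : ℝ) • waveFreq m₁ s₁ w.1 + ((s₂ : ℤ) : ℝ) • waveFreq m₂ s₂ w.2) ≤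
      ENNReal.ofReal (2 * Real.pi * shellBound n a m₁ M R) • volume := by
  have hpi : 0 < 2 * Real.pi := by positivity
  set b₁ : ℝ := ((s₁ : ℤ) : ℝ)
  set b₂ : ℝ := ((s₂ : ℤ) : ℝ)
  set g : Space n → Space n → ℝ := fun ξ η =>
    bracket m₁ ((2 * Real.pi) • η) + bracket m₂ ((2 * Real.pi) • (ξ - b₁ • η)) with hg
  have hgc : Continuous (Function.uncurry g) :=
    ((continuous_bracket m₁).comp (by fun_prop)).add ((continuous_bracket m₂).comp (by fun_prop))
  set f : Space n → Space n → ℝ := fun ξ η => g ξ η / (2 * Real.pi) with hf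
  have hfc : Continuous (Function.uncurry f) := hgc.div_const _
  have hB := shellBound_pos (n := n) (M := M) ha hm hR
  have hmap : ∀ ξ, (volume.restrict (freqCube n a M R c)).map (f ξ) ≤
      ENNReal.ofReal (2 * Real.pi * shellBound n a m₁ M R) • volume := by
    intro ξ
    have hgξ : Continuous (g ξ) := ((continuous_bracket m₁).comp (continuous_const_smul _)).add
      (continuous_bracket_sub m₂ (2 * Real.pi) ξ b₁)
    have hfξ : Continuous (f ξ) := hgξ.div_const _
    have h1 := map_shell_le hn ha hm hM hR c (continuous_bracket_sub m₂ (2 * Real.pi) ξ b₁)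
      (convexOn_bracket_sub m₂ (2 * Real.pi) ξ b₁)
    refine measure_le_smul_volume_of_Ioc ?_ ENNReal.ofReal_ne_top fun s t hst => ?_
    · exact (ENNReal.ofReal_pos.2 (by positivity)).ne'
    · have e : f ξ ⁻¹' Set.Ioc s t = g ξ ⁻¹' Set.Ioc (2 * Real.pi * s) (2 * Real.pi * t) := by
        ext η
        simp only [hf, Set.mem_preimage, Set.mem_Ioc, lt_div_iff₀ hpi, div_le_iff₀ hpi]
        rw [mul_comm s, mul_comm t]
      rw [Measure.map_apply hfξ.measurable measurableSet_Ioc, e,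
        ← Measure.map_apply hgξ.measurable measurableSet_Ioc]
      refine (h1 _).trans_eq ?_
      rw [Measure.smul_apply, Real.volume_Ioc, smul_eq_mul, ← ENNReal.ofReal_mul hB.le,
        ← ENNReal.ofReal_mul (by positivity)]
      congr 1
      ring
  have key := map_fibered_le hfc.measurable hmap
  have hshear := measurePreserving_shear (volume.restrict (freqCube n a M R c)) s₁ s₂
  rw [← hshear.map_eq, Measure.map_map ?_ hshear.measurable] at key
  · refine le_of_eq_of_le ?_ key
    congr 1
    ext1 w
    simp only [Function.comp_apply, waveFreq, hf, hg]
    refine WithLp.ofLp_injective 2 (Prod.ext ?_ ?_)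
    · have e1 : b₁ * b₁ = 1 := units_cast_mul_self s₁
      have e2 : b₂ * b₂ = 1 := units_cast_mul_self s₂
      have e3 : b₁ • w.1 + b₂ • w.2 - b₁ • w.1 = b₂ • w.2 := by abel
      rw [e3, smul_comm, bracket_units_smul]
      simp only [WithLp.ofLp_add, WithLp.ofLp_smul, Prod.fst_add, Prod.smul_fst, smul_eq_mul]
      field_simp
      linear_combination (bracket m₁ ((2 * Real.pi) • w.1)) * e1 +
        (bracket m₂ ((2 * Real.pi) • w.2)) * e2
    · simp only [WithLp.ofLp_add, WithLp.ofLp_smul, Prod.snd_add, Prod.smul_snd]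
      rfl
  · exact (WithLp.volume_preserving_toLp ℝ (Space n)).measurable.comp
      ((hfc.measurable.comp measurable_swap).prodMk measurable_snd)

/-- Up to signs the push-forward is the convolution of two indicator functions, whose value at `ζ`
is the volume in `hK`. -/
theorem map_add_restrict_prod_le {V : Type*} [NormedAddCommGroup V] [InnerProductSpace ℝ V]
    [FiniteDimensional ℝ V] [MeasurableSpace V] [BorelSpace V] {X Y : Set V}
    (hX : MeasurableSet X) (hY : MeasurableSet Y) (s₁ s₂ : ℤˣ) {K : ℝ≥0∞}
    (hK : ∀ ζ, volume {z | z ∈ X ∧ ((s₂ : ℤ) : ℝ) • (ζ - ((s₁ : ℤ) : ℝ) • z) ∈ Y} ≤ K) :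
    (((volume.restrict X).prod (volume.restrict Y)).map
      fun w => ((s₁ : ℤ) : ℝ) • w.1 + ((s₂ : ℤ) : ℝ) • w.2) ≤ K • (volume : Measure V) := by
  set b₁ : ℝ := ((s₁ : ℤ) : ℝ)
  set b₂ : ℝ := ((s₂ : ℤ) : ℝ) with hb₂
  have hr : Measurable fun w : V × V => b₁ • w.1 + b₂ • w.2 := by fun_prop
  rw [Measure.le_iff]
  intro s hs
  have hYm : MeasurableSet {w : V × V | b₂ • (w.2 - b₁ • w.1) ∈ Y} :=
    (by fun_prop : Measurable fun w : V × V => b₂ • (w.2 - b₁ • w.1)) hY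
  set T : Set (V × V) := ({w | w.2 ∈ s} ∩ {w | w.1 ∈ X}) ∩ {w | b₂ • (w.2 - b₁ • w.1) ∈ Y}
  have hT : MeasurableSet T := ((measurable_snd hs).inter (measurable_fst hX)).inter hYm
  have hshear := measurePreserving_shear (volume : Measure V) s₁ s₂
  rw [Measure.map_apply hr hs, Measure.prod_restrict, Measure.restrict_apply (hr hs)]
  have e : (fun w : V × V => b₁ • w.1 + b₂ • w.2) ⁻¹' s ∩ X ×ˢ Y =
      (fun w : V × V => (w.1, b₁ • w.1 + b₂ • w.2)) ⁻¹' T := by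
    ext w
    have e3 : b₂ • (b₁ • w.1 + b₂ • w.2 - b₁ • w.1) = w.2 := by
      rw [add_sub_cancel_left, smul_smul, hb₂, units_cast_mul_self, one_smul]
    change (_ ∧ _ ∧ _) ↔ ((_ ∧ _) ∧ b₂ • (b₁ • w.1 + b₂ • w.2 - b₁ • w.1) ∈ Y)
    rw [e3, and_assoc]
    rfl
  rw [e, hshear.measure_preimage hT.nullMeasurableSet, Measure.prod_apply_symm hT]
  calc ∫⁻ ζ, volume ((fun z => (z, ζ)) ⁻¹' T) ≤ ∫⁻ ζ, s.indicator (fun _ => K) ζ := by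
        refine lintegral_mono fun ζ => ?_
        by_cases hζ : ζ ∈ s
        · rw [Set.indicator_of_mem hζ]
          refine le_trans (measure_mono fun z hz => ?_) (hK ζ)
          exact ⟨hz.1.2, hz.2⟩
        · rw [Set.indicator_of_notMem hζ]
          refine (measure_mono_null (t := ∅) (fun z hz => hζ hz.1.1) measure_empty).le
    _ = (K • volume) s := by rw [lintegral_indicator hs, setLIntegral_const]; rfl

/-- The frequencies in a thickened surface and a cube, in terms of Mathlib's variable. -/
def thickCube (n : ℕ) (a M ε m : ℝ) (s : ℤˣ) (R : ℝ) (c : Fin n → ℝ) : Set (SpaceTime n) :=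
  {z | (2 * Real.pi) • z ∈ thickSurface n a M ε m s ∧ ∀ l, |z.snd l - c l| ≤ R}

theorem isClosed_thickSurface (n : ℕ) (a M ε m : ℝ) (s : ℤˣ) :
    IsClosed (thickSurface n a M ε m s) := by
  have hsnd : Continuous fun z : SpaceTime n => z.snd := by fun_prop
  have h1 : IsClosed ((fun z : SpaceTime n => z.snd) ⁻¹' freqRegion n a M) :=
    (isClosed_freqRegion n a M).preimage hsnd
  have h2 : IsClosed {z : SpaceTime n | |z.fst - ((s : ℤ) : ℝ) * bracket m z.snd| ≤ ε} :=
    isClosed_le (Continuous.abs (Continuous.sub (by fun_prop)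
      (continuous_const.mul ((continuous_bracket m).comp hsnd)))) continuous_const
  exact h1.inter h2

theorem measurableSet_thickCube (n : ℕ) (a M ε m : ℝ) (s : ℤˣ) (R : ℝ) (c : Fin n → ℝ) :
    MeasurableSet (thickCube n a M ε m s R c) := by
  have h1 : IsClosed ((fun z : SpaceTime n => (2 * Real.pi) • z) ⁻¹' thickSurface n a M ε m s) :=
    (isClosed_thickSurface n a M ε m s).preimage (continuous_const_smul _)
  have h2 : IsClosed {z : SpaceTime n | ∀ l, |z.snd l - c l| ≤ R} := by
    simp only [Set.ofPred_forall]
    exact isClosed_iInter fun l => isClosed_le (by fun_prop) continuous_const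
  exact (h1.inter h2).measurableSet

theorem volume_abs_two_pi_mul_sub_le (s : ℤˣ) (b ε : ℝ) :
    volume {t : ℝ | |2 * Real.pi * t - ((s : ℤ) : ℝ) * b| ≤ ε} ≤ ENNReal.ofReal (2 * ε) := by
  have hpi : 1 ≤ 2 * Real.pi := by linarith [Real.pi_gt_three]
  set c := ((s : ℤ) : ℝ) * b
  calc _ ≤ volume (Set.Icc (c / (2 * Real.pi) - ε) (c / (2 * Real.pi) + ε)) := by
        refine measure_mono fun t ht => ?_
        have h1 : |t - c / (2 * Real.pi)| ≤ ε := by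
          have e : 2 * Real.pi * t - c = 2 * Real.pi * (t - c / (2 * Real.pi)) := by field_simp
          simp only [Set.mem_ofPred_eq] at ht
          rw [e, abs_mul, abs_of_pos (by positivity)] at ht
          nlinarith [abs_nonneg (t - c / (2 * Real.pi))]
        rw [abs_le] at h1
        constructor <;> linarith
    _ = _ := by rw [Real.volume_Icc]; congr 1; ring

/-- Over a fixed `η` both constraints confine `τ` to an interval, and the shorter one counts; the
two are compatible only for `η` in a shell of thickness `2 * (ε₁ + ε₂)`. -/
theorem volume_thick_inter_le {n : ℕ} (hn : 3 ≤ n) {a m₁ : ℝ} (m₂ : ℝ) (ha : 1 ≤ a)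
    (hm : 0 < m₁) {M : ℝ} (hM : IsDyadic M) (N : ℝ) {R : ℝ} (hR : 0 < R) (c : Fin n → ℝ)
    (s₁ s₂ : ℤˣ) {ε₁ ε₂ : ℝ} (hε₁ : 0 < ε₁) (hε₂ : 0 < ε₂) (ζ : SpaceTime n) :
    volume {z | z ∈ thickCube n a M ε₁ m₁ s₁ R c ∧ ((s₂ : ℤ) : ℝ) • (ζ - ((s₁ : ℤ) : ℝ) • z) ∈
      {z | (2 * Real.pi) • z ∈ thickSurface n a N ε₂ m₂ s₂}} ≤
      ENNReal.ofReal (8 * (ε₁ * ε₂) * shellBound n a m₁ M R) := by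
  set b₁ : ℝ := ((s₁ : ℤ) : ℝ) with hb₁
  set b₂ : ℝ := ((s₂ : ℤ) : ℝ) with hb₂
  have hb₁1 : b₁ * b₁ = 1 := units_cast_mul_self s₁
  have hb₂1 : b₂ * b₂ = 1 := units_cast_mul_self s₂
  have habs₁ : |b₁| = 1 := by rcases units_cast_eq s₁ with h | h <;> rw [hb₁, h] <;> norm_num
  have habs₂ : |b₂| = 1 := by rcases units_cast_eq s₂ with h | h <;> rw [hb₂, h] <;> norm_num
  set g : Space n → ℝ := fun η =>
    bracket m₁ ((2 * Real.pi) • η) + bracket m₂ ((2 * Real.pi) • (ζ.snd - b₁ • η)) with hg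
  have hgc : Continuous g :=
    ((continuous_bracket m₁).comp (by fun_prop)).add ((continuous_bracket m₂).comp (by fun_prop))
  set J := Set.Icc (2 * Real.pi * ζ.fst - (ε₁ + ε₂)) (2 * Real.pi * ζ.fst + (ε₁ + ε₂))
  set S := freqCube n a M R c with hS
  have hSm : MeasurableSet (S ∩ g ⁻¹' J) :=
    (measurableSet_freqCube n a M R c).inter (hgc.measurable measurableSet_Icc)
  set A := {z | z ∈ thickCube n a M ε₁ m₁ s₁ R c ∧ b₂ • (ζ - b₁ • z) ∈
      {z | (2 * Real.pi) • z ∈ thickSurface n a N ε₂ m₂ s₂}} with hA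
  have hAm : MeasurableSet A := by
    refine (measurableSet_thickCube n a M ε₁ m₁ s₁ R c).inter ?_
    have : Continuous fun z : SpaceTime n => (2 * Real.pi) • (b₂ • (ζ - b₁ • z)) := by fun_prop
    exact ((isClosed_thickSurface n a N ε₂ m₂ s₂).preimage this).measurableSet
  have hB := shellBound_pos (n := n) (M := M) ha hm hR
  rw [volume_spaceTime_eq_lintegral hAm]
  have slice : ∀ η : Space n, volume {τ : ℝ | (WithLp.toLp 2 (τ, η) : SpaceTime n) ∈ A} ≤
      (S ∩ g ⁻¹' J).indicator (fun _ => ENNReal.ofReal (2 * min ε₁ ε₂)) η := by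
    intro η
    have hslice : ∀ τ : ℝ, (WithLp.toLp 2 (τ, η) : SpaceTime n) ∈ A →
        η ∈ S ∧ |2 * Real.pi * τ - b₁ * bracket m₁ ((2 * Real.pi) • η)| ≤ ε₁ ∧
        |2 * Real.pi * τ - b₁ * (2 * Real.pi * ζ.fst -
          bracket m₂ ((2 * Real.pi) • (ζ.snd - b₁ • η)))| ≤ ε₂ := by
      rintro τ ⟨⟨h1, h2⟩, h3⟩
      refine ⟨⟨h1.1, h2⟩, h1.2, ?_⟩
      have h4 := h3.2
      have e1 : ((2 * Real.pi) • b₂ • (ζ - b₁ • (WithLp.toLp 2 (τ, η) : SpaceTime n))).snd =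
          b₂ • (2 * Real.pi) • (ζ.snd - b₁ • η) := by
        rw [smul_comm]
        simp
      have e2 : ((2 * Real.pi) • b₂ • (ζ - b₁ • (WithLp.toLp 2 (τ, η) : SpaceTime n))).fst =
          2 * Real.pi * (b₂ * (ζ.fst - b₁ * τ)) := by
        simp
      rw [e1, e2, bracket_units_smul] at h4
      set B₂ := bracket m₂ ((2 * Real.pi) • (ζ.snd - b₁ • η))
      have e3 : 2 * Real.pi * τ - b₁ * (2 * Real.pi * ζ.fst - B₂) =
          -(b₁ * b₂) * (2 * Real.pi * (b₂ * (ζ.fst - b₁ * τ)) - b₂ * B₂) := by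
        linear_combination (-2 * Real.pi * τ * b₂ * b₂) * hb₁1 +
          (-2 * Real.pi * τ + 2 * Real.pi * b₁ * ζ.fst - b₁ * B₂) * hb₂1
      rw [e3, abs_mul, abs_neg, abs_mul, habs₁, habs₂, one_mul, one_mul]
      exact h4
    by_cases hη : η ∈ S ∩ g ⁻¹' J
    · rw [Set.indicator_of_mem hη]
      rcases le_total ε₁ ε₂ with h | h
      · rw [min_eq_left h]
        exact (measure_mono fun τ hτ => (hslice τ hτ).2.1).trans
          (volume_abs_two_pi_mul_sub_le s₁ _ _)
      · rw [min_eq_right h]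
        exact (measure_mono fun τ hτ => (hslice τ hτ).2.2).trans
          (volume_abs_two_pi_mul_sub_le s₁ _ _)
    · rw [Set.indicator_of_notMem hη]
      refine (measure_mono_null (t := ∅) (fun τ hτ => hη ?_) measure_empty).le
      obtain ⟨h1, h2, h3⟩ := hslice τ hτ
      refine ⟨h1, ?_⟩
      -- Subtracting the two constraints eliminates `τ`.
      have h5 : |b₁ * (2 * Real.pi * ζ.fst - g η)| ≤ ε₁ + ε₂ := by
        have := abs_sub (2 * Real.pi * τ - b₁ * bracket m₁ ((2 * Real.pi) • η))
          (2 * Real.pi * τ - b₁ * (2 * Real.pi * ζ.fst -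
          bracket m₂ ((2 * Real.pi) • (ζ.snd - b₁ • η))))
        refine le_trans (le_of_eq ?_) (this.trans (add_le_add h2 h3))
        congr 1
        simp only [hg]
        ring
      rw [abs_mul, habs₁, one_mul, abs_le] at h5
      constructor <;> linarith
  calc _ ≤ _ := lintegral_mono slice
    _ = ENNReal.ofReal (2 * min ε₁ ε₂) * volume (S ∩ g ⁻¹' J) := by
        rw [lintegral_indicator hSm, setLIntegral_const]
    _ ≤ ENNReal.ofReal (2 * min ε₁ ε₂) *
        (ENNReal.ofReal (shellBound n a m₁ M R) * ENNReal.ofReal (2 * (ε₁ + ε₂))) := by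
        gcongr
        have h1 := map_shell_le hn ha hm hM hR c
          (continuous_bracket_sub m₂ (2 * Real.pi) ζ.snd b₁)
          (convexOn_bracket_sub m₂ (2 * Real.pi) ζ.snd b₁) J
        rw [Measure.map_apply hgc.measurable measurableSet_Icc,
          Measure.restrict_apply (hgc.measurable measurableSet_Icc), Set.inter_comm] at h1
        refine h1.trans_eq ?_
        rw [Measure.smul_apply, Real.volume_Icc, smul_eq_mul]
        congr 2
        ring
    _ ≤ _ := by
        have hmin : 0 < min ε₁ ε₂ := lt_min hε₁ hε₂
        rw [← ENNReal.ofReal_mul hB.le, ← ENNReal.ofReal_mul (by positivity)]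
        refine ENNReal.ofReal_le_ofReal ?_
        -- The sum is at most twice the maximum, and minimum times maximum is the product.
        have : min ε₁ ε₂ * (ε₁ + ε₂) ≤ 2 * (ε₁ * ε₂) := by
          rcases le_total ε₁ ε₂ with h | h
          · rw [min_eq_left h]; nlinarith
          · rw [min_eq_right h]; nlinarith
        calc _ = 4 * (min ε₁ ε₂ * (ε₁ + ε₂)) * shellBound n a m₁ M R := by ring
          _ ≤ 4 * (2 * (ε₁ * ε₂)) * shellBound n a m₁ M R := by gcongr
          _ = _ := by ring

end Pairs

/-! ### From densities to bilinear estimates: multipliers, signs and cubes -/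

section Assembly

variable {n : ℕ} {Z : Type*} [MeasurableSpace Z]

theorem lintegral_spaceTime {f : SpaceTime n → ℝ≥0∞} (hf : Measurable f) :
    ∫⁻ z, f z = ∫⁻ t : ℝ, ∫⁻ x : Space n, f (WithLp.toLp 2 (t, x)) := by
  have h := WithLp.volume_preserving_toLp ℝ (Space n)
  rw [← h.lintegral_comp hf, Measure.volume_eq_prod]
  exact lintegral_prod _ (hf.comp h.measurable).aemeasurable

/-- At fixed time the temporal oscillation is a unimodular factor, which is put into the amplitude.
-/
theorem fourierExt_slice (μ : Measure Z) (r : Z → SpaceTime n) (D : Z → ℂ) (t : ℝ) (x : Space n) :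
    fourierExt μ r D (WithLp.toLp 2 (t, x)) =
      fourierExt μ (fun w => (r w).snd)
        (fun w => Real.fourierChar ((r w).fst * t) • D w) x := by
  unfold fourierExt
  congr 1 with w
  rw [smul_smul, ← AddChar.map_add_eq_mul, WithLp.prod_inner_apply, add_comm]
  congr 3
  simp [mul_comm]

theorem integrable_fourierChar_smul {μ : Measure Z} {g : Z → ℝ} (hg : Measurable g) {D : Z → ℂ}
    (hD : Integrable D μ) : Integrable (fun w => Real.fourierChar (g w) • D w) μ :=
  hD.mono ((Real.continuous_fourierChar.comp_aestronglyMeasurable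
    hg.aestronglyMeasurable).smul hD.1)
    (Filter.Eventually.of_forall fun w => by rw [Circle.norm_smul])

theorem measurable_fst_comp {r : Z → SpaceTime n} (hr : Measurable r) :
    Measurable fun w => (r w).fst :=
  (by fun_prop : Continuous fun z : SpaceTime n => z.fst).measurable.comp hr

theorem measurable_snd_comp {r : Z → SpaceTime n} (hr : Measurable r) :
    Measurable fun w => (r w).snd :=
  (by fun_prop : Continuous fun z : SpaceTime n => z.snd).measurable.comp hr

/-- On a time slice where the function is an integrable superposition of plane waves, a spatial
multiplier multiplies the amplitudes. -/
theorem fourierInv_mul_fourier_slice {μ : Measure Z} [SFinite μ] {r : Z → SpaceTime n}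
    (hr : Measurable r) {D : Z → ℂ} (hD : Integrable D μ) (h : SchwartzMap (Space n) ℂ) {t : ℝ}
    {w : Space n → ℂ} (hw : w =ᵐ[volume] fun x => fourierExt μ r D (WithLp.toLp 2 (t, x)))
    (hwi : Integrable w) (x : Space n) :
    𝓕⁻ (fun ξ => h ξ * 𝓕 w ξ) x =
      fourierExt μ r (fun y => h (r y).snd * D y) (WithLp.toLp 2 (t, x)) := by
  have h1 := fourierInv_mul_fourier_fourierExt (measurable_snd_comp hr)
    (integrable_fourierChar_smul ((measurable_fst_comp hr).mul_const t) hD) h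
    (by simpa only [fourierExt_slice] using hw) hwi x
  rw [h1, fourierExt_slice]
  congr 1 with y
  simp only [Circle.smul_def, smul_eq_mul]
  ring

theorem integrable_schwartz_mul {μ : Measure Z} {g : Z → Space n} (hg : Measurable g)
    {D : Z → ℂ} (hD : Integrable D μ) (h : SchwartzMap (Space n) ℂ) {S : ℝ}
    (hS : ∀ ξ, ‖h ξ‖ ≤ S) : Integrable (fun w => h (g w) * D w) μ :=
  hD.bdd_mul (c := S) (h.continuous.measurable.comp hg).aestronglyMeasurable
    (Filter.Eventually.of_forall fun _ => hS _)

/-- Plancherel on almost every time slice, then integration in time. The slices must be integrable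
because the multiplier is defined by Fourier integrals. -/
theorem lintegral_multiplier_le {μ : Measure Z} [SFinite μ] {r : Z → SpaceTime n}
    (hr : Measurable r) {D : Z → ℂ} (hD : Integrable D μ) (h : SchwartzMap (Space n) ℂ) {S : ℝ}
    (hS : ∀ ξ, ‖h ξ‖ ≤ S)
    (hslice : ∀ᵐ t : ℝ, Integrable fun x => fourierExt μ r D (WithLp.toLp 2 (t, x)))
    (hfin : ∫⁻ z, ‖fourierExt μ r D z‖ₑ ^ 2 ≠ ⊤) :
    ∫⁻ z, ‖fourierExt μ r (fun y => h (r y).snd * D y) z‖ₑ ^ 2 ≤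
      ENNReal.ofReal S ^ 2 * ∫⁻ z, ‖fourierExt μ r D z‖ₑ ^ 2 := by
  have hWc := continuous_fourierExt hr hD
  have hGc := continuous_fourierExt hr (integrable_schwartz_mul (measurable_snd_comp hr) hD h hS)
  have hWm : Measurable fun z => ‖fourierExt μ r D z‖ₑ ^ 2 := by fun_prop
  have htoLp := (WithLp.volume_preserving_toLp ℝ (Space n)).measurable
  rw [lintegral_spaceTime hWm] at hfin ⊢
  rw [lintegral_spaceTime (by fun_prop)]
  have hm1 : Measurable fun t : ℝ =>
      ∫⁻ x : Space n, ‖fourierExt μ r D (WithLp.toLp 2 (t, x))‖ₑ ^ 2 :=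
    Measurable.lintegral_prod_right' (f := fun w : ℝ × Space n =>
      ‖fourierExt μ r D (WithLp.toLp 2 w)‖ₑ ^ 2) (hWm.comp htoLp)
  rw [← lintegral_const_mul _ hm1]
  refine lintegral_mono_ae ?_
  filter_upwards [hslice, ae_lt_top hm1 hfin] with t ht1 ht2
  have h2 : MemLp (fun x => fourierExt μ r D (WithLp.toLp 2 (t, x))) 2 := by
    refine ⟨ht1.1, ?_⟩
    rw [lintegral_enorm_sq] at ht2
    exact (ENNReal.pow_lt_top_iff.1 ht2).resolve_right (by norm_num)
  have := lintegral_fourierInv_mul_fourier_le ht1 h2 h hS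
  simpa only [fourierInv_mul_fourier_slice hr hD h (Filter.EventuallyEq.refl _ _) ht1] using this

/-- Conjugation reverses every frequency and keeps all moduli; in an unprojected product each factor
can therefore be flipped on its own. -/
theorem exists_fourierExt_flip (μ : Measure Z) (p : Z → SpaceTime n) {A : Z → ℂ}
    (hA : Integrable A μ) (s : ℤˣ) : ∃ A' : Z → ℂ, Integrable A' μ ∧ (∀ w, ‖A' w‖ₑ = ‖A w‖ₑ) ∧
      ∀ z, ‖fourierExt μ p A z‖ₑ = ‖fourierExt μ (fun w => ((s : ℤ) : ℝ) • p w) A' z‖ₑ := by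
  rcases units_cast_eq s with h | h <;> rw [h]
  · exact ⟨A, hA, fun _ => rfl, fun z => by simp only [one_smul]⟩
  · refine ⟨fun w => (starRingEnd ℂ) (A w), ?_, fun w => RCLike.enorm_conj _, fun z => ?_⟩
    · exact Complex.conjLIE.integrable_comp_iff.2 hA
    · simp only [neg_one_smul]
      rw [← conj_fourierExt, RCLike.enorm_conj]

variable {Y : Type*} [MeasurableSpace Y]

/-- The `L²` bound for a product of two superpositions of plane waves, where the signs of the
frequencies may be chosen freely. -/
theorem lintegral_fourierExt_mul_fourierExt_le {μ : Measure Z} {ν : Measure Y} [SFinite μ]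
    [SFinite ν] {p : Z → SpaceTime n} {q : Y → SpaceTime n} (hp : Measurable p)
    (hq : Measurable q) {A : Z → ℂ} {B : Y → ℂ} (hA : Integrable A μ) (hB : Integrable B ν)
    {S : Set Z} {T : Set Y} (hS : MeasurableSet S) (hT : MeasurableSet T)
    (hAS : ∀ w ∉ S, A w = 0) (hBT : ∀ w ∉ T, B w = 0) (s₁ s₂ : ℤˣ) {K : ℝ≥0∞}
    (hK : ((μ.restrict S).prod (ν.restrict T)).map
      (fun w => ((s₁ : ℤ) : ℝ) • p w.1 + ((s₂ : ℤ) : ℝ) • q w.2) ≤ K • volume) :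
    ∫⁻ z, ‖fourierExt μ p A z * fourierExt ν q B z‖ₑ ^ 2 ≤
      K * ((∫⁻ w, ‖A w‖ₑ ^ 2 ∂μ) * ∫⁻ w, ‖B w‖ₑ ^ 2 ∂ν) := by
  obtain ⟨A', hA', hAe, hAf⟩ := exists_fourierExt_flip μ p hA s₁
  obtain ⟨B', hB', hBe, hBf⟩ := exists_fourierExt_flip ν q hB s₂
  have hmeas : Measurable fun w : Z × Y =>
      ((s₁ : ℤ) : ℝ) • p w.1 + ((s₂ : ℤ) : ℝ) • q w.2 := by fun_prop
  have e : ∀ z, ‖fourierExt μ p A z * fourierExt ν q B z‖ₑ ^ 2 =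
      ‖fourierExt (μ.prod ν) (fun w => ((s₁ : ℤ) : ℝ) • p w.1 + ((s₂ : ℤ) : ℝ) • q w.2)
        (fun w => A' w.1 * B' w.2) z‖ₑ ^ 2 := by
    intro z
    rw [enorm_mul, hAf, hBf, ← enorm_mul, fourierExt_mul]
  simp_rw [e]
  rw [Measure.prod_restrict] at hK
  refine (lintegral_fourierExt_sq_le hmeas (hA'.mul_prod hB') (hS.prod hT) ?_ hK).trans_eq ?_
  · intro w hw
    have : A' w.1 = 0 ∨ B' w.2 = 0 := by
      rw [Set.mem_prod, not_and_or] at hw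
      refine hw.imp (fun h => ?_) fun h => ?_
      · rw [← enorm_eq_zero, hAe, hAS _ h, enorm_zero]
      · rw [← enorm_eq_zero, hBe, hBT _ h, enorm_zero]
    rcases this with h | h <;> rw [h] <;> simp
  · congr 1
    simp_rw [enorm_mul, mul_pow, hAe, hBe]
    exact lintegral_prod_mul (hA.1.enorm.pow_const 2) (hB.1.enorm.pow_const 2)

/-- The lattice cube of side `R` which contains `ξ`. -/
noncomputable def cubeIdx (R : ℝ) (ξ : Space n) : Fin n → ℤ := fun l => ⌊ξ l / R⌋

theorem measurable_cubeIdx (R : ℝ) : Measurable (cubeIdx (n := n) R) := by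
  refine measurable_pi_lambda _ fun l => ?_
  exact Int.measurable_floor.comp (by fun_prop : Measurable fun ξ : Space n => ξ l / R)

theorem abs_sub_le_of_cubeIdx {R : ℝ} (hR : 0 < R) {ξ : Space n} {k : Fin n → ℤ}
    (h : cubeIdx R ξ = k) (l : Fin n) : |ξ l - R * k l| ≤ R := by
  have h1 : ⌊ξ l / R⌋ = k l := congrFun h l
  rw [Int.floor_eq_iff, le_div_iff₀ hR, div_lt_iff₀ hR] at h1
  rw [abs_le]
  constructor <;> nlinarith [h1.1, h1.2]

/-- Floors of two reals at distance at most `1` differ by at most `1`, which leaves three choices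
per coordinate. -/
theorem cubeIdx_sub_mem {R : ℝ} (hR : 0 < R) {ξ η : Space n} (h : ‖ξ - η‖ ≤ R) :
    cubeIdx R η - cubeIdx R ξ ∈ Fintype.piFinset fun _ : Fin n => Finset.Icc (-1 : ℤ) 1 := by
  rw [Fintype.mem_piFinset]
  intro l
  have h1 : |ξ l / R - η l / R| ≤ 1 := by
    rw [← sub_div, abs_div, abs_of_pos hR, div_le_one hR]
    exact (abs_coord_le_norm (ξ - η) l).trans h
  rw [abs_le] at h1
  have a1 := Int.floor_le (ξ l / R)
  have a2 := Int.lt_floor_add_one (ξ l / R)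
  have b1 := Int.floor_le (η l / R)
  have b2 := Int.lt_floor_add_one (η l / R)
  rw [Finset.mem_Icc]
  simp only [Pi.sub_apply, cubeIdx]
  constructor
  · have : ((-2 : ℤ) : ℝ) < ((⌊η l / R⌋ - ⌊ξ l / R⌋ : ℤ) : ℝ) := by push_cast; linarith [h1.1, h1.2]
    have := Int.cast_lt.1 this
    omega
  · have : ((⌊η l / R⌋ - ⌊ξ l / R⌋ : ℤ) : ℝ) < ((2 : ℤ) : ℝ) := by push_cast; linarith [h1.1, h1.2]
    have := Int.cast_lt.1 this
    omega

theorem exists_finset_cubeIdx {R : ℝ} (hR : 0 < R) (ρ : ℝ) :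
    ∃ T : Finset (Fin n → ℤ), ∀ ξ : Space n, ‖ξ‖ ≤ ρ → cubeIdx R ξ ∈ T := by
  refine ⟨Fintype.piFinset fun _ => Finset.Icc ⌊-(ρ / R)⌋ ⌊ρ / R⌋, fun ξ hξ => ?_⟩
  rw [Fintype.mem_piFinset]
  intro l
  have h1 : |ξ l / R| ≤ ρ / R := by
    rw [abs_div, abs_of_pos hR]
    exact div_le_div_of_nonneg_right ((abs_coord_le_norm ξ l).trans hξ) hR.le
  rw [abs_le] at h1
  rw [Finset.mem_Icc]
  exact ⟨Int.floor_le_floor h1.1, Int.floor_le_floor h1.2⟩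

/-- The pieces are disjoint. The injection `g` allows for the index shift between the cubes of the
two factors. -/
theorem sum_eLpNorm_indicator_sq_le {μ : Measure Z} {ι : Type*} {idx : Z → ι} (T : Finset ι)
    {g : ι → ι} (hg : Function.Injective g) (hm : ∀ i, MeasurableSet {x | idx x = i})
    (A : Z → ℂ) :
    ∑ k ∈ T, eLpNorm ({x | idx x = g k}.indicator A) 2 μ ^ 2 ≤ eLpNorm A 2 μ ^ 2 := by
  calc _ = ∑ k ∈ T, ∫⁻ x in {x | idx x = g k}, ‖A x‖ₑ ^ 2 ∂μ := by
        refine Finset.sum_congr rfl fun k _ => ?_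
        rw [← lintegral_enorm_sq, ← lintegral_indicator (hm _)]
        refine lintegral_congr fun x => ?_
        by_cases hx : x ∈ {x | idx x = g k}
        · rw [Set.indicator_of_mem hx, Set.indicator_of_mem hx]
        · rw [Set.indicator_of_notMem hx, Set.indicator_of_notMem hx]; simp
    _ = ∫⁻ x in ⋃ k ∈ T, {x | idx x = g k}, ‖A x‖ₑ ^ 2 ∂μ := by
        rw [lintegral_biUnion_finset ?_ fun k _ => hm _]
        intro i _ j _ hij
        refine Set.disjoint_left.2 fun x (hx : idx x = g i) (hy : idx x = g j) => hij ?_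
        exact hg (hx.symm.trans hy)
    _ ≤ ∫⁻ x, ‖A x‖ₑ ^ 2 ∂μ := setLIntegral_le_lintegral _ _
    _ = _ := lintegral_enorm_sq _ _

theorem sum_mul_le_of_sum_sq_le {ι : Type*} (T : Finset ι) {f g : ι → ℝ≥0∞} {a b : ℝ≥0∞}
    (hf : ∑ k ∈ T, f k ^ 2 ≤ a ^ 2) (hg : ∑ k ∈ T, g k ^ 2 ≤ b ^ 2) :
    ∑ k ∈ T, f k * g k ≤ a * b := by
  have h := ENNReal.inner_le_Lp_mul_Lq T f g Real.HolderConjugate.two_two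
  simp only [ENNReal.rpow_two] at h
  refine h.trans (mul_le_mul' ?_ ?_)
  · calc _ ≤ (a ^ 2) ^ (1 / (2 : ℝ)) := ENNReal.rpow_le_rpow hf (by norm_num)
      _ = a := by rw [← ENNReal.rpow_two, ← ENNReal.rpow_mul]; norm_num
  · calc _ ≤ (b ^ 2) ^ (1 / (2 : ℝ)) := ENNReal.rpow_le_rpow hg (by norm_num)
      _ = b := by rw [← ENNReal.rpow_two, ← ENNReal.rpow_mul]; norm_num

theorem fourierExt_sum {V : Type*} [NormedAddCommGroup V] [InnerProductSpace ℝ V]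
    [FiniteDimensional ℝ V] [MeasurableSpace V] [BorelSpace V]
    {ι : Type*} (T : Finset ι) {μ : Measure Z} {r : Z → V} (hr : Measurable r)
    {D : ι → Z → ℂ} (hD : ∀ i ∈ T, Integrable (D i) μ) (z : V) :
    fourierExt μ r (fun w => ∑ i ∈ T, D i w) z = ∑ i ∈ T, fourierExt μ r (D i) z := by
  unfold fourierExt
  simp_rw [Finset.smul_sum]
  exact integral_finsetSum T fun i hi => integrable_fourierExt hr (hD i hi) z

/-- The bilinear multiplier estimate for two pieces. -/
theorem eLpNorm_bilinear_piece_le {μ : Measure Z} {ν : Measure Y} [SFinite μ]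
    [SFinite ν] {p : Z → SpaceTime n} {q : Y → SpaceTime n} (hp : Measurable p)
    (hq : Measurable q) {A : Z → ℂ} {B : Y → ℂ} (hA : Integrable A μ) (hB : Integrable B ν)
    (hA2 : MemLp A 2 μ) (hB2 : MemLp B 2 ν)
    {S : Set Z} {T : Set Y} (hS : MeasurableSet S) (hT : MeasurableSet T)
    (hAS : ∀ w ∉ S, A w = 0) (hBT : ∀ w ∉ T, B w = 0) (s₁ s₂ : ℤˣ) {K : ℝ≥0∞} (hKt : K ≠ ⊤)
    (hK : ((μ.restrict S).prod (ν.restrict T)).map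
      (fun w => ((s₁ : ℤ) : ℝ) • p w.1 + ((s₂ : ℤ) : ℝ) • q w.2) ≤ K • volume)
    (hU : ∀ᵐ t : ℝ, MemLp (fun x => fourierExt μ p A (WithLp.toLp 2 (t, x))) 2)
    (hV : ∀ᵐ t : ℝ, MemLp (fun x => fourierExt ν q B (WithLp.toLp 2 (t, x))) 2)
    (h : SchwartzMap (Space n) ℂ) {H : ℝ} (hH : ∀ ξ, ‖h ξ‖ ≤ H) :
    eLpNorm (fourierExt (μ.prod ν) (fun w => p w.1 + q w.2)
      fun w => h (p w.1 + q w.2).snd * (A w.1 * B w.2)) 2 volume ≤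
      ENNReal.ofReal H * K ^ (1 / 2 : ℝ) * (eLpNorm A 2 μ * eLpNorm B 2 ν) := by
  have hr : Measurable fun w : Z × Y => p w.1 + q w.2 := by fun_prop
  have hW := lintegral_fourierExt_mul_fourierExt_le hp hq hA hB hS hT hAS hBT s₁ s₂ hK
  have hD := hA.mul_prod hB
  simp_rw [fourierExt_mul] at hW
  have hfin : K * ((∫⁻ w, ‖A w‖ₑ ^ 2 ∂μ) * ∫⁻ w, ‖B w‖ₑ ^ 2 ∂ν) ≠ ⊤ := by
    rw [lintegral_enorm_sq, lintegral_enorm_sq]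
    exact ENNReal.mul_ne_top hKt (ENNReal.mul_ne_top (ENNReal.pow_ne_top hA2.2.ne)
      (ENNReal.pow_ne_top hB2.2.ne))
  have h1 := lintegral_multiplier_le hr hD h hH ?_ (ne_top_of_le_ne_top hfin hW)
  · have h2 := h1.trans (mul_le_mul_right hW _)
    rw [lintegral_enorm_sq, lintegral_enorm_sq, lintegral_enorm_sq] at h2
    have e : ENNReal.ofReal H ^ 2 * (K * (eLpNorm A 2 μ ^ 2 * eLpNorm B 2 ν ^ 2)) =
        (ENNReal.ofReal H * K ^ (1 / 2 : ℝ) * (eLpNorm A 2 μ * eLpNorm B 2 ν)) ^ 2 := by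
      have : (K ^ (1 / 2 : ℝ)) ^ 2 = K := by
        rw [← ENNReal.rpow_two, ← ENNReal.rpow_mul]; norm_num
      rw [mul_pow, mul_pow, mul_pow, this, mul_assoc]
    rw [e] at h2
    exact (ENNReal.pow_le_pow_left_iff two_ne_zero).1 h2
  -- The product of two L² slices is integrable, as the slicewise multiplier bound demands.
  · filter_upwards [hU, hV] with t hUt hVt
    simp_rw [← fourierExt_mul]
    exact hUt.integrable_mul hVt

/-- The bilinear multiplier estimate: orthogonality over cubes of the size of the output
frequency reduces it to pieces. -/
theorem eLpNorm_bilinear_le {μ : Measure Z} {ν : Measure Y} [SFinite μ]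
    [SFinite ν] {p : Z → SpaceTime n} {q : Y → SpaceTime n} (hp : Measurable p)
    (hq : Measurable q) {A : Z → ℂ} {B : Y → ℂ} (hA : Integrable A μ) (hB : Integrable B ν)
    (hA2 : MemLp A 2 μ) (hB2 : MemLp B 2 ν)
    {S : Set Z} {T : Set Y} (hS : MeasurableSet S) (hT : MeasurableSet T)
    (hAS : ∀ w ∉ S, A w = 0) (hBT : ∀ w ∉ T, B w = 0) (s₁ s₂ : ℤˣ) {K : ℝ≥0∞} (hKt : K ≠ ⊤)
    {R : ℝ} (hR : 0 < R)
    (hK : ∀ k, ((μ.restrict (S ∩ {w | cubeIdx R (p w).snd = k})).prod (ν.restrict T)).map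
      (fun w => ((s₁ : ℤ) : ℝ) • p w.1 + ((s₂ : ℤ) : ℝ) • q w.2) ≤ K • volume)
    {ρ : ℝ} (hρ : ∀ w ∈ S, ‖(p w).snd‖ ≤ ρ)
    (hU : ∀ A' : Z → ℂ, Integrable A' μ → MemLp A' 2 μ →
      ∀ᵐ t : ℝ, MemLp (fun x => fourierExt μ p A' (WithLp.toLp 2 (t, x))) 2)
    (hV : ∀ B' : Y → ℂ, Integrable B' ν → MemLp B' 2 ν →
      ∀ᵐ t : ℝ, MemLp (fun x => fourierExt ν q B' (WithLp.toLp 2 (t, x))) 2)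
    (h : SchwartzMap (Space n) ℂ) {H : ℝ} (hH : ∀ ξ, ‖h ξ‖ ≤ H) (hhR : ∀ ξ, R < ‖ξ‖ → h ξ = 0) :
    eLpNorm (fourierExt (μ.prod ν) (fun w => p w.1 + q w.2)
      fun w => h (p w.1 + q w.2).snd * (A w.1 * B w.2)) 2 volume ≤
      3 ^ n * (ENNReal.ofReal H * K ^ (1 / 2 : ℝ) * (eLpNorm A 2 μ * eLpNorm B 2 ν)) := by
  classical
  have hr : Measurable fun w : Z × Y => p w.1 + q w.2 := by fun_prop
  set E : (Fin n → ℤ) → Set Z := fun k => {w | cubeIdx R (p w).snd = k} with hE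
  -- The second factor is indexed by the cube of `-q`: a small output `p + q` then means that the
  -- two cubes are equal or adjacent.
  set F : (Fin n → ℤ) → Set Y := fun k => {w | cubeIdx R (-(q w).snd) = k} with hF
  have hEm : ∀ k, MeasurableSet (E k) := fun k =>
    ((measurable_cubeIdx R).comp (measurable_snd_comp hp)) (measurableSet_singleton k)
  have hFm : ∀ k, MeasurableSet (F k) := fun k =>
    ((measurable_cubeIdx R).comp (measurable_snd_comp hq).neg) (measurableSet_singleton k)
  obtain ⟨P, hP⟩ := exists_finset_cubeIdx (n := n) hR ρ
  set J : Finset (Fin n → ℤ) := Fintype.piFinset fun _ : Fin n => Finset.Icc (-1 : ℤ) 1 with hJ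
  have hJc : J.card = 3 ^ n := by
    rw [hJ, Fintype.card_piFinset_const]
    rfl
  -- Here `e.2` is the cube of the first factor and `e.1` the offset to the cube of the second.
  set D : (Fin n → ℤ) × (Fin n → ℤ) → Z × Y → ℂ := fun e w =>
    h (p w.1 + q w.2).snd * ((E e.2).indicator A w.1 * (F (e.2 + e.1)).indicator B w.2) with hD
  have hAk : ∀ k, Integrable ((E k).indicator A) μ := fun k => hA.indicator (hEm k)
  have hBk : ∀ k, Integrable ((F k).indicator B) ν := fun k => hB.indicator (hFm k)
  have hDi : ∀ e, Integrable (D e) (μ.prod ν) := fun e =>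
    integrable_schwartz_mul (measurable_snd_comp hr) ((hAk _).mul_prod (hBk _)) h hH
  have hsum : (fun w : Z × Y => h (p w.1 + q w.2).snd * (A w.1 * B w.2)) =
      fun w => ∑ e ∈ J ×ˢ P, D e w := by
    ext w
    set k := cubeIdx R (p w.1).snd with hk
    set k' := cubeIdx R (-(q w.2).snd) with hk'
    rw [Finset.sum_eq_single (k' - k, k)]
    · simp only [hD]
      rw [Set.indicator_of_mem (show w.1 ∈ E k from rfl), Set.indicator_of_mem]
      change k' = _
      abel
    · rintro ⟨j, i⟩ - hne
      simp only [hD]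
      by_cases h1 : w.1 ∈ E i
      · by_cases h2 : w.2 ∈ F (i + j)
        · refine absurd ?_ hne
          have h1' : k = i := h1
          have h2' : k' = i + j := h2
          rw [h2', h1', add_sub_cancel_left]
        · rw [Set.indicator_of_notMem h2]; simp
      · rw [Set.indicator_of_notMem h1]; simp
    -- A pair missing from the finite sum contributes nothing: a far offset makes the symbol vanish,
    -- a cube outside `P` makes `A` vanish.
    · intro hnot
      rw [Finset.mem_product, not_and_or] at hnot
      rcases hnot with hnot | hnot
      · have : R < ‖(p w.1 + q w.2).snd‖ := by
          by_contra! hcon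
          refine hnot (cubeIdx_sub_mem hR ?_)
          rw [sub_neg_eq_add]
          exact hcon
        simp only [hD, hhR _ this, zero_mul]
      · have : w.1 ∉ S := fun hw => hnot (hP _ (hρ _ hw))
        simp only [hD]
        have hz : (E k).indicator A w.1 = 0 := by
          rw [Set.indicator_apply, hAS _ this, ite_self]
        rw [hz]; simp
  set c := ENNReal.ofReal H * K ^ (1 / 2 : ℝ) with hc
  have hpiece : ∀ e, eLpNorm (fourierExt (μ.prod ν) (fun w => p w.1 + q w.2) (D e)) 2 volume ≤
      c * (eLpNorm ((E e.2).indicator A) 2 μ * eLpNorm ((F (e.2 + e.1)).indicator B) 2 ν) := by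
    intro e
    refine eLpNorm_bilinear_piece_le hp hq (hAk _) (hBk _) (hA2.indicator (hEm _))
      (hB2.indicator (hFm _)) (hS.inter (hEm e.2)) hT ?_ ?_ s₁ s₂ hKt (hK e.2)
      (hU _ (hAk _) (hA2.indicator (hEm _))) (hV _ (hBk _) (hB2.indicator (hFm _))) h hH
    · intro w hw
      by_cases h1 : w ∈ E e.2
      · rw [Set.indicator_of_mem h1]
        exact hAS w fun h2 => hw ⟨h2, h1⟩
      · rw [Set.indicator_of_notMem h1]
    · intro w hw
      rw [Set.indicator_apply, hBT w hw, ite_self]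
  have hGsum : fourierExt (μ.prod ν) (fun w => p w.1 + q w.2)
      (fun w => h (p w.1 + q w.2).snd * (A w.1 * B w.2)) =
      ∑ e ∈ J ×ˢ P, fourierExt (μ.prod ν) (fun w => p w.1 + q w.2) (D e) := by
    ext z
    rw [hsum, fourierExt_sum _ hr (fun e _ => hDi e), Finset.sum_apply]
  rw [hGsum]
  calc _ ≤ ∑ e ∈ J ×ˢ P, eLpNorm (fourierExt (μ.prod ν) (fun w => p w.1 + q w.2) (D e)) 2
          volume := eLpNorm_sum_le (fun e _ =>
            (continuous_fourierExt hr (hDi e)).aestronglyMeasurable) (by norm_num)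
    _ ≤ ∑ e ∈ J ×ˢ P, c * (eLpNorm ((E e.2).indicator A) 2 μ *
          eLpNorm ((F (e.2 + e.1)).indicator B) 2 ν) := Finset.sum_le_sum fun e _ => hpiece e
    _ = ∑ j ∈ J, c * ∑ k ∈ P, eLpNorm ((E k).indicator A) 2 μ *
          eLpNorm ((F (k + j)).indicator B) 2 ν := by
        rw [Finset.sum_product]
        exact Finset.sum_congr rfl fun j _ => by rw [Finset.mul_sum]
    -- For a fixed offset each cube of one factor meets exactly one of the other, so Cauchy–Schwarz
    -- over the cubes loses nothing; only the `3 ^ n` offsets cost a constant.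
    _ ≤ ∑ _j ∈ J, c * (eLpNorm A 2 μ * eLpNorm B 2 ν) := by
        refine Finset.sum_le_sum fun j _ => mul_le_mul_right (sum_mul_le_of_sum_sq_le P ?_ ?_) _
        · exact sum_eLpNorm_indicator_sq_le P (g := fun k => k) Function.injective_id hEm A
        · exact sum_eLpNorm_indicator_sq_le P (g := fun k => k + j) (add_left_injective j) hFm B
    _ = _ := by
        rw [Finset.sum_const, hJc, nsmul_eq_mul]
        push_cast
        rfl

end Assembly

/-! ### Littlewood–Paley symbols as Schwartz functions -/

section Symbols

theorem IsCutoff.eq_zero {χ : ℝ → ℝ} (hχ : IsCutoff χ) {r : ℝ} (hr : 2 ≤ |r|) : χ r = 0 := by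
  refine image_eq_zero_of_notMem_tsupport fun h => ?_
  have := hχ.support h
  rcases le_abs.1 hr with h' | h'
  · linarith [this.2]
  · linarith [this.1]

theorem IsCutoff.hasCompactSupport {χ : ℝ → ℝ} (hχ : IsCutoff χ) : HasCompactSupport χ :=
  isCompact_Icc.of_isClosed_subset (isClosed_tsupport χ)
    (hχ.support.trans Set.Ioo_subset_Icc_self)

/-- The norm fails to be smooth only at the origin, near which the cutoff is constant. -/
theorem IsCutoff.contDiff_radial {n : ℕ} {χ : ℝ → ℝ} (hχ : IsCutoff χ) {c : ℝ} (hc : 0 < c) :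
    ContDiff ℝ ∞ fun ξ : Space n => χ (c * ‖ξ‖) := by
  rw [contDiff_iff_contDiffAt]
  intro ξ
  by_cases h0 : ξ = 0
  · subst h0
    have : (fun ξ : Space n => χ (c * ‖ξ‖)) =ᶠ[nhds 0] fun _ => 1 := by
      filter_upwards [Metric.ball_mem_nhds (0 : Space n) (inv_pos.2 hc)] with ξ hξ
      refine hχ.eq_one _ ?_
      rw [mem_ball_zero_iff] at hξ
      rw [abs_of_nonneg (by positivity)]
      calc c * ‖ξ‖ ≤ c * c⁻¹ := by gcongr
        _ = 1 := mul_inv_cancel₀ hc.ne'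
    exact contDiffAt_const.congr_of_eventuallyEq this
  · exact hχ.smooth.contDiffAt.comp ξ (contDiffAt_const.mul (contDiffAt_norm ℝ h0))

theorem IsCutoff.exists_radial_schwartz (n : ℕ) {χ : ℝ → ℝ} (hχ : IsCutoff χ) {c : ℝ}
    (hc : 0 < c) : ∃ h : SchwartzMap (Space n) ℂ, ∀ ξ, h ξ = (χ (c * ‖ξ‖) : ℂ) := by
  have hcs : HasCompactSupport fun ξ : Space n => ((χ (c * ‖ξ‖) : ℝ) : ℂ) := by
    refine HasCompactSupport.intro (isCompact_closedBall (0 : Space n) (2 / c)) fun ξ hξ => ?_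
    rw [mem_closedBall_zero_iff, not_le, div_lt_iff₀ hc] at hξ
    rw [hχ.eq_zero, Complex.ofReal_zero]
    rw [abs_of_nonneg (by positivity)]
    linarith
  exact ⟨hcs.toSchwartzMap (Complex.ofRealCLM.contDiff.comp (hχ.contDiff_radial hc)),
    fun ξ => rfl⟩

/-- `h` is the symbol of a bounded spatial multiplier with profile `σ`, cutting off at frequencies
of size `O`. -/
structure IsSymbol {n : ℕ} (σ : ℝ → ℝ) (O H : ℝ) (h : SchwartzMap (Space n) ℂ) : Prop where
  eq_profile : ∀ ξ, h ξ = (σ ‖(2 * Real.pi) • ξ‖ : ℂ)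
  bound : ∀ ξ, ‖h ξ‖ ≤ H
  eq_zero : ∀ ξ, 2 * size O ≤ ‖(2 * Real.pi) • ξ‖ → h ξ = 0

/-- As `2 * π` exceeds `2`, cubes of side exactly `size O` in Mathlib's variable are large enough
for the neighbour argument. -/
theorem IsSymbol.eq_zero_of_lt {n : ℕ} {σ : ℝ → ℝ} {O H : ℝ} {h : SchwartzMap (Space n) ℂ}
    (hh : IsSymbol σ O H h) (ξ : Space n) (hξ : size O < ‖ξ‖) : h ξ = 0 := by
  refine hh.eq_zero ξ ?_
  rw [norm_smul, Real.norm_of_nonneg (by positivity)]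
  nlinarith [Real.pi_gt_three, norm_nonneg ξ]

theorem exists_symbols (n : ℕ) {χ : ℝ → ℝ} (hχ : IsCutoff χ) : ∃ H : ℝ, 0 ≤ H ∧
    ∀ O, IsDyadic O → (∃ h : SchwartzMap (Space n) ℂ, IsSymbol (annulusProfile χ O) O H h) ∧
      ∃ h : SchwartzMap (Space n) ℂ, IsSymbol (lowProfile χ O) O H h := by
  obtain ⟨B, hB⟩ := hχ.smooth.continuous.bounded_above_of_compact_support hχ.hasCompactSupport
  have hB0 : 0 ≤ B := (norm_nonneg _).trans (hB 0)
  have hpi : (0 : ℝ) < 2 * Real.pi := by positivity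
  have hnorm : ∀ ξ : Space n, ‖(2 * Real.pi) • ξ‖ = 2 * Real.pi * ‖ξ‖ := fun ξ => by
    rw [norm_smul, Real.norm_of_nonneg hpi.le]
  -- `B` bounds the cutoff, which may exceed `1` between `1` and `2`; the annular symbol is a
  -- difference of two dilates. The bound is uniform in `O`.
  refine ⟨2 * B, by positivity, fun O hO => ?_⟩
  rcases hO.eq_zero_or_size with h0 | hs
  · subst h0
    have hs : size 0 = 1 := by norm_num [size]
    obtain ⟨h, hh⟩ := hχ.exists_radial_schwartz n (c := 2 * (2 * Real.pi)) (by positivity)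
    have e : ∀ ξ : Space n, h ξ = (χ (2 * ‖(2 * Real.pi) • ξ‖) : ℂ) := fun ξ => by
      rw [hh, hnorm, mul_assoc]
    have hb : ∀ ξ, ‖h ξ‖ ≤ 2 * B := fun ξ => by
      rw [e, Complex.norm_real]; linarith [hB (2 * ‖(2 * Real.pi) • ξ‖)]
    have hz : ∀ ξ, 2 * size 0 ≤ ‖(2 * Real.pi) • ξ‖ → h ξ = 0 := fun ξ hξ => by
      rw [hs] at hξ
      rw [e, hχ.eq_zero, Complex.ofReal_zero]
      rw [abs_of_nonneg (by positivity)]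
      linarith
    exact ⟨⟨h, fun ξ => by rw [e]; simp [annulusProfile], hb, hz⟩,
      ⟨h, fun ξ => by rw [e]; simp [lowProfile], hb, hz⟩⟩
  · have hO1 : 1 ≤ O := hs ▸ one_le_size O
    have hO0 : 0 < O := by linarith
    obtain ⟨h, hh⟩ := hχ.exists_radial_schwartz n (c := 2 * Real.pi / O) (by positivity)
    obtain ⟨h', hh'⟩ := hχ.exists_radial_schwartz n (c := 2 * (2 * Real.pi / O)) (by positivity)
    have e : ∀ ξ : Space n, h ξ = (χ (‖(2 * Real.pi) • ξ‖ / O) : ℂ) := fun ξ => by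
      rw [hh, hnorm]; congr 2; ring
    have e' : ∀ ξ : Space n, h' ξ = (χ (2 * (‖(2 * Real.pi) • ξ‖ / O)) : ℂ) := fun ξ => by
      rw [hh', hnorm]; congr 2; ring
    have hb : ∀ ξ, ‖h ξ‖ ≤ B := fun ξ => by
      rw [e, Complex.norm_real]; exact hB _
    have hb' : ∀ ξ, ‖h' ξ‖ ≤ B := fun ξ => by
      rw [e', Complex.norm_real]; exact hB _
    have hz : ∀ ξ, 2 * size O ≤ ‖(2 * Real.pi) • ξ‖ → h ξ = 0 := fun ξ hξ => by
      rw [hs] at hξ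
      rw [e, hχ.eq_zero, Complex.ofReal_zero]
      rw [abs_of_nonneg (by positivity), le_div_iff₀ hO0]
      exact hξ
    have hz' : ∀ ξ, 2 * size O ≤ ‖(2 * Real.pi) • ξ‖ → h' ξ = 0 := fun ξ hξ => by
      rw [hs] at hξ
      rw [e', hχ.eq_zero, Complex.ofReal_zero]
      rw [abs_of_nonneg (by positivity), ← mul_div_assoc, le_div_iff₀ hO0]
      linarith [norm_nonneg ((2 * Real.pi) • ξ)]
    refine ⟨⟨h - h', fun ξ => ?_, fun ξ => ?_, fun ξ hξ => ?_⟩, ⟨h, fun ξ => ?_, fun ξ => ?_, hz⟩⟩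
    · rw [sub_apply, e, e']; simp [annulusProfile, hO0.ne']
    · rw [sub_apply]
      linarith [norm_sub_le (h ξ) (h' ξ), hb ξ, hb' ξ]
    · rw [sub_apply, hz ξ hξ, hz' ξ hξ, sub_zero]
    · rw [e]; simp [lowProfile, hO0.ne']
    · linarith [hb ξ]

end Symbols

/-! ### Products of free waves -/

section FreeWaves

variable {n : ℕ}

/-- The spatial frequencies of size `M`, in terms of Mathlib's frequency variable. -/
def freqSet (n : ℕ) (a M : ℝ) : Set (Space n) := {η | (2 * Real.pi) • η ∈ freqRegion n a M}

theorem measurableSet_freqSet (n : ℕ) (a M : ℝ) : MeasurableSet (freqSet n a M) :=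
  ((isClosed_freqRegion n a M).preimage (f := fun η : Space n => (2 * Real.pi) • η)
    (continuous_const_smul (2 * Real.pi))).measurableSet

theorem norm_le_norm_two_pi_smul {V : Type*} [NormedAddCommGroup V] [NormedSpace ℝ V] (x : V) :
    ‖x‖ ≤ ‖(2 * Real.pi) • x‖ := by
  rw [norm_smul, Real.norm_of_nonneg (by positivity)]
  nlinarith [Real.pi_gt_three, norm_nonneg x]

theorem norm_le_of_mem_freqSet {a M : ℝ} {η : Space n} (h : η ∈ freqSet n a M) :
    ‖η‖ ≤ a * size M := (norm_le_norm_two_pi_smul η).trans h.2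

/-- L² is contained in L¹ on a set of finite measure. Frequency localization thus makes the
plane-wave integrals converge absolutely. -/
theorem integrable_indicator_of_memLp_two {V : Type*} [NormedAddCommGroup V]
    [InnerProductSpace ℝ V] [FiniteDimensional ℝ V] [MeasurableSpace V] [BorelSpace V]
    {f : V → ℂ} (hf : MemLp f 2) {S : Set V} (hS : MeasurableSet S) {ρ : ℝ}
    (hρ : ∀ x ∈ S, ‖x‖ ≤ ρ) : Integrable (S.indicator f) := by
  rw [integrable_indicator_iff hS]
  have hfin : volume S < ⊤ := by
    refine (measure_mono (t := Metric.closedBall 0 ρ) fun x hx => ?_).trans_lt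
      measure_closedBall_lt_top
    simpa using hρ x hx
  have : IsFiniteMeasure ((volume : Measure V).restrict S) := ⟨by simpa using hfin⟩
  exact (hf.restrict S).integrable (by norm_num)

theorem waveSymbol_eq (m : ℝ) (s : ℤˣ) (t : ℝ) (η : Space n) :
    waveSymbol m s t η = Real.fourierChar ((waveFreq m s η).fst * t) := by
  rw [waveSymbol, Real.fourierChar_apply]
  have e : (waveFreq m s η).fst =
    ((s : ℤ) : ℝ) * bracket m ((2 * Real.pi) • η) / (2 * Real.pi) := rfl
  rw [e]
  congr 3
  field_simp

theorem fourierExt_waveFreq_slice (m : ℝ) (s : ℤˣ) (A : Space n → ℂ) (t : ℝ) :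
    (fun x => fourierExt volume (waveFreq m s) A (WithLp.toLp 2 (t, x))) =
      𝓕⁻ fun η => waveSymbol m s t η * A η := by
  ext x
  rw [fourierExt_slice, Real.fourierInv_eq, fourierExt]
  congr 1 with η
  rw [waveSymbol_eq, Circle.smul_def ((Real.fourierChar _)) (A η), smul_eq_mul]
  rfl

theorem integrable_waveSymbol_mul (m : ℝ) (s : ℤˣ) (t : ℝ) {A : Space n → ℂ}
    (hA : Integrable A) : Integrable fun η => waveSymbol m s t η * A η := by
  have := integrable_fourierChar_smul ((measurable_fst_comp (measurable_waveFreq m s)).mul_const t)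
    hA
  simpa only [waveSymbol_eq, Circle.smul_def, smul_eq_mul] using this

theorem memLp_two_waveSymbol_mul (m : ℝ) (s : ℤˣ) (t : ℝ) {A : Space n → ℂ}
    (hA : Integrable A) (hA2 : MemLp A 2) : MemLp (fun η => waveSymbol m s t η * A η) 2 := by
  refine hA2.of_le (integrable_waveSymbol_mul m s t hA).1 (Filter.Eventually.of_forall fun η => ?_)
  rw [norm_mul, waveSymbol_eq, Circle.norm_coe, one_mul]

theorem memLp_fourierExt_waveFreq_slice (m : ℝ) (s : ℤˣ) {A : Space n → ℂ} (hA : Integrable A)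
    (hA2 : MemLp A 2) (t : ℝ) :
    MemLp (fun x => fourierExt volume (waveFreq m s) A (WithLp.toLp 2 (t, x))) 2 := by
  rw [fourierExt_waveFreq_slice]
  have h1 := integrable_waveSymbol_mul m s t hA
  have h2 := memLp_two_waveSymbol_mul m s t hA hA2
  refine ⟨(continuous_fourierInv_of_integrable h1).aestronglyMeasurable, ?_⟩
  rw [eLpNorm_fourierInv h1 h2]
  exact h2.2

/-- A localized free wave is a superposition of plane waves with integrable amplitudes. -/
theorem LocalizedAt.exists_fourierExt {a M : ℝ} {φ : L2x n} (hφ : LocalizedAt a M φ) (m : ℝ)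
    (s : ℤˣ) : ∃ A : Space n → ℂ, Integrable A ∧ MemLp A 2 ∧ (∀ η ∉ freqSet n a M, A η = 0) ∧
      eLpNorm A 2 volume = ‖φ‖ₑ ∧ ∀ t : ℝ, (freeWave m s φ t : Space n → ℂ) =ᵐ[volume]
        fun x => fourierExt volume (waveFreq m s) A (WithLp.toLp 2 (t, x)) := by
  set A := (freqSet n a M).indicator (𝓕 φ : L2x n) with hA
  have hm := measurableSet_freqSet n a M
  have hAe : (𝓕 φ : L2x n) =ᵐ[volume] A := by
    filter_upwards [hφ] with η hη
    by_cases h : η ∈ freqSet n a M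
    · rw [hA, Set.indicator_of_mem h]
    · rw [hA, Set.indicator_of_notMem h, hη h]
  have hAi : Integrable A := integrable_indicator_of_memLp_two (Lp.memLp _) hm
    fun η hη => norm_le_of_mem_freqSet hη
  have hA2 : MemLp A 2 := (Lp.memLp _).indicator hm
  refine ⟨A, hAi, hA2, fun η hη => Set.indicator_of_notMem hη _, ?_, fun t => ?_⟩
  · rw [← eLpNorm_congr_ae hAe, ← Lp.enorm_def, ← ofReal_norm, ← ofReal_norm, Lp.norm_fourier_eq]
  · rw [fourierExt_waveFreq_slice]
    have h1 := integrable_waveSymbol_mul m s t hAi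
    have h2 := memLp_two_waveSymbol_mul m s t hAi hA2
    have e : freeWave m s φ t = 𝓕⁻ (h2.toLp _) := by
      rw [freeWave]
      congr 1
      rw [MemLp.toLp_eq_toLp_iff]
      filter_upwards [hAe] with η hη
      rw [hη]
    rw [e]
    exact coeFn_fourierInv_toLp h1 h2

theorem map_restrict_prod_restrict_mono {X Y W : Type*} [MeasurableSpace X] [MeasurableSpace Y]
    [MeasurableSpace W] {μ : Measure X} {ν : Measure Y} [SFinite μ] [SFinite ν] {r : X × Y → W}
    (hr : Measurable r) {S S' : Set X} {T T' : Set Y} (hS : S ⊆ S') (hT : T ⊆ T') :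
    ((μ.restrict S).prod (ν.restrict T)).map r ≤ ((μ.restrict S').prod (ν.restrict T')).map r := by
  refine Measure.map_mono ?_ hr
  rw [Measure.prod_restrict, Measure.prod_restrict]
  exact Measure.restrict_mono (Set.prod_mono hS hT) le_rfl

/-- At every time both waves have an L² slice, so the product is integrable there; this gives
equality at every point although the slices are known only almost everywhere in `x`. -/
theorem spatialMultiplier_freeProduct {σ : ℝ → ℝ} {O H : ℝ} {h : SchwartzMap (Space n) ℂ}
    (hh : IsSymbol σ O H h) {m₁ m₂ : ℝ} {s₁ s₂ : ℤˣ} {φ ψ : L2x n} {A B : Space n → ℂ}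
    (hA : Integrable A) (hA2 : MemLp A 2) (hB : Integrable B) (hB2 : MemLp B 2)
    (hφ : ∀ t : ℝ, (freeWave m₁ s₁ φ t : Space n → ℂ) =ᵐ[volume]
        fun x => fourierExt volume (waveFreq m₁ s₁) A (WithLp.toLp 2 (t, x)))
    (hψ : ∀ t : ℝ, (freeWave m₂ s₂ ψ t : Space n → ℂ) =ᵐ[volume]
        fun x => fourierExt volume (waveFreq m₂ s₂) B (WithLp.toLp 2 (t, x))) :
    spatialMultiplier σ (freeProduct m₁ m₂ s₁ s₂ φ ψ) =
      fourierExt (volume.prod volume) (fun w => waveFreq m₁ s₁ w.1 + waveFreq m₂ s₂ w.2)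
        fun w => h (waveFreq m₁ s₁ w.1 + waveFreq m₂ s₂ w.2).snd * (A w.1 * B w.2) := by
  have hr : Measurable fun w : Space n × Space n => waveFreq m₁ s₁ w.1 + waveFreq m₂ s₂ w.2 :=
    ((measurable_waveFreq m₁ s₁).comp measurable_fst).add
      ((measurable_waveFreq m₂ s₂).comp measurable_snd)
  ext p
  have hslice : (fun x : Space n => freeProduct m₁ m₂ s₁ s₂ φ ψ (WithLp.toLp 2 (p.fst, x)))
      =ᵐ[volume] fun x => fourierExt (volume.prod volume)
        (fun w => waveFreq m₁ s₁ w.1 + waveFreq m₂ s₂ w.2) (fun w => A w.1 * B w.2)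
        (WithLp.toLp 2 (p.fst, x)) := by
    filter_upwards [hφ p.fst, hψ p.fst] with x h1 h2
    rw [← fourierExt_mul, ← h1, ← h2]
    rfl
  have hi : Integrable fun x : Space n =>
      freeProduct m₁ m₂ s₁ s₂ φ ψ (WithLp.toLp 2 (p.fst, x)) := by
    refine Integrable.congr ?_ hslice.symm
    simp_rw [← fourierExt_mul]
    exact (memLp_fourierExt_waveFreq_slice m₁ s₁ hA hA2 p.fst).integrable_mul
      (memLp_fourierExt_waveFreq_slice m₂ s₂ hB hB2 p.fst)
  have key := fourierInv_mul_fourier_slice hr (hA.mul_prod hB) h hslice hi p.snd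
  simp_rw [hh.eq_profile] at key
  rw [spatialMultiplier]
  refine key.trans ?_
  simp_rw [hh.eq_profile]
  rfl

theorem L2Bound.mono {F : SpaceTime n → ℂ} {B B' : ℝ} (h : L2Bound F B) (hB : B ≤ B') :
    L2Bound F B' := ⟨h.1, h.2.trans (ENNReal.ofReal_le_ofReal hB)⟩

theorem L2Bound.of_ae_zero {F : SpaceTime n → ℂ} (h : F =ᵐ[volume] 0) : L2Bound F 0 :=
  ⟨(memLp_congr_ae h).2 MemLp.zero, by rw [eLpNorm_congr_ae h]; simp⟩

theorem ofReal_bilinear_const {H k x y : ℝ} (hH : 0 ≤ H) (hk : 0 ≤ k) (hx : 0 ≤ x) :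
    3 ^ n * (ENNReal.ofReal H * ENNReal.ofReal k ^ (1 / 2 : ℝ) *
      (ENNReal.ofReal x * ENNReal.ofReal y)) =
      ENNReal.ofReal (3 ^ n * H * Real.sqrt k * (x * y)) := by
  rw [ENNReal.ofReal_rpow_of_nonneg hk (by norm_num), ← Real.sqrt_eq_rpow,
    ← ENNReal.ofReal_mul hx, ← ENNReal.ofReal_mul hH, ← ENNReal.ofReal_mul (by positivity),
    show (3 : ℝ≥0∞) ^ n = ENNReal.ofReal (3 ^ n) by
      rw [ENNReal.ofReal_pow (by norm_num)]; norm_num,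
    ← ENNReal.ofReal_mul (by positivity)]
  congr 1
  ring

/-- The high frequency is at least `4 * a * size M` and the low one at most `a * size M`, so their
sum stays above `3 * a * size M`, beyond the support of the symbol. -/
theorem two_size_le_norm_of_separated {a κ : ℝ} (ha : 1 ≤ a) (hκ : 4 * a ^ 2 ≤ κ) {O M N : ℝ}
    (hN : IsDyadic N) (hMN : κ * size M < size N) (hO : size O < size M) {η ζ : Space n}
    (hη : η ∈ freqSet n a M) (hζ : ζ ∈ freqSet n a N) :
    2 * size O ≤ ‖(2 * Real.pi) • (η + ζ)‖ := by
  have hM1 := one_le_size M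
  -- `N = 0` would force `κ * size M < 1`; so the lower bound `N / a` on the annulus is a genuine
  -- one.
  have hNs : size N = N := by
    rcases hN.eq_zero_or_size with h | h
    · have : size N = 1 := by rw [h]; norm_num [size]
      nlinarith
    · exact h
  have h1 : N / a ≤ ‖(2 * Real.pi) • ζ‖ := hζ.1
  have h2 : ‖(2 * Real.pi) • η‖ ≤ a * size M := hη.2
  have h3 : 4 * a * size M ≤ N / a := by
    rw [le_div_iff₀ (by linarith), ← hNs]
    nlinarith
  have h4 : ‖(2 * Real.pi) • ζ‖ ≤ ‖(2 * Real.pi) • (η + ζ)‖ + ‖(2 * Real.pi) • η‖ := by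
    have e : (2 * Real.pi) • ζ = (2 * Real.pi) • (η + ζ) - (2 * Real.pi) • η := by module
    rw [e]
    exact norm_sub_le _ _
  nlinarith

theorem freeProduct_comm (m₁ m₂ : ℝ) (s₁ s₂ : ℤˣ) (φ ψ : L2x n) :
    freeProduct m₁ m₂ s₁ s₂ φ ψ = freeProduct m₂ m₁ s₂ s₁ ψ φ := by
  ext p
  exact mul_comm _ _

theorem map_waveFreq_cube_le (hn : 3 ≤ n) {a : ℝ} (ha : 1 ≤ a) {m₁ : ℝ}
    (hm₁ : 0 < m₁) (m₂ : ℝ) (s₁ s₂ : ℤˣ) {M : ℝ} (hM : IsDyadic M) {R : ℝ} (hR : 0 < R)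
    {T : Set (Space n)} (k : Fin n → ℤ) :
    ((volume.restrict (freqSet n a M ∩ {w | cubeIdx R (waveFreq m₁ s₁ w).snd = k})).prod
      (volume.restrict T)).map
      (fun w => ((s₁ : ℤ) : ℝ) • waveFreq m₁ s₁ w.1 + ((s₂ : ℤ) : ℝ) • waveFreq m₂ s₂ w.2) ≤
      ENNReal.ofReal (2 * Real.pi * shellBound n a m₁ M R) • volume := by
  have hr' : Measurable fun w : Space n × Space n =>
      ((s₁ : ℤ) : ℝ) • waveFreq m₁ s₁ w.1 + ((s₂ : ℤ) : ℝ) • waveFreq m₂ s₂ w.2 := by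
    have h₁ := measurable_waveFreq (n := n) m₁ s₁
    have h₂ := measurable_waveFreq (n := n) m₂ s₂
    fun_prop
  refine le_trans ?_ (map_waveFreq_pair_le hn m₂ ha hm₁ hM hR (fun l => R * k l) s₁ s₂)
  have := map_restrict_prod_restrict_mono (μ := (volume : Measure (Space n)))
    (ν := (volume : Measure (Space n))) hr' (T := T) (T' := Set.univ)
    (S := freqSet n a M ∩ {w | cubeIdx R (waveFreq m₁ s₁ w).snd = k})
    (S' := freqCube n a M R fun l => R * k l)
    (fun η hη => ⟨hη.1, abs_sub_le_of_cubeIdx hR hη.2⟩) (Set.subset_univ _)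
  rwa [Measure.restrict_univ] at this

/-- Only the first factor's size and mass enter, since only its frequencies are confined to cubes in
the density bound; the other version follows by commuting the factors. -/
theorem L2Bound_spatialMultiplier_freeProduct (hn : 3 ≤ n) {a : ℝ} (ha : 1 ≤ a) {m₁ : ℝ}
    (hm₁ : 0 < m₁) (m₂ : ℝ) (s₁ s₂ : ℤˣ) {σ : ℝ → ℝ} {O H : ℝ} (hH : 0 ≤ H)
    {h : SchwartzMap (Space n) ℂ} (hh : IsSymbol σ O H h) {M N : ℝ} (hM : IsDyadic M)
    {φ ψ : L2x n} (hφ : LocalizedAt a M φ) (hψ : LocalizedAt a N ψ) :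
    L2Bound (spatialMultiplier σ (freeProduct m₁ m₂ s₁ s₂ φ ψ))
      (3 ^ n * H * Real.sqrt (2 * Real.pi * shellBound n a m₁ M (size O)) * (‖φ‖ * ‖ψ‖)) := by
  obtain ⟨A, hA, hA2, hAS, hAn, hAw⟩ := hφ.exists_fourierExt m₁ s₁
  obtain ⟨B, hB, hB2, hBS, hBn, hBw⟩ := hψ.exists_fourierExt m₂ s₂
  have hO : 0 < size O := zero_lt_one.trans_le (one_le_size O)
  rw [spatialMultiplier_freeProduct hh hA hA2 hB hB2 hAw hBw]
  have hr : Measurable fun w : Space n × Space n => waveFreq m₁ s₁ w.1 + waveFreq m₂ s₂ w.2 :=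
    ((measurable_waveFreq m₁ s₁).comp measurable_fst).add
      ((measurable_waveFreq m₂ s₂).comp measurable_snd)
  have key := eLpNorm_bilinear_le (measurable_waveFreq m₁ s₁) (measurable_waveFreq m₂ s₂)
    hA hB hA2 hB2 (measurableSet_freqSet n a M) (measurableSet_freqSet n a N) hAS hBS s₁ s₂
    (K := ENNReal.ofReal (2 * Real.pi * shellBound n a m₁ M (size O))) ENNReal.ofReal_ne_top
    hO ?_ (ρ := a * size M) (fun η hη => norm_le_of_mem_freqSet hη)
    (fun A' h1 h2 => Filter.Eventually.of_forall
      (memLp_fourierExt_waveFreq_slice m₁ s₁ h1 h2))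
    (fun A' h1 h2 => Filter.Eventually.of_forall
      (memLp_fourierExt_waveFreq_slice m₂ s₂ h1 h2)) h hh.bound hh.eq_zero_of_lt
  · have hcont := continuous_fourierExt hr
      (integrable_schwartz_mul (measurable_snd_comp hr) (hA.mul_prod hB) h hh.bound)
    have hB := shellBound_pos (n := n) (M := M) ha hm₁ hO
    rw [hAn, hBn, ← ofReal_norm, ← ofReal_norm, ofReal_bilinear_const hH (by positivity)
      (norm_nonneg _)] at key
    exact ⟨⟨hcont.aestronglyMeasurable, key.trans_lt ENNReal.ofReal_lt_top⟩, key⟩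
  · exact fun k => map_waveFreq_cube_le hn ha hm₁ m₂ s₁ s₂ hM hO k

theorem spatialMultiplier_freeProduct_eq_zero {a κ : ℝ} (ha : 1 ≤ a) (hκ : 4 * a ^ 2 ≤ κ)
    (m₁ m₂ : ℝ) (s₁ s₂ : ℤˣ) {σ : ℝ → ℝ} {O H : ℝ} {h : SchwartzMap (Space n) ℂ}
    (hh : IsSymbol σ O H h) {M N : ℝ} (hN : IsDyadic N) (hMN : κ * size M < size N)
    (hO : size O < size M) {φ ψ : L2x n} (hφ : LocalizedAt a M φ) (hψ : LocalizedAt a N ψ) :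
    L2Bound (spatialMultiplier σ (freeProduct m₁ m₂ s₁ s₂ φ ψ)) 0 := by
  obtain ⟨A, hA, hA2, hAS, hAn, hAw⟩ := hφ.exists_fourierExt m₁ s₁
  obtain ⟨B, hB, hB2, hBS, hBn, hBw⟩ := hψ.exists_fourierExt m₂ s₂
  rw [spatialMultiplier_freeProduct hh hA hA2 hB hB2 hAw hBw]
  refine L2Bound.of_ae_zero (Filter.Eventually.of_forall fun z => ?_)
  have : (fun w : Space n × Space n =>
      h (waveFreq m₁ s₁ w.1 + waveFreq m₂ s₂ w.2).snd * (A w.1 * B w.2)) = fun _ => 0 := by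
    ext w
    by_cases h1 : w.1 ∈ freqSet n a M
    · by_cases h2 : w.2 ∈ freqSet n a N
      · rw [hh.eq_zero, zero_mul]
        exact two_size_le_norm_of_separated ha hκ hN hMN hO h1 h2
      · rw [hBS _ h2]; simp
    · rw [hAS _ h1]; simp
  rw [this]
  simp [fourierExt]

end FreeWaves

/-! ### Functions with Fourier support near the characteristic surfaces -/

section ThickSurfaces

variable {n : ℕ}

/-- The thickened surface in terms of Mathlib's frequency variable. -/
def thickSet (n : ℕ) (a M ε m : ℝ) (s : ℤˣ) : Set (SpaceTime n) :=
  {z | (2 * Real.pi) • z ∈ thickSurface n a M ε m s}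

theorem measurableSet_thickSet (n : ℕ) (a M ε m : ℝ) (s : ℤˣ) :
    MeasurableSet (thickSet n a M ε m s) :=
  ((isClosed_thickSurface n a M ε m s).preimage (f := fun z : SpaceTime n => (2 * Real.pi) • z)
    (continuous_const_smul (2 * Real.pi))).measurableSet

theorem snd_mem_freqSet {a M ε m : ℝ} {s : ℤˣ} {z : SpaceTime n} (hz : z ∈ thickSet n a M ε m s) :
    z.snd ∈ freqSet n a M := hz.1

/-- Boundedness of the thickened surface makes the space-time Fourier transform integrable. -/
theorem norm_le_of_mem_thickSet {a M ε m : ℝ} (hm : 0 < m) {s : ℤˣ} {z : SpaceTime n}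
    (hz : z ∈ thickSet n a M ε m s) : ‖z‖ ≤ ε + m + a * size M + a * size M := by
  refine (norm_le_norm_two_pi_smul z).trans ?_
  set y := (2 * Real.pi) • z
  have h1 : ‖y.snd‖ ≤ a * size M := hz.1.2
  have h2 : |y.fst - ((s : ℤ) : ℝ) * bracket m y.snd| ≤ ε := hz.2
  have h3 : |y.fst| ≤ ε + bracket m y.snd := by
    have h4 : |((s : ℤ) : ℝ) * bracket m y.snd| = bracket m y.snd := by
      rw [abs_mul, abs_of_pos (bracket_pos hm _)]
      rcases units_cast_eq s with h | h <;> rw [h] <;> norm_num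
    have := abs_sub_abs_le_abs_sub y.fst (((s : ℤ) : ℝ) * bracket m y.snd)
    linarith
  have h5 := bracket_le hm y.snd
  have h6 : ‖y‖ ≤ |y.fst| + ‖y.snd‖ := by
    rw [WithLp.prod_norm_eq_of_L2, Real.sqrt_le_left (by positivity), Real.norm_eq_abs]
    nlinarith [mul_nonneg (abs_nonneg y.fst) (norm_nonneg y.snd)]
  linarith

theorem memLp_fourierExt_id {V : Type*} [NormedAddCommGroup V] [InnerProductSpace ℝ V]
    [FiniteDimensional ℝ V] [MeasurableSpace V] [BorelSpace V] {A : V → ℂ} (hA : Integrable A)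
    (hA2 : MemLp A 2) : MemLp (fourierExt volume (fun z : V => z) A) 2 := by
  have e : fourierExt volume (fun z : V => z) A = 𝓕⁻ A := by
    ext z
    rw [Real.fourierInv_eq, fourierExt]
  rw [e]
  exact ⟨(continuous_fourierInv_of_integrable hA).aestronglyMeasurable, by
    rw [eLpNorm_fourierInv hA hA2]; exact hA2.2⟩

theorem ae_memLp_slice {f : SpaceTime n → ℂ} (hf : Continuous f) (hf2 : MemLp f 2) :
    ∀ᵐ t : ℝ, MemLp (fun x : Space n => f (WithLp.toLp 2 (t, x))) 2 := by
  have hWm : Measurable fun z => ‖f z‖ₑ ^ 2 := by fun_prop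
  have htoLp := (WithLp.volume_preserving_toLp ℝ (Space n)).measurable
  have hm1 : Measurable fun t : ℝ => ∫⁻ x : Space n, ‖f (WithLp.toLp 2 (t, x))‖ₑ ^ 2 :=
    Measurable.lintegral_prod_right' (f := fun w : ℝ × Space n =>
      ‖f (WithLp.toLp 2 w)‖ₑ ^ 2) (hWm.comp htoLp)
  have hfin : ∫⁻ z, ‖f z‖ₑ ^ 2 ≠ ⊤ := by
    rw [lintegral_enorm_sq]
    exact ENNReal.pow_ne_top hf2.2.ne
  rw [lintegral_spaceTime hWm] at hfin
  filter_upwards [ae_lt_top hm1 hfin] with t ht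
  have hc : Continuous fun x : Space n => f (WithLp.toLp 2 (t, x)) := by fun_prop
  refine ⟨hc.aestronglyMeasurable, ?_⟩
  rw [lintegral_enorm_sq] at ht
  exact (ENNReal.pow_lt_top_iff.1 ht).resolve_right (by norm_num)

theorem ae_ae_slice {P : SpaceTime n → Prop} (h : ∀ᵐ z, P z) :
    ∀ᵐ t : ℝ, ∀ᵐ x : Space n, P (WithLp.toLp 2 (t, x)) := by
  have h1 := (WithLp.volume_preserving_toLp ℝ (Space n)).quasiMeasurePreserving.ae h
  rw [Measure.volume_eq_prod] at h1
  exact Measure.ae_ae_of_ae_prod h1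

theorem ae_of_ae_fst {P : SpaceTime n → Prop} (h : ∀ᵐ t : ℝ, ∀ x, P (WithLp.toLp 2 (t, x))) :
    ∀ᵐ z, P z := by
  have h1 := (WithLp.volume_preserving_ofLp ℝ (Space n)).quasiMeasurePreserving
  rw [Measure.volume_eq_prod] at h1
  filter_upwards [(Measure.quasiMeasurePreserving_fst.comp h1).ae h] with z hz
  exact hz z.snd

theorem FourierSupportedIn.exists_fourierExt {a M ε m : ℝ} (hm : 0 < m) {s : ℤˣ} {u : L2tx n}
    (hu : FourierSupportedIn (thickSurface n a M ε m s) u) :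
    ∃ A : SpaceTime n → ℂ, Integrable A ∧ MemLp A 2 ∧ (∀ z ∉ thickSet n a M ε m s, A z = 0) ∧
      eLpNorm A 2 volume = ‖u‖ₑ ∧ (u : SpaceTime n → ℂ) =ᵐ[volume]
        fourierExt volume (fun z : SpaceTime n => z) A := by
  set A := (thickSet n a M ε m s).indicator (𝓕 u : L2tx n) with hA
  have hms := measurableSet_thickSet n a M ε m s
  have hAe : (𝓕 u : L2tx n) =ᵐ[volume] A := by
    filter_upwards [hu] with η hη
    by_cases h : η ∈ thickSet n a M ε m s
    · rw [hA, Set.indicator_of_mem h]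
    · rw [hA, Set.indicator_of_notMem h, hη h]
  have hAi : Integrable A := integrable_indicator_of_memLp_two (Lp.memLp _) hms
    fun η hη => norm_le_of_mem_thickSet hm hη
  have hA2 : MemLp A 2 := (Lp.memLp _).indicator hms
  refine ⟨A, hAi, hA2, fun η hη => Set.indicator_of_notMem hη _, ?_, ?_⟩
  · rw [← eLpNorm_congr_ae hAe, ← Lp.enorm_def, ← ofReal_norm, ← ofReal_norm, Lp.norm_fourier_eq]
  · have e1 : (𝓕 u : L2tx n) = hA2.toLp A := by
      rw [← (MemLp.toLp_eq_toLp_iff (Lp.memLp (𝓕 u : L2tx n)) hA2).2 hAe, Lp.toLp_coeFn]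
    have e : u = 𝓕⁻ (hA2.toLp A) := by
      rw [← e1]
      exact (FourierTransform.fourierInv_fourier_eq (F := L2tx n) u).symm
    have h1 := coeFn_fourierInv_toLp hAi hA2
    rw [← e] at h1
    filter_upwards [h1] with z hz
    rw [hz, Real.fourierInv_eq, fourierExt]

/-- In contrast to free waves, the L² slices are obtained from Fubini, hence only for almost every
time, and the identity holds almost everywhere. -/
theorem spatialMultiplier_mul_ae {σ : ℝ → ℝ} {O H : ℝ} {h : SchwartzMap (Space n) ℂ}
    (hh : IsSymbol σ O H h) {u v : SpaceTime n → ℂ} {A B : SpaceTime n → ℂ}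
    (hA : Integrable A) (hA2 : MemLp A 2) (hB : Integrable B) (hB2 : MemLp B 2)
    (hu : u =ᵐ[volume] fourierExt volume (fun z : SpaceTime n => z) A)
    (hv : v =ᵐ[volume] fourierExt volume (fun z : SpaceTime n => z) B) :
    spatialMultiplier σ (fun p => u p * v p) =ᵐ[volume]
      fourierExt (volume.prod volume) (fun w : SpaceTime n × SpaceTime n => w.1 + w.2)
        fun w => h (w.1 + w.2).snd * (A w.1 * B w.2) := by
  have hr : Measurable fun w : SpaceTime n × SpaceTime n => w.1 + w.2 := by fun_prop
  have hW : ∀ᵐ z, u z * v z = fourierExt (volume.prod volume)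
      (fun w : SpaceTime n × SpaceTime n => w.1 + w.2) (fun w => A w.1 * B w.2) z := by
    filter_upwards [hu, hv] with z h1 h2
    rw [h1, h2, fourierExt_mul]
  refine ae_of_ae_fst ?_
  filter_upwards [ae_ae_slice hW,
    ae_memLp_slice (continuous_fourierExt measurable_id hA) (memLp_fourierExt_id hA hA2),
    ae_memLp_slice (continuous_fourierExt measurable_id hB) (memLp_fourierExt_id hB hB2)]
    with t h1 h2 h3 x
  have hi : Integrable fun x : Space n =>
      u (WithLp.toLp 2 (t, x)) * v (WithLp.toLp 2 (t, x)) := by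
    refine Integrable.congr ?_ (Filter.EventuallyEq.symm h1)
    refine (h2.integrable_mul h3).congr (Filter.Eventually.of_forall fun x => ?_)
    exact fourierExt_mul volume volume (fun z : SpaceTime n => z) (fun z : SpaceTime n => z) A B _
  have key := fourierInv_mul_fourier_slice hr (hA.mul_prod hB) h h1 hi x
  simp_rw [hh.eq_profile] at key
  rw [spatialMultiplier]
  refine key.trans ?_
  simp_rw [hh.eq_profile]

theorem map_thick_cube_le (hn : 3 ≤ n) {a : ℝ} (ha : 1 ≤ a) {m₁ : ℝ}
    (hm₁ : 0 < m₁) (m₂ : ℝ) (s₁ s₂ : ℤˣ) {M : ℝ} (hM : IsDyadic M) (N : ℝ) {R : ℝ} (hR : 0 < R)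
    {ε₁ ε₂ : ℝ} (hε₁ : 0 < ε₁) (hε₂ : 0 < ε₂) (k : Fin n → ℤ) :
    ((volume.restrict (thickSet n a M ε₁ m₁ s₁ ∩ {w | cubeIdx R w.snd = k})).prod
      (volume.restrict (thickSet n a N ε₂ m₂ s₂))).map
      (fun w => ((s₁ : ℤ) : ℝ) • w.1 + ((s₂ : ℤ) : ℝ) • w.2) ≤
      ENNReal.ofReal (8 * (ε₁ * ε₂) * shellBound n a m₁ M R) • volume := by
  have hr' : Measurable fun w : SpaceTime n × SpaceTime n =>
      ((s₁ : ℤ) : ℝ) • w.1 + ((s₂ : ℤ) : ℝ) • w.2 := by fun_prop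
  refine le_trans (map_restrict_prod_restrict_mono hr'
    (S' := thickCube n a M ε₁ m₁ s₁ R fun l => R * k l)
    (fun z hz => ⟨hz.1, abs_sub_le_of_cubeIdx hR hz.2⟩) subset_rfl) ?_
  exact map_add_restrict_prod_le (measurableSet_thickCube n a M ε₁ m₁ s₁ R _)
    (measurableSet_thickSet n a N ε₂ m₂ s₂) s₁ s₂ fun ζ =>
      volume_thick_inter_le hn m₂ ha hm₁ hM N hR (fun l => R * k l) s₁ s₂ hε₁ hε₂ ζ

theorem L2Bound.congr_ae {F G : SpaceTime n → ℂ} {B : ℝ} (h : F =ᵐ[volume] G) (hG : L2Bound G B) :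
    L2Bound F B := ⟨(memLp_congr_ae h).2 hG.1, (eLpNorm_congr_ae h).trans_le hG.2⟩

theorem L2Bound_spatialMultiplier_mul (hn : 3 ≤ n) {a : ℝ} (ha : 1 ≤ a) {m₁ m₂ : ℝ}
    (hm₁ : 0 < m₁) (hm₂ : 0 < m₂) (s₁ s₂ : ℤˣ) {σ : ℝ → ℝ} {O H : ℝ} (hH : 0 ≤ H)
    {h : SchwartzMap (Space n) ℂ} (hh : IsSymbol σ O H h) {M N : ℝ} (hM : IsDyadic M)
    {ε₁ ε₂ : ℝ} (hε₁ : 0 < ε₁) (hε₂ : 0 < ε₂) {u v : L2tx n}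
    (hu : FourierSupportedIn (thickSurface n a M ε₁ m₁ s₁) u)
    (hv : FourierSupportedIn (thickSurface n a N ε₂ m₂ s₂) v) :
    L2Bound (spatialMultiplier σ fun p => u p * v p)
      (3 ^ n * H * Real.sqrt (8 * (ε₁ * ε₂) * shellBound n a m₁ M (size O)) * (‖u‖ * ‖v‖)) := by
  obtain ⟨A, hA, hA2, hAS, hAn, hAw⟩ := hu.exists_fourierExt hm₁
  obtain ⟨B, hB, hB2, hBS, hBn, hBw⟩ := hv.exists_fourierExt hm₂
  have hO : 0 < size O := zero_lt_one.trans_le (one_le_size O)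
  refine L2Bound.congr_ae (spatialMultiplier_mul_ae hh hA hA2 hB hB2 hAw hBw) ?_
  have hr : Measurable fun w : SpaceTime n × SpaceTime n => w.1 + w.2 := by fun_prop
  have key := eLpNorm_bilinear_le (p := fun z : SpaceTime n => z) (q := fun z : SpaceTime n => z)
    measurable_id measurable_id
    hA hB hA2 hB2 (measurableSet_thickSet n a M ε₁ m₁ s₁) (measurableSet_thickSet n a N ε₂ m₂ s₂)
    hAS hBS s₁ s₂
    (K := ENNReal.ofReal (8 * (ε₁ * ε₂) * shellBound n a m₁ M (size O))) ENNReal.ofReal_ne_top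
    hO (fun k => map_thick_cube_le hn ha hm₁ m₂ s₁ s₂ hM N hO hε₁ hε₂ k)
    (ρ := a * size M) (fun z hz => norm_le_of_mem_freqSet (snd_mem_freqSet hz))
    (fun A' h1 h2 => ae_memLp_slice (continuous_fourierExt measurable_id h1)
      (memLp_fourierExt_id h1 h2))
    (fun A' h1 h2 => ae_memLp_slice (continuous_fourierExt measurable_id h1)
      (memLp_fourierExt_id h1 h2)) h hh.bound hh.eq_zero_of_lt
  have hcont := continuous_fourierExt hr
    (integrable_schwartz_mul (measurable_snd_comp hr) (hA.mul_prod hB) h hh.bound)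
  have hB := shellBound_pos (n := n) (M := M) ha hm₁ hO
  rw [hAn, hBn, ← ofReal_norm, ← ofReal_norm, ofReal_bilinear_const hH (by positivity)
    (norm_nonneg _)] at key
  exact ⟨⟨hcont.aestronglyMeasurable, key.trans_lt ENNReal.ofReal_lt_top⟩, key⟩

theorem L2Bound_spatialMultiplier_mul_zero {a κ : ℝ} (ha : 1 ≤ a) (hκ : 4 * a ^ 2 ≤ κ)
    {m₁ m₂ : ℝ} (hm₁ : 0 < m₁) (hm₂ : 0 < m₂) (s₁ s₂ : ℤˣ) {σ : ℝ → ℝ} {O H : ℝ}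
    {h : SchwartzMap (Space n) ℂ} (hh : IsSymbol σ O H h) {M N : ℝ} (hN : IsDyadic N)
    (hMN : κ * size M < size N) (hO : size O < size M) {ε₁ ε₂ : ℝ} {u v : L2tx n}
    (hu : FourierSupportedIn (thickSurface n a M ε₁ m₁ s₁) u)
    (hv : FourierSupportedIn (thickSurface n a N ε₂ m₂ s₂) v) :
    L2Bound (spatialMultiplier σ fun p => u p * v p) 0 := by
  obtain ⟨A, hA, hA2, hAS, hAn, hAw⟩ := hu.exists_fourierExt hm₁
  obtain ⟨B, hB, hB2, hBS, hBn, hBw⟩ := hv.exists_fourierExt hm₂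
  refine L2Bound.congr_ae (spatialMultiplier_mul_ae hh hA hA2 hB hB2 hAw hBw)
    (L2Bound.of_ae_zero (Filter.Eventually.of_forall fun z => ?_))
  have : (fun w : SpaceTime n × SpaceTime n =>
      h (w.1 + w.2).snd * (A w.1 * B w.2)) = fun _ => 0 := by
    ext w
    by_cases h1 : w.1 ∈ thickSet n a M ε₁ m₁ s₁
    · by_cases h2 : w.2 ∈ thickSet n a N ε₂ m₂ s₂
      · rw [hh.eq_zero, zero_mul]
        exact two_size_le_norm_of_separated ha hκ hN hMN hO (snd_mem_freqSet h1)
          (snd_mem_freqSet h2)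
      · rw [hBS _ h2]; simp
    · rw [hAS _ h1]; simp
  rw [this]
  simp [fourierExt]

end ThickSurfaces

/-! ### Comparison of the frequency sizes and the final estimates -/

section Conclusion

variable {n : ℕ}

theorem low_pos (O M N : ℝ) : 0 < low O M N :=
  lt_min (zero_lt_one.trans_le (one_le_size O)) (lt_min (zero_lt_one.trans_le (one_le_size M))
    (zero_lt_one.trans_le (one_le_size N)))

theorem sqrt_pow_eq_rpow (hn : 2 ≤ n) {L : ℝ} (hL : 0 < L) :
    Real.sqrt (L ^ (n - 2)) = L ^ (((n : ℝ) - 2) / 2) := by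
  rw [Real.sqrt_eq_rpow, ← Real.rpow_natCast, ← Real.rpow_mul hL.le]
  congr 1
  push_cast [hn]
  ring

theorem sqrt_mul_pow_eq_rpow (hn : 2 ≤ n) {L : ℝ} (hL : 0 < L) :
    Real.sqrt (L * L ^ (n - 2)) = L ^ (((n : ℝ) - 1) / 2) := by
  rw [Real.sqrt_mul hL.le, sqrt_pow_eq_rpow hn hL, Real.sqrt_eq_rpow, ← Real.rpow_add hL]
  congr 1
  ring

/-- The case distinction which turns the bilinear estimates with either factor as the one of
lower frequency into the claimed estimates. -/
theorem L2Bound_of_cases (hn : 3 ≤ n) {κ : ℝ} (hκ : 1 ≤ κ) {O M N c E : ℝ} (hc : 0 ≤ c)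
    (hE : 0 ≤ E) {F : SpaceTime n → ℂ}
    (h₁ : L2Bound F (c * Real.sqrt (size M * min (size O) (size M) ^ (n - 2)) * E))
    (h₂ : L2Bound F (c * Real.sqrt (size N * min (size O) (size N) ^ (n - 2)) * E))
    (h₀ : κ * size M < size N → size O < size M → L2Bound F 0)
    (h₀' : κ * size N < size M → size O < size N → L2Bound F 0) :
    (Comparable κ M N → L2Bound F (c * Real.sqrt (κ ^ (n - 2)) *
      (high O M N ^ ((1 : ℝ) / 2) * low O M N ^ (((n : ℝ) - 2) / 2) * E))) ∧
    (¬ Comparable κ M N → L2Bound F (c * Real.sqrt (κ ^ (n - 2)) *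
      (low O M N ^ (((n : ℝ) - 1) / 2) * E))) := by
  have hO1 := one_le_size O
  have hM1 := one_le_size M
  have hN1 := one_le_size N
  have hL := low_pos O M N
  constructor
  · rintro ⟨hMN, -⟩
    refine h₁.mono ?_
    have hH : size M ≤ high O M N := (le_max_left _ _).trans (le_max_right _ _)
    -- Replacing `size M` by `size N` inside the minimum costs a factor `κ`, whence the constant
    -- `√(κ ^ (n - 2))`.
    have hmin : min (size O) (size M) ≤ κ * low O M N := by
      rw [low, mul_min_of_nonneg _ _ (by linarith), mul_min_of_nonneg _ _ (by linarith)]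
      refine le_min ?_ (le_min ?_ ?_)
      · exact (min_le_left _ _).trans (by nlinarith)
      · exact (min_le_right _ _).trans (by nlinarith)
      · exact (min_le_right _ _).trans hMN
    have hmin0 : 0 ≤ min (size O) (size M) := le_min (by linarith) (by linarith)
    rw [← sqrt_pow_eq_rpow (by omega) hL, ← Real.sqrt_eq_rpow]
    have key : Real.sqrt (size M * min (size O) (size M) ^ (n - 2)) ≤
        Real.sqrt (κ ^ (n - 2)) * (Real.sqrt (high O M N) * Real.sqrt (low O M N ^ (n - 2))) := by
      rw [← Real.sqrt_mul (by linarith), ← Real.sqrt_mul (by positivity)]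
      refine Real.sqrt_le_sqrt ?_
      calc _ ≤ high O M N * (κ * low O M N) ^ (n - 2) := by gcongr; linarith
        _ = _ := by rw [mul_pow]; ring
    calc _ ≤ c * (Real.sqrt (κ ^ (n - 2)) *
          (Real.sqrt (high O M N) * Real.sqrt (low O M N ^ (n - 2)))) * E := by gcongr
      _ = _ := by ring
  · intro hMN
    -- Without comparability this factor is superfluous; being at least `1`, it can be carried along
    -- to keep one constant.
    have hκs : 1 ≤ Real.sqrt (κ ^ (n - 2)) := by
      rw [Real.one_le_sqrt]; exact one_le_pow₀ hκ
    have hpos : 0 ≤ c * Real.sqrt (κ ^ (n - 2)) * (low O M N ^ (((n : ℝ) - 1) / 2) * E) := by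
      positivity
    -- `Q` is the lower input size when `size O` is not below it: then `Q` is the smallest of the
    -- three, and `Q * Q ^ (n - 2)` gives the exponent `(n - 1) / 2`.
    have hstep : ∀ Q, low O M N = Q → min (size O) Q = Q →
        c * Real.sqrt (Q * min (size O) Q ^ (n - 2)) * E ≤
        c * Real.sqrt (κ ^ (n - 2)) * (low O M N ^ (((n : ℝ) - 1) / 2) * E) := by
      intro Q hQ hmQ
      rw [hmQ, ← hQ, sqrt_mul_pow_eq_rpow (by omega) hL]
      have : 0 ≤ c * (low O M N ^ (((n : ℝ) - 1) / 2) * E) := by positivity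
      nlinarith
    rw [Comparable, not_and_or, not_le, not_le] at hMN
    rcases hMN with hMN | hMN
    · rcases lt_or_ge (size O) (size N) with h | h
      · exact (h₀' hMN h).mono hpos
      · refine h₂.mono (hstep _ ?_ (min_eq_right h))
        rw [low, min_eq_right (by nlinarith : size N ≤ size M), min_eq_right h]
    · rcases lt_or_ge (size O) (size M) with h | h
      · exact (h₀ hMN h).mono hpos
      · refine h₁.mono (hstep _ ?_ (min_eq_right h))
        rw [low, min_eq_left (by nlinarith : size M ≤ size N), min_eq_right h]

/-- Separates constants from frequency sizes; `b` stands for `2 * π` with free waves and for `8 *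
(ε₁ * ε₂)` with thickened surfaces. -/
theorem sqrt_shellBound_le {a m d : ℝ} (ha : 1 ≤ a) (hm : 0 < m) (hd : shellConst n a m + 1 ≤ d)
    (M O : ℝ) {b : ℝ} (hb : 0 ≤ b) : Real.sqrt (b * shellBound n a m M (size O)) ≤
      Real.sqrt (b * d) * Real.sqrt (size M * min (size O) (size M) ^ (n - 2)) := by
  have hC := shellConst_nonneg (n := n) ha hm
  have hM1 := one_le_size M
  have hmin0 : 0 ≤ min (size O) (size M) := le_min (by linarith [one_le_size O]) (by linarith)
  rw [← Real.sqrt_mul (mul_nonneg hb (by linarith))]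
  refine Real.sqrt_le_sqrt ?_
  rw [shellBound]
  calc _ = b * (shellConst n a m + 1) * (size M * min (size O) (size M) ^ (n - 2)) := by ring
    _ ≤ _ := by gcongr

end Conclusion

end KG

theorem mainTheorem5 (n : ℕ) (hn : 3 ≤ n) (a : ℝ) (ha : 1 ≤ a) :
    ∃ κ₀ : ℝ, ∀ κ : ℝ, κ₀ ≤ κ → ∀ χ : ℝ → ℝ, KG.IsCutoff χ →
      ∀ m₁ m₂ : ℝ, 0 < m₁ → 0 < m₂ → ∃ C : ℝ,
        -- free waves
        (∀ (s₁ s₂ : ℤˣ) (O M N : ℝ), KG.IsDyadic O → KG.IsDyadic M → KG.IsDyadic N →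
          ∀ φ ψ : KG.L2x n, KG.LocalizedAt a M φ → KG.LocalizedAt a N ψ →
            (KG.Comparable κ M N →
              KG.L2Bound (KG.proj χ O (KG.freeProduct m₁ m₂ s₁ s₂ φ ψ))
                (C * (KG.high O M N ^ ((1 : ℝ) / 2) * KG.low O M N ^ (((n : ℝ) - 2) / 2)
                  * ‖φ‖ * ‖ψ‖)) ∧
              KG.L2Bound (KG.projLow χ O (KG.freeProduct m₁ m₂ s₁ s₂ φ ψ))
                (C * (KG.high O M N ^ ((1 : ℝ) / 2) * KG.low O M N ^ (((n : ℝ) - 2) / 2)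
                  * ‖φ‖ * ‖ψ‖))) ∧
            (¬ KG.Comparable κ M N →
              KG.L2Bound (KG.proj χ O (KG.freeProduct m₁ m₂ s₁ s₂ φ ψ))
                (C * (KG.low O M N ^ (((n : ℝ) - 1) / 2) * ‖φ‖ * ‖ψ‖)) ∧
              KG.L2Bound (KG.projLow χ O (KG.freeProduct m₁ m₂ s₁ s₂ φ ψ))
                (C * (KG.low O M N ^ (((n : ℝ) - 1) / 2) * ‖φ‖ * ‖ψ‖)))) ∧
        -- functions with Fourier support in thickened characteristic surfaces
        (∀ (s₁ s₂ : ℤˣ) (O M N : ℝ), KG.IsDyadic O → KG.IsDyadic M → KG.IsDyadic N →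
          1 < O → 1 < M → 1 < N →
          ∀ ε₁ ε₂ : ℝ, 0 < ε₁ → 0 < ε₂ →
          ∀ u v : KG.L2tx n,
            KG.FourierSupportedIn (KG.thickSurface n a M ε₁ m₁ s₁) u →
            KG.FourierSupportedIn (KG.thickSurface n a N ε₂ m₂ s₂) v →
            (KG.Comparable κ M N →
              KG.L2Bound (KG.projLow χ O (fun p => u p * v p))
                (C * ((ε₁ * ε₂) ^ ((1 : ℝ) / 2) * KG.high O M N ^ ((1 : ℝ) / 2)
                  * KG.low O M N ^ (((n : ℝ) - 2) / 2) * ‖u‖ * ‖v‖))) ∧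
            (¬ KG.Comparable κ M N → κ ≤ M → κ ≤ N →
              KG.L2Bound (KG.projLow χ O (fun p => u p * v p))
                (C * ((ε₁ * ε₂) ^ ((1 : ℝ) / 2) * KG.low O M N ^ (((n : ℝ) - 1) / 2)
                  * ‖u‖ * ‖v‖)))) := by
  -- This threshold is the one demanded by `two_size_le_norm_of_separated`.
  refine ⟨4 * a ^ 2, fun κ hκ χ hχ m₁ m₂ hm₁ hm₂ => ?_⟩
  have hκ1 : 1 ≤ κ := by nlinarith
  obtain ⟨H, hH, hsym⟩ := KG.exists_symbols n hχ
  have hc₁ := KG.shellConst_nonneg (n := n) ha hm₁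
  have hc₂ := KG.shellConst_nonneg (n := n) ha hm₂
  -- One constant for both masses, because either factor may have to play the low-frequency role.
  set d := KG.shellConst n a m₁ + KG.shellConst n a m₂ + 1 with hd
  have hd₁ : KG.shellConst n a m₁ + 1 ≤ d := by linarith
  have hd₂ : KG.shellConst n a m₂ + 1 ≤ d := by linarith
  have hd0 : 0 ≤ d := by linarith
  set c := 3 ^ n * H * Real.sqrt (8 * d) with hc
  have hc0 : 0 ≤ c := by positivity
  -- The `8` of the thickened estimate also dominates the `2 * π` of the free one.
  have h8 : Real.sqrt (2 * Real.pi * d) ≤ Real.sqrt (8 * d) :=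
    Real.sqrt_le_sqrt (by nlinarith [Real.pi_lt_four])
  refine ⟨c * Real.sqrt (κ ^ (n - 2)), ?_, ?_⟩
  · intro s₁ s₂ O M N hO hM hN φ ψ hφ hψ
    have main : ∀ σ : ℝ → ℝ, (∃ h : SchwartzMap (KG.Space n) ℂ, KG.IsSymbol σ O H h) →
        (KG.Comparable κ M N → KG.L2Bound
          (KG.spatialMultiplier σ (KG.freeProduct m₁ m₂ s₁ s₂ φ ψ))
          (c * Real.sqrt (κ ^ (n - 2)) * (KG.high O M N ^ ((1 : ℝ) / 2) *
            KG.low O M N ^ (((n : ℝ) - 2) / 2) * (‖φ‖ * ‖ψ‖)))) ∧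
        (¬ KG.Comparable κ M N → KG.L2Bound
          (KG.spatialMultiplier σ (KG.freeProduct m₁ m₂ s₁ s₂ φ ψ))
          (c * Real.sqrt (κ ^ (n - 2)) * (KG.low O M N ^ (((n : ℝ) - 1) / 2) *
            (‖φ‖ * ‖ψ‖)))) := by
      rintro σ ⟨h, hh⟩
      have hle : ∀ m M', 0 < m → KG.shellConst n a m + 1 ≤ d →
          3 ^ n * H * Real.sqrt (2 * Real.pi * KG.shellBound n a m M' (KG.size O)) *
            (‖φ‖ * ‖ψ‖) ≤
          c * Real.sqrt (KG.size M' * min (KG.size O) (KG.size M') ^ (n - 2)) *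
            (‖φ‖ * ‖ψ‖) := by
        intro m M' hm hmd
        refine mul_le_mul_of_nonneg_right ?_ (by positivity)
        rw [hc, mul_assoc (3 ^ n * H)]
        refine mul_le_mul_of_nonneg_left ?_ (by positivity)
        refine (KG.sqrt_shellBound_le ha hm hmd M' O (by positivity)).trans ?_
        exact mul_le_mul_of_nonneg_right h8 (Real.sqrt_nonneg _)
      refine KG.L2Bound_of_cases hn hκ1 hc0 (by positivity)
        ((KG.L2Bound_spatialMultiplier_freeProduct hn ha hm₁ m₂ s₁ s₂ hH hh hM hφ hψ).mono
          (hle m₁ M hm₁ hd₁)) ?_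
        (fun h1 h2 => KG.spatialMultiplier_freeProduct_eq_zero ha hκ m₁ m₂ s₁ s₂ hh hN h1 h2
          hφ hψ) (fun h1 h2 => ?_)
      · rw [KG.freeProduct_comm]
        have := KG.L2Bound_spatialMultiplier_freeProduct hn ha hm₂ m₁ s₂ s₁ hH hh hN hψ hφ
        rw [mul_comm ‖ψ‖] at this
        exact this.mono (hle m₂ N hm₂ hd₂)
      · rw [KG.freeProduct_comm]
        exact KG.spatialMultiplier_freeProduct_eq_zero ha hκ m₂ m₁ s₂ s₁ hh hM h1 h2 hψ hφ
    obtain ⟨hs₁, hs₂⟩ := hsym O hO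
    simp only [mul_assoc] at main ⊢
    exact ⟨fun hcomp => ⟨(main _ hs₁).1 hcomp, (main _ hs₂).1 hcomp⟩,
      fun hcomp => ⟨(main _ hs₁).2 hcomp, (main _ hs₂).2 hcomp⟩⟩
  · intro s₁ s₂ O M N hO hM hN _ _ _ ε₁ ε₂ hε₁ hε₂ u v hu hv
    obtain ⟨-, h, hh⟩ := hsym O hO
    have hε : 0 ≤ ε₁ * ε₂ := by positivity
    have hle : ∀ m M', 0 < m → KG.shellConst n a m + 1 ≤ d →
        3 ^ n * H * Real.sqrt (8 * (ε₁ * ε₂) * KG.shellBound n a m M' (KG.size O)) *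
          (‖u‖ * ‖v‖) ≤
        c * Real.sqrt (KG.size M' * min (KG.size O) (KG.size M') ^ (n - 2)) *
          ((ε₁ * ε₂) ^ ((1 : ℝ) / 2) * (‖u‖ * ‖v‖)) := by
      intro m M' hm hmd
      rw [← mul_assoc (c * _)]
      refine mul_le_mul_of_nonneg_right ?_ (by positivity)
      rw [hc, ← Real.sqrt_eq_rpow, mul_assoc (3 ^ n * H), mul_assoc (3 ^ n * H)]
      refine mul_le_mul_of_nonneg_left ?_ (by positivity)
      refine (KG.sqrt_shellBound_le ha hm hmd M' O (by positivity)).trans_eq ?_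
      rw [mul_right_comm 8, Real.sqrt_mul (by positivity) (ε₁ * ε₂)]
      ring
    have main := KG.L2Bound_of_cases hn hκ1 (O := O) (M := M) (N := N) hc0
      (E := (ε₁ * ε₂) ^ ((1 : ℝ) / 2) * (‖u‖ * ‖v‖)) (by positivity)
      (F := KG.projLow χ O (fun p => u p * v p))
      ((KG.L2Bound_spatialMultiplier_mul hn ha hm₁ hm₂ s₁ s₂ hH hh hM hε₁ hε₂ hu hv).mono
        (hle m₁ M hm₁ hd₁)) ?_
      (fun h1 h2 => KG.L2Bound_spatialMultiplier_mul_zero ha hκ hm₁ hm₂ s₁ s₂ hh hN h1 h2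
        hu hv) (fun h1 h2 => ?_)
    · refine ⟨fun hcomp => (main.1 hcomp).mono (le_of_eq ?_),
        fun hcomp _ _ => (main.2 hcomp).mono (le_of_eq ?_)⟩ <;> ring
    · simp_rw [mul_comm (u _)]
      have := KG.L2Bound_spatialMultiplier_mul hn ha hm₂ hm₁ s₂ s₁ hH hh hN hε₂ hε₁ hv hu
      rw [mul_comm ‖v‖, mul_comm ε₂] at this
      exact this.mono (hle m₂ N hm₂ hd₂)
    · simp_rw [mul_comm (u _)]
      exact KG.L2Bound_spatialMultiplier_mul_zero ha hκ hm₂ hm₁ s₂ s₁ hh hM h1 h2 hv hu
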